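/- Let $h(x)=(2\pi)^{-1/2}e^{-x^2/2}$ and, for $t\in\mathbb R$ and $\eta>0$, let $h_{t,\eta}(s)=h(s-t)e^{-2\pi i\eta(s-t)}$. Let $\Phi$ be a complex Gaussian white noise on a probability space: a stationary generalized random process (an almost surely linear map from $\mathcal S(\mathbb R;\mathbb C)$ to complex random variables, continuous in the sense of finite-dimensional distributions) whose finite-dimensional distributions are centred and jointly Gaussian, with $$\mathbb E[\Phi(\varphi)\overline{\Phi(\psi)}]=\int_{\mathbb R}\hat\varphi(x)\overline{\hat\psi(x)}\,dx,\qquad \mathbb E[\Phi(\varphi)\Phi(\psi)]=\int_{\mathbb R}\hat\varphi(x)\hat\psi(-x)\,dx .$$ Let $f(s)=Ae^{2\pi i\xi_0 s}$ with $A\ge 0$ and $\xi_0>0$. Fix $t\in\mathbb R$ and $\xi>0$. For $\alpha,\eta>0$ put $$V_\eta=\int_{\mathbb R} f(s)h_{t,\eta}(s)\,ds+\Phi(h_{t,\eta}),\qquad \partial_tV_\eta=\partial_t\!\int_{\mathbb R} f(s)h_{t,\eta}(s)\,ds+\Phi(\partial_t h_{t,\eta}),$$ $$\Omega_\eta=\frac{1}{2\pi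 i}\frac{\partial_tV_\eta}{V_\eta},\qquad Y_{\alpha,\eta}=V_\eta\,\frac{1}{\pi\alpha}\,e^{-|\xi-\Omega_\eta|^2/\alpha}$$ (with $Y_{\alpha,\eta}=0$ where $V_\eta=0$), and write $\mathrm{Cov}(X,Z)=\mathbb E[(X-\mathbb EX)\overline{(Z-\mathbb EZ)}]$. Then: 1. For every $\alpha>0$, $Y_{\alpha,\eta}$ is square integrable for all $\eta>0$, and $\mathrm{Cov}(Y_{\alpha,\eta},Y_{\alpha,\eta'})$ and $\mathrm{Cov}(Y_{\alpha,\eta},\overline{Y_{\alpha,\eta'}})$ are continuous functions of $(\eta,\eta')\in(0,\infty)^2$. 2. There are $\alpha_0>0$ and a function $K:(0,\infty)^2\to\mathbb R$ such that for all distinct $\eta,\eta'>0$ and all $0<\alpha<\alpha_0$, $$|\mathrm{Cov}(Y_{\alpha,\eta},Y_{\alpha,\eta'})|\le K(\eta,\eta')\,\alpha^{-1},\qquad |\mathrm{Cov}(Y_{\alpha,\eta},\overline{Y_{\alpha,\eta'}})|\le K(\eta,\eta')\,\alpha^{-1},$$ where $K$ satisfies: (a) for every $\delta>0$ there are $D,C$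 with $K(\eta,\eta')\le C(\eta+\eta')^2e^{-(\eta-\eta')^2}$ whenever $\eta,\eta'\ge\delta$ and $|\eta-\eta'|\ge D$; (b) there are $\delta>0$ and $D,C$ with $K(\eta,\eta')\le C(\eta+\eta')^2\eta^{-1/2}e^{-(\eta-\eta')^2}$ whenever $0<\eta<\delta$, $\eta'>0$ and $|\eta-\eta'|\ge D$; (c) there are $\delta>0$ and $D,C$ with $K(\eta,\eta')\le C(\eta+\eta')^2\eta'^{-1/2}e^{-(\eta-\eta')^2}$ whenever $\eta>0$, $0<\eta'<\delta$ and $|\eta-\eta'|\ge D$. -/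

import Mathlib

open MeasureTheory ProbabilityTheory Filter Topology
open scoped SchwartzMap FourierTransform ComplexConjugate

namespace SST

/-! ### The Gaussian window as a Schwartz function -/

theorem exists_bound_poly_mul_gaussian (p : Polynomial ℝ) :
    ∃ C : ℝ, ∀ x : ℝ, |p.eval x| * Real.exp (-(x ^ 2 / 2)) ≤ C := by
  induction p using Polynomial.induction_on' with
  | add p q hp hq =>
    obtain ⟨C, hC⟩ := hp
    obtain ⟨D, hD⟩ := hq
    refine ⟨C + D, fun x => ?_⟩
    have h1 : |(p + q).eval x| ≤ |p.eval x| + |q.eval x| := by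
      rw [Polynomial.eval_add]; exact abs_add_le _ _
    have h2 := mul_le_mul_of_nonneg_right h1 (Real.exp_pos (-(x ^ 2 / 2))).le
    linarith [hC x, hD x]
  | monomial m a =>
    refine ⟨|a| * (1 + 2 ^ m * (m.factorial : ℝ)), fun x => ?_⟩
    rw [Polynomial.eval_monomial, abs_mul, mul_assoc]
    refine mul_le_mul_of_nonneg_left ?_ (abs_nonneg a)
    have h1 : |x ^ m| ≤ 1 + x ^ (2 * m) := by
      have : x ^ (2 * m) = |x ^ m| ^ 2 := by rw [sq_abs]; ring
      rw [this]; nlinarith [sq_nonneg (|x ^ m| - 1), abs_nonneg (x ^ m)]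
    have h2 : (x ^ 2 / 2) ^ m ≤ (m.factorial : ℝ) * Real.exp (x ^ 2 / 2) := by
      have := Real.pow_div_factorial_le_exp (x ^ 2 / 2) (by positivity) m
      rw [div_le_iff₀ (by positivity)] at this
      linarith
    have h3 : x ^ (2 * m) = 2 ^ m * (x ^ 2 / 2) ^ m := by
      rw [← mul_pow, pow_mul]; congr 1; ring
    have h4 : Real.exp (x ^ 2 / 2) * Real.exp (-(x ^ 2 / 2)) = 1 := by
      rw [← Real.exp_add]; simp
    have h5 : Real.exp (-(x ^ 2 / 2)) ≤ 1 := Real.exp_le_one_iff.2 (by nlinarith [sq_nonneg x])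
    have hpos := Real.exp_pos (-(x ^ 2 / 2))
    calc |x ^ m| * Real.exp (-(x ^ 2 / 2))
        ≤ (1 + 2 ^ m * ((m.factorial : ℝ) * Real.exp (x ^ 2 / 2))) * Real.exp (-(x ^ 2 / 2)) := by
          refine mul_le_mul_of_nonneg_right (h1.trans ?_) hpos.le
          rw [h3]; gcongr
      _ = Real.exp (-(x ^ 2 / 2)) + 2 ^ m * (m.factorial : ℝ) *
            (Real.exp (x ^ 2 / 2) * Real.exp (-(x ^ 2 / 2))) := by ring
      _ ≤ 1 + 2 ^ m * (m.factorial : ℝ) := by rw [h4]; linarith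

/-- The real Schwartz function `x ↦ e^{-x²/2}`. -/
noncomputable def gaussianSchwartz : 𝓢(ℝ, ℝ) where
  toFun x := Real.exp (-(x ^ 2 / 2))
  smooth' := by fun_prop
  decay' k n := by
    obtain ⟨C, hC⟩ := exists_bound_poly_mul_gaussian
      (Polynomial.X ^ k * (Polynomial.hermite n).map (Int.castRingHom ℝ))
    refine ⟨C, fun x => ?_⟩
    have h := hC x
    rw [norm_iteratedFDeriv_eq_norm_iteratedDeriv, iteratedDeriv_eq_iterate,
      Polynomial.deriv_gaussian_eq_hermite_mul_gaussian]
    rw [Polynomial.eval_mul, Polynomial.eval_pow, Polynomial.eval_X, Polynomial.eval_map,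
      abs_mul, abs_pow] at h
    rw [norm_mul, norm_mul, norm_pow, norm_neg, norm_one, one_pow, one_mul, Real.norm_eq_abs,
      Real.norm_eq_abs, Real.norm_eq_abs, abs_of_pos (Real.exp_pos _), ← mul_assoc]
    exact h

/-- The window `h(x) = (2π)^{-1/2} e^{-x²/2}`. -/
noncomputable def gaussianWindow : 𝓢(ℝ, ℂ) :=
  ((Real.sqrt (2 * Real.pi))⁻¹ : ℝ) • gaussianSchwartz.postcompCLM Complex.ofRealCLM

theorem gaussianWindow_apply (x : ℝ) :
    gaussianWindow x = (((Real.sqrt (2 * Real.pi))⁻¹ * Real.exp (-(x ^ 2 / 2)) : ℝ) : ℂ) := by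
  change ((Real.sqrt (2 * Real.pi))⁻¹ : ℝ) • ((Real.exp (-(x ^ 2 / 2)) : ℝ) : ℂ) = _
  rw [Complex.real_smul, Complex.ofReal_mul]

/-! ### Time-frequency shifts of a window -/

/-- The character `s ↦ e^{-2πiηs}`. -/
noncomputable def modulation (η : ℝ) (s : ℝ) : ℂ :=
  Complex.exp (-(2 * Real.pi * Complex.I * η) * s)

theorem iteratedDeriv_modulation (η : ℝ) (n : ℕ) :
    iteratedDeriv n (modulation η)
      = fun s => (-(2 * Real.pi * Complex.I * η)) ^ n * modulation η s := by
  induction n with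
  | zero => simp
  | succ n ih =>
    rw [iteratedDeriv_succ, ih]
    funext s
    have h1 : HasDerivAt (fun s : ℝ => -(2 * Real.pi * Complex.I * η) * (s : ℂ))
        (-(2 * Real.pi * Complex.I * η) * 1) s :=
      (Complex.ofRealCLM.hasDerivAt (x := s)).const_mul _
    have h2 := (h1.cexp.const_mul ((-(2 * Real.pi * Complex.I * η)) ^ n)).deriv
    simp only [modulation]
    rw [h2]; ring

theorem norm_modulation (η s : ℝ) : ‖modulation η s‖ = 1 := by
  have : modulation η s = Complex.exp (((-(2 * Real.pi * η * s) : ℝ) : ℂ) * Complex.I) := by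
    simp only [modulation]; congr 1; push_cast; ring
  rw [this, Complex.norm_exp_ofReal_mul_I]

theorem modulation_hasTemperateGrowth (η : ℝ) : (modulation η).HasTemperateGrowth := by
  refine ⟨?_, fun n => ⟨0, ‖(-(2 * Real.pi * Complex.I * η) : ℂ)‖ ^ n, fun x => ?_⟩⟩
  · unfold modulation
    exact Complex.contDiff_exp.comp (contDiff_const.mul Complex.ofRealCLM.contDiff)
  · rw [norm_iteratedFDeriv_eq_norm_iteratedDeriv, iteratedDeriv_modulation, norm_mul, norm_pow,
      norm_modulation, pow_zero]

/-- `h_{t,η}(s) = h(s - t) e^{-2πiη(s - t)}`. -/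
noncomputable def atom (h : 𝓢(ℝ, ℂ)) (t η : ℝ) : 𝓢(ℝ, ℂ) :=
  (SchwartzMap.smulLeftCLM ℂ (modulation η) h).compSubConstCLM ℂ t

theorem atom_apply (h : 𝓢(ℝ, ℂ)) (t η s : ℝ) :
    atom h t η s = h (s - t) * Complex.exp (-(2 * Real.pi * Complex.I * η) * ((s - t : ℝ) : ℂ)) := by
  rw [atom, SchwartzMap.compSubConstCLM_apply,
    SchwartzMap.smulLeftCLM_apply_apply (modulation_hasTemperateGrowth η), smul_eq_mul, mul_comm]
  rfl

/-- `∂ₜ h_{t,η}`, which is `-∂ₛ h_{t,η}` because `h_{t,η}(s)` depends on `s - t` only. -/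
noncomputable def dtAtom (h : 𝓢(ℝ, ℂ)) (t η : ℝ) : 𝓢(ℝ, ℂ) :=
  -SchwartzMap.derivCLM ℂ ℂ (atom h t η)

theorem hasDerivAt_atom (h : 𝓢(ℝ, ℂ)) (t η s : ℝ) :
    HasDerivAt (fun τ => atom h τ η s) (dtAtom h t η s) t := by
  set g : 𝓢(ℝ, ℂ) := SchwartzMap.smulLeftCLM ℂ (modulation η) h with hg
  have h1 : HasDerivAt (fun x : ℝ => g x) (deriv g (s - t)) (s - t) :=
    g.differentiableAt.hasDerivAt
  have h2 : dtAtom h t η s = -deriv g (s - t) := by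
    change -(deriv (fun x => g (x - t)) s) = _
    rw [deriv_comp_sub_const]
  rw [h2]
  exact h1.comp_const_sub s t

/-! ### Complex Gaussian white noise -/

section Noise

variable {Ω : Type*} [MeasurableSpace Ω]

/-- A generalized random process: an (almost surely) linear map from test functions to complex
random variables which is continuous in the sense of finite-dimensional distributions. -/
structure IsGeneralizedRandomProcess (Φ : 𝓢(ℝ, ℂ) → Ω → ℂ) (P : Measure Ω)
    [IsProbabilityMeasure P] : Prop where
  aemeasurable : ∀ φ, AEMeasurable (Φ φ) P
  linear : ∀ (a b : ℂ) (φ ψ : 𝓢(ℝ, ℂ)),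
    Φ (a • φ + b • ψ) =ᵐ[P] fun ω => a * Φ φ ω + b * Φ ψ ω
  continuous : ∀ (n : ℕ) (φ : ℕ → Fin n → 𝓢(ℝ, ℂ)) (ψ : Fin n → 𝓢(ℝ, ℂ)),
    Tendsto φ atTop (𝓝 ψ) →
      TendstoInDistribution (fun k ω i => Φ (φ k i) ω) atTop (fun ω i => Φ (ψ i) ω)
        (fun _ => P) P

/-- Stationarity: translating all the test functions does not change the joint distributions. -/
def IsStationary (Φ : 𝓢(ℝ, ℂ) → Ω → ℂ) (P : Measure Ω) : Prop :=
  ∀ (n : ℕ) (φ : Fin n → 𝓢(ℝ, ℂ)) (a : ℝ),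
    IdentDistrib (fun ω i => Φ ((φ i).compSubConstCLM ℂ a) ω) (fun ω i => Φ (φ i) ω) P P

/-- Complex Gaussian white noise: a stationary generalized random process with centred, jointly
Gaussian (over `ℝ`, possibly degenerate) finite-dimensional distributions, whose power spectrum is
Lebesgue measure: the covariance functional is `B(φ,ψ) = ∫ φ̂(ξ) conj(ψ̂(ξ)) dξ` and the
pseudocovariance functional is `B(φ, conj ψ) = ∫ φ̂(ξ) ψ̂(-ξ) dξ`. -/
structure IsComplexGaussianWhiteNoise (Φ : 𝓢(ℝ, ℂ) → Ω → ℂ) (P : Measure Ω)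
    [IsProbabilityMeasure P] : Prop where
  grp : IsGeneralizedRandomProcess Φ P
  stationary : IsStationary Φ P
  gaussian : IsGaussianProcess Φ P
  mean : ∀ φ, ∫ ω, Φ φ ω ∂P = 0
  covariance : ∀ φ ψ, ∫ ω, Φ φ ω * conj (Φ ψ ω) ∂P = ∫ ξ : ℝ, 𝓕 φ ξ * conj (𝓕 ψ ξ)
  pseudocovariance : ∀ φ ψ, ∫ ω, Φ φ ω * Φ ψ ω ∂P = ∫ ξ : ℝ, 𝓕 φ ξ * 𝓕 ψ (-ξ)

/-! ### The synchrosqueezing integrand -/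

/-- The harmonic signal `f(s) = A e^{2πiξ₀s}`. -/
noncomputable def signal (A ξ₀ : ℝ) (s : ℝ) : ℂ :=
  A * Complex.exp (2 * Real.pi * Complex.I * ξ₀ * s)

/-- `V_{f+Φ}(t,η) = f(h_{t,η}) + Φ(h_{t,η})`. -/
noncomputable def stft (h : 𝓢(ℝ, ℂ)) (f : ℝ → ℂ) (Φ : 𝓢(ℝ, ℂ) → Ω → ℂ) (t η : ℝ) (ω : Ω) : ℂ :=
  (∫ s : ℝ, f s * atom h t η s) + Φ (atom h t η) ω

/-- `∂ₜV_{f+Φ}(t,η) = ∂ₜ[f(h_{t,η})] + Φ(∂ₜh_{t,η})`. -/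
noncomputable def dtStft (h : 𝓢(ℝ, ℂ)) (f : ℝ → ℂ) (Φ : 𝓢(ℝ, ℂ) → Ω → ℂ) (t η : ℝ) (ω : Ω) : ℂ :=
  deriv (fun τ => ∫ s : ℝ, f s * atom h τ η s) t + Φ (dtAtom h t η) ω

/-- The reassignment rule `Ω_{f+Φ}(t,η) = (2πi)⁻¹ ∂ₜV / V`. Its value where `V = 0` plays no role:
it only enters through `sstIntegrand`, which vanishes there. -/
noncomputable def reassignment (h : 𝓢(ℝ, ℂ)) (f : ℝ → ℂ) (Φ : 𝓢(ℝ, ℂ) → Ω → ℂ) (t η : ℝ)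
    (ω : Ω) : ℂ :=
  1 / (2 * Real.pi * Complex.I) * (dtStft h f Φ t η ω / stft h f Φ t η ω)

/-- `Y(t,η) = V(t,η) (πα)⁻¹ exp(-|ξ - Ω(t,η)|²/α)`. -/
noncomputable def sstIntegrand (h : 𝓢(ℝ, ℂ)) (f : ℝ → ℂ) (Φ : 𝓢(ℝ, ℂ) → Ω → ℂ) (t ξ α η : ℝ)
    (ω : Ω) : ℂ :=
  stft h f Φ t η ω *
    ((1 / (Real.pi * α) * Real.exp (-(1 / α) * ‖(ξ : ℂ) - reassignment h f Φ t η ω‖ ^ 2) : ℝ) : ℂ)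

/-- `Cov(X, Y) = E[(X - EX) conj(Y - EY)]`. -/
noncomputable def complexCov (X Y : Ω → ℂ) (P : Measure Ω) : ℂ :=
  ∫ ω, (X ω - ∫ ω', X ω' ∂P) * conj (Y ω - ∫ ω', Y ω' ∂P) ∂P

end Noise

end SST

/-! For fixed `η`, the variable `Y α η` is a function of the Gaussian vector formed by the real and
imaginary parts of `Φ(h_{t,η})` and `Φ(∂ₜh_{t,η})`. Its covariance with `Y α η'` is therefore at
most a linear correlation coefficient times the product of two `L²` norms. Both factors are
controlled uniformly in the frequencies.

Correlation. Gebelein's inequality (`enorm_integral_mul_sub_sq_le_of_correlation`) passes from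
linear functionals to square integrable functions: when linear correlations are at most `ρ`, the
second Gaussian vector can be realised as `ρZ + √(1-ρ²)W` with `W` independent of the rest, and the
Ornstein–Uhlenbeck operator `P_ρ` differs from the expectation by a Hilbert–Schmidt operator of norm
`O(ρ)`. Linear functionals of the noise correspond isometrically, up to a scalar, to the functions
`Re((A + bs)e^{-iks})`, `k = 2πη`, in `L²(e^{-s²} ds)`. Their inner products decay like a Gaussian
in `k - k'`. The delicate point is uniformity as `k → 0`, where the four-dimensional family becomes
linearly dependent: `le_integral_trigPoly_sq_of_le_one` and
`abs_integral_trigPoly_mul_le_of_pairing_bound` use rescaled coordinates in which the norm is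
bounded below and the pairing above. The outcome is `exists_sq_integral_trigPoly_mul_le`, which
gives `ρ ≤ C e^{-(η-η')²}`.

Size. With `Z = ∂ₜV - 2πiξV`, one has `|Y|² = (πα)⁻²|V|² exp(-|Z|²/(2π²α|V|²))`. The exponential
confines the complex Gaussian `Z` to a disc of radius about `√α|V|`, an event of probability of
order `α` as long as both components of `Z` have variance bounded below. Since `V` and `Z` are
dependent, the part of `V` explained by `Z` is regressed out first
(`exists_lintegral_sq_mul_exp_le`). Thus `E|Y|² ≤ C/α` for all `η, α > 0`.

The two together give `K(η,η') = C e^{-(η-η')²}`; the polynomial and power factors in (a), (b), (c)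
are at least `1` where they are needed. For continuity, `Y` is a globally Lipschitz function of `(V,
∂ₜV)` (`exists_norm_squeeze_sub_le`), hence continuous in `η` in `L²(P)`, and covariances are
continuous on `L²`. -/

namespace SST

/-! ### The Mehler kernel -/

section Mehler

open scoped ENNReal NNReal

/-- The density of `N(ρz, 1 - ρ²)` at `y` with respect to the standard Gaussian measure. -/
noncomputable def mehler (ρ z y : ℝ) : ℝ :=
  (√(1 - ρ ^ 2))⁻¹ * Real.exp (-(ρ ^ 2 * z ^ 2 - 2 * ρ * z * y + ρ ^ 2 * y ^ 2) / (2 * (1 - ρ ^ 2)))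

theorem mehler_nonneg (ρ z y : ℝ) : 0 ≤ mehler ρ z y := by
  unfold mehler; positivity

@[fun_prop]
theorem continuous_mehler_uncurry (ρ : ℝ) : Continuous fun p : ℝ × ℝ => mehler ρ p.1 p.2 := by
  unfold mehler; fun_prop

theorem mehler_mul_gaussianPDFReal {ρ : ℝ} (hρ : ρ ^ 2 < 1) (z y : ℝ) :
    mehler ρ z y * gaussianPDFReal 0 1 y
      = gaussianPDFReal (ρ * z) (Real.toNNReal (1 - ρ ^ 2)) y := by
  have h : 0 < 1 - ρ ^ 2 := by linarith
  simp only [mehler, gaussianPDFReal]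
  rw [Real.coe_toNNReal _ h.le, mul_mul_mul_comm, ← Real.exp_add, ← mul_inv,
    ← Real.sqrt_mul h.le]
  congr 2
  · congr 1; push_cast; ring
  · push_cast; field_simp; ring

theorem gaussianReal_eq_withDensity_mehler {ρ : ℝ} (hρ : ρ ^ 2 < 1) (z : ℝ) :
    gaussianReal (ρ * z) (Real.toNNReal (1 - ρ ^ 2))
      = (gaussianReal 0 1).withDensity fun y => ENNReal.ofReal (mehler ρ z y) := by
  have h : Real.toNNReal (1 - ρ ^ 2) ≠ 0 := (Real.toNNReal_pos.2 (by linarith)).ne'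
  have hm : Continuous (mehler ρ z) := (continuous_mehler_uncurry ρ).comp (by fun_prop : Continuous fun y : ℝ => (z, y))
  rw [gaussianReal_of_var_ne_zero _ h, gaussianReal_of_var_ne_zero _ one_ne_zero,
    ← withDensity_mul _ (measurable_gaussianPDF _ _) hm.measurable.ennreal_ofReal]
  congr 1
  ext y
  simp only [Pi.mul_apply, gaussianPDF]
  rw [← ENNReal.ofReal_mul (gaussianPDFReal_nonneg _ _ _), mul_comm (gaussianPDFReal 0 1 y),
    mehler_mul_gaussianPDFReal hρ]

/-- Completing the square in `y` turns the squared kernel times two standard densities into a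
multiple of a bivariate Gaussian density, factored as a marginal in `z` and a conditional law in
`y`. Its total mass `(1-ρ²)⁻¹ = ∑ ρ^{2n}` is the squared Hilbert–Schmidt norm of `P_ρ`. -/
theorem mehler_sq_mul_gaussianPDFReal {ρ : ℝ} (hρ : ρ ^ 2 < 1) (z y : ℝ) :
    gaussianPDFReal 0 1 z * (gaussianPDFReal 0 1 y * mehler ρ z y ^ 2)
      = (1 - ρ ^ 2)⁻¹ *
        (gaussianPDFReal 0 (Real.toNNReal ((1 + ρ ^ 2) / (1 - ρ ^ 2))) z *
          gaussianPDFReal (2 * ρ / (1 + ρ ^ 2) * z)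
            (Real.toNNReal ((1 - ρ ^ 2) / (1 + ρ ^ 2))) y) := by
  have h : 0 < 1 - ρ ^ 2 := by linarith
  have h' : 0 < 1 + ρ ^ 2 := by positivity
  simp only [mehler, gaussianPDFReal, mul_pow, inv_pow, Real.sq_sqrt h.le]
  rw [Real.coe_toNNReal _ (by positivity), Real.coe_toNNReal _ (by positivity)]
  have e1 : ∀ a b c d e f : ℝ, a * b * (c * d * (e * f)) = e * (a * c) * (b * d * f) := by
    intros; ring
  have e2 : ∀ a b c d e : ℝ, e * (a * b * (c * d)) = e * (a * c) * (b * d) := by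
    intros; ring
  rw [e1, e2, ← mul_inv (√_) (√_), ← mul_inv (√_) (√_), ← Real.sqrt_mul (by positivity),
    ← Real.sqrt_mul (by positivity), ← Real.exp_add, ← Real.exp_nat_mul, ← Real.exp_add, ← Real.exp_add]
  congr 2
  · congr 2; push_cast; field_simp
  · push_cast; field_simp; ring

theorem lintegral_lintegral_mehler_sq {ρ : ℝ} (hρ : ρ ^ 2 < 1) :
    ∫⁻ z, ∫⁻ y, ENNReal.ofReal (mehler ρ z y ^ 2) ∂gaussianReal 0 1 ∂gaussianReal 0 1
      = ENNReal.ofReal (1 - ρ ^ 2)⁻¹ := by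
  have h : 0 < 1 - ρ ^ 2 := by linarith
  have hm : ∀ z, Measurable fun y => ENNReal.ofReal (mehler ρ z y ^ 2) := fun z =>
    (((continuous_mehler_uncurry ρ).comp (by fun_prop : Continuous fun y : ℝ => (z, y))).pow
      2).measurable.ennreal_ofReal
  have hm2 : Measurable fun z => ∫⁻ y, ENNReal.ofReal (mehler ρ z y ^ 2) ∂gaussianReal 0 1 :=
    Measurable.lintegral_prod_right'
      (f := fun p : ℝ × ℝ => ENNReal.ofReal (mehler ρ p.1 p.2 ^ 2))
      (by fun_prop)
  have hv1 : Real.toNNReal ((1 + ρ ^ 2) / (1 - ρ ^ 2)) ≠ 0 :=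
    (Real.toNNReal_pos.2 (by positivity)).ne'
  have hv2 : Real.toNNReal ((1 - ρ ^ 2) / (1 + ρ ^ 2)) ≠ 0 :=
    (Real.toNNReal_pos.2 (by positivity)).ne'
  conv_lhs => rw [gaussianReal_of_var_ne_zero _ one_ne_zero]
  rw [lintegral_withDensity_eq_lintegral_mul _ (measurable_gaussianPDF _ _)
    (by rw [← gaussianReal_of_var_ne_zero _ one_ne_zero]; exact hm2)]
  have key : ∀ z, (gaussianPDF 0 1 * fun z => ∫⁻ y, ENNReal.ofReal (mehler ρ z y ^ 2)
      ∂(volume.withDensity (gaussianPDF 0 1))) z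
      = ENNReal.ofReal (1 - ρ ^ 2)⁻¹ *
        gaussianPDF 0 (Real.toNNReal ((1 + ρ ^ 2) / (1 - ρ ^ 2))) z := by
    intro z
    simp only [Pi.mul_apply]
    rw [lintegral_withDensity_eq_lintegral_mul _ (measurable_gaussianPDF _ _) (hm z),
      ← lintegral_const_mul _ ((measurable_gaussianPDF _ _).mul (hm z))]
    have : ∀ y, gaussianPDF 0 1 z * ((gaussianPDF 0 1 * fun y => ENNReal.ofReal (mehler ρ z y ^ 2)) y)
        = (ENNReal.ofReal (1 - ρ ^ 2)⁻¹ *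
        gaussianPDF 0 (Real.toNNReal ((1 + ρ ^ 2) / (1 - ρ ^ 2))) z) *
          gaussianPDF (2 * ρ / (1 + ρ ^ 2) * z) (Real.toNNReal ((1 - ρ ^ 2) / (1 + ρ ^ 2))) y := by
      intro y
      simp only [Pi.mul_apply, gaussianPDF]
      rw [← ENNReal.ofReal_mul (gaussianPDFReal_nonneg _ _ _),
        ← ENNReal.ofReal_mul (gaussianPDFReal_nonneg _ _ _), mehler_sq_mul_gaussianPDFReal hρ,
        ENNReal.ofReal_mul (by positivity), ENNReal.ofReal_mul (gaussianPDFReal_nonneg _ _ _),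
        mul_assoc]
    simp_rw [this]
    rw [lintegral_const_mul _ (measurable_gaussianPDF _ _), lintegral_gaussianPDF_eq_one _ hv2,
      mul_one]
  simp_rw [key]
  rw [lintegral_const_mul _ (measurable_gaussianPDF _ _), lintegral_gaussianPDF_eq_one _ hv1,
      mul_one]

theorem lintegral_pi_prod {ι : Type*} [Fintype ι] (μ : ι → Measure ℝ)
    [∀ i, IsProbabilityMeasure (μ i)] (f : ι → ℝ → ℝ≥0∞) (hf : ∀ i, Measurable (f i)) :
    ∫⁻ x, ∏ i, f i (x i) ∂Measure.pi μ = ∏ i, ∫⁻ x, f i x ∂μ i := by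
  have h := lintegral_prod_eq_prod_lintegral_of_indepFun (μ := Measure.pi μ) Finset.univ
    (fun i (x : ι → ℝ) => f i (x i))
    (iIndepFun_pi (μ := μ) (X := f) fun i => (hf i).aemeasurable)
    (fun i => (hf i).comp (measurable_pi_apply i))
  rw [h]
  refine Finset.prod_congr rfl fun i _ => ?_
  rw [← (measurePreserving_eval μ i).lintegral_comp (hf i)]

theorem pi_withDensity {ι : Type*} [Fintype ι] (μ : ι → Measure ℝ)
    [∀ i, IsProbabilityMeasure (μ i)] (f : ι → ℝ → ℝ≥0∞) (hf : ∀ i, Measurable (f i))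
    [∀ i, SigmaFinite ((μ i).withDensity (f i))] :
    Measure.pi (fun i => (μ i).withDensity (f i))
      = (Measure.pi μ).withDensity fun x => ∏ i, f i (x i) := by
  refine Measure.pi_eq fun s hs => ?_
  rw [withDensity_apply _ (MeasurableSet.univ_pi hs), ← lintegral_indicator (MeasurableSet.univ_pi hs)]
  have : ∀ x : ι → ℝ, (Set.univ.pi s).indicator (fun x => ∏ i, f i (x i)) x
      = ∏ i, (s i).indicator (f i) (x i) := by
    intro x
    by_cases hx : x ∈ Set.univ.pi s
    · rw [Set.indicator_of_mem hx]
      exact Finset.prod_congr rfl fun i _ => (Set.indicator_of_mem (hx i trivial) _).symm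
    · rw [Set.indicator_of_notMem hx]
      simp only [Set.mem_pi, Set.mem_univ, true_implies, not_forall] at hx
      obtain ⟨i, hi⟩ := hx
      exact (Finset.prod_eq_zero (Finset.mem_univ i) (Set.indicator_of_notMem hi _)).symm
  simp_rw [this]
  rw [lintegral_pi_prod μ _ fun i => (hf i).indicator (hs i)]
  refine Finset.prod_congr rfl fun i _ => ?_
  rw [lintegral_indicator (hs i), withDensity_apply _ (hs i)]

theorem sq_lintegral_mul_le {α : Type*} [MeasurableSpace α] {μ : Measure α} {f g : α → ℝ≥0∞}
    (hf : AEMeasurable f μ) (hg : AEMeasurable g μ) :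
    (∫⁻ x, f x * g x ∂μ) ^ 2 ≤ (∫⁻ x, f x ^ 2 ∂μ) * ∫⁻ x, g x ^ 2 ∂μ := by
  have h := ENNReal.lintegral_mul_le_Lp_mul_Lq μ Real.HolderConjugate.two_two hf hg
  have h2 := pow_le_pow_left' h 2
  simp only [Pi.mul_apply, ENNReal.rpow_two] at h2
  refine h2.trans_eq ?_
  rw [mul_pow, ← ENNReal.rpow_two, ← ENNReal.rpow_two, ← ENNReal.rpow_mul, ← ENNReal.rpow_mul]
  norm_num

variable {ι : Type*} [Fintype ι]

theorem lintegral_lintegral_prod_mehler_sq {ρ : ℝ} (hρ : ρ ^ 2 < 1) :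
    ∫⁻ z, ∫⁻ y, ENNReal.ofReal ((∏ i : ι, mehler ρ (z i) (y i)) ^ 2)
      ∂Measure.pi (fun _ : ι => gaussianReal 0 1) ∂Measure.pi (fun _ : ι => gaussianReal 0 1)
      = ENNReal.ofReal (((1 - ρ ^ 2)⁻¹) ^ Fintype.card ι) := by
  have h : 0 < 1 - ρ ^ 2 := by linarith
  have hm : ∀ z, Measurable fun y => ENNReal.ofReal (mehler ρ z y ^ 2) := fun z =>
    (((continuous_mehler_uncurry ρ).comp (by fun_prop : Continuous fun y : ℝ => (z, y))).pow
      2).measurable.ennreal_ofReal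
  have hm2 : Measurable fun z => ∫⁻ y, ENNReal.ofReal (mehler ρ z y ^ 2) ∂gaussianReal 0 1 :=
    Measurable.lintegral_prod_right'
      (f := fun p : ℝ × ℝ => ENNReal.ofReal (mehler ρ p.1 p.2 ^ 2))
      (by fun_prop)
  have e : ∀ z y : ι → ℝ, ENNReal.ofReal ((∏ i : ι, mehler ρ (z i) (y i)) ^ 2)
      = ∏ i, ENNReal.ofReal (mehler ρ (z i) (y i) ^ 2) := fun z y => by
    rw [← Finset.prod_pow, ENNReal.ofReal_prod_of_nonneg fun i _ => sq_nonneg _]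
  simp_rw [e]
  have e2 : ∀ z : ι → ℝ, ∫⁻ y, ∏ i, ENNReal.ofReal (mehler ρ (z i) (y i) ^ 2)
      ∂Measure.pi (fun _ : ι => gaussianReal 0 1)
      = ∏ i, ∫⁻ y, ENNReal.ofReal (mehler ρ (z i) y ^ 2) ∂gaussianReal 0 1 := fun z =>
    lintegral_pi_prod _ (fun i y => ENNReal.ofReal (mehler ρ (z i) y ^ 2)) fun i => hm _
  simp_rw [e2]
  rw [lintegral_pi_prod _ (fun _ z => ∫⁻ y, ENNReal.ofReal (mehler ρ z y ^ 2) ∂gaussianReal 0 1)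
    fun _ => hm2]
  simp only [lintegral_lintegral_mehler_sq hρ, Finset.prod_const, Finset.card_univ]
  rw [ENNReal.ofReal_pow (by positivity)]

/-- Coordinates are independent, so the one-dimensional Mehler density tensorises. This presents the
Ornstein–Uhlenbeck operator as an integral operator on `L²` of the standard Gaussian measure. -/
theorem map_affine_pi_gaussianReal {ρ : ℝ} (hρ : ρ ^ 2 < 1) (z : ι → ℝ) :
    (Measure.pi (fun _ : ι => gaussianReal 0 1)).map
        (fun w i => ρ * z i + √(1 - ρ ^ 2) * w i)
      = (Measure.pi (fun _ : ι => gaussianReal 0 1)).withDensity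
          fun y => ENNReal.ofReal (∏ i, mehler ρ (z i) (y i)) := by
  have h : 0 < 1 - ρ ^ 2 := by linarith
  have h1 : ∀ i, (gaussianReal 0 1).map (fun w => ρ * z i + √(1 - ρ ^ 2) * w)
      = (gaussianReal 0 1).withDensity fun y => ENNReal.ofReal (mehler ρ (z i) y) := fun i => by
    rw [← gaussianReal_eq_withDensity_mehler hρ]
    have : (fun w => ρ * z i + √(1 - ρ ^ 2) * w)
      = (fun w => ρ * z i + w) ∘ (fun w => √(1 - ρ ^ 2) * w) := rfl
    rw [this, ← Measure.map_map (by fun_prop) (by fun_prop), gaussianReal_map_const_mul,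
      gaussianReal_map_const_add]
    congr 1
    · ring
    · ext
      simp [Real.sq_sqrt h.le, h.le]
  have : ∀ i, IsProbabilityMeasure ((gaussianReal 0 1).map (fun w => ρ * z i + √(1 - ρ ^ 2) * w)) :=
    fun i => Measure.isProbabilityMeasure_map (by fun_prop)
  have hs : ∀ i, IsProbabilityMeasure
      ((gaussianReal 0 1).withDensity fun y => ENNReal.ofReal (mehler ρ (z i) y)) :=
    fun i => h1 i ▸ this i
  rw [Measure.pi_map_pi (μ := fun _ : ι => gaussianReal 0 1)
    (f := fun i w => ρ * z i + √(1 - ρ ^ 2) * w) (fun i => by fun_prop)]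
  simp_rw [h1, ENNReal.ofReal_prod_of_nonneg fun i _ => mehler_nonneg ρ _ _]
  exact pi_withDensity _ (fun i y => ENNReal.ofReal (mehler ρ (z i) y)) fun i =>
    ((continuous_mehler_uncurry ρ).comp
      (by fun_prop : Continuous fun y : ℝ => (z i, y))).measurable.ennreal_ofReal

/-- A Markov kernel whose density is square integrable is close to the expectation in `L²`. -/
theorem lintegral_enorm_sq_integral_kernel_sub_le {α : Type*} [MeasurableSpace α] (γ : Measure α)
    [IsProbabilityMeasure γ] {r : α → α → ℝ} (hr0 : ∀ z y, 0 ≤ r z y)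
    (hrm2 : Measurable fun p : α × α => r p.1 p.2)
    (hone : ∀ z, ∫⁻ y, ENNReal.ofReal (r z y) ∂γ = 1) {c : ℝ}
    (htot : ∫⁻ z, ∫⁻ y, ENNReal.ofReal (r z y ^ 2) ∂γ ∂γ = ENNReal.ofReal c)
    {g : α → ℂ} (hg : Measurable g) (hg2 : MemLp g 2 γ) :
    ∫⁻ z, ‖(∫ y, r z y • g y ∂γ) - ∫ y, g y ∂γ‖ₑ ^ 2 ∂γ
      ≤ ENNReal.ofReal (c - 1) * ∫⁻ w, ‖g w‖ₑ ^ 2 ∂γ := by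
  have hrm : ∀ z, Measurable (r z) := fun z => hrm2.comp measurable_prodMk_left
  -- Because `r z` has mass one, `∫(r-1)² = ∫r² - 1`. The identity is kept additive, as subtraction
  -- in `ℝ≥0∞` truncates.
  have hsub : ∀ z, ∫⁻ y, ENNReal.ofReal ((r z y - 1) ^ 2) ∂γ + 1
      = ∫⁻ y, ENNReal.ofReal (r z y ^ 2) ∂γ := fun z => by
    have e : ∀ y, ENNReal.ofReal ((r z y - 1) ^ 2) + 2 * ENNReal.ofReal (r z y)
        = ENNReal.ofReal (r z y ^ 2) + 1 := fun y => by
      rw [← ENNReal.ofReal_ofNat 2, ← ENNReal.ofReal_one, ← ENNReal.ofReal_mul (by norm_num),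
        ← ENNReal.ofReal_add (by positivity) (mul_nonneg (by norm_num) (hr0 z y)),
        ← ENNReal.ofReal_add (by positivity) (by norm_num)]
      congr 1; ring
    have e2 := lintegral_congr (μ := γ) e
    rw [lintegral_add_right _ (by fun_prop), lintegral_add_right _ (by fun_prop),
      lintegral_const_mul _ (by fun_prop), hone] at e2
    simp only [mul_one, lintegral_const, measure_univ] at e2
    rw [← one_add_one_eq_two (R := ℝ≥0∞), ← add_assoc] at e2
    exact (ENNReal.add_left_inj ENNReal.one_ne_top).1 e2
  have hm3 : Measurable fun z => ∫⁻ y, ENNReal.ofReal (r z y ^ 2) ∂γ :=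
    Measurable.lintegral_prod_right' (f := fun p : α × α => ENNReal.ofReal (r p.1 p.2 ^ 2))
      (by fun_prop)
  have hm4 : Measurable fun z => ∫⁻ y, ENNReal.ofReal ((r z y - 1) ^ 2) ∂γ :=
    Measurable.lintegral_prod_right'
      (f := fun p : α × α => ENNReal.ofReal ((r p.1 p.2 - 1) ^ 2)) (by fun_prop)
  have hfin : ∀ᵐ z ∂γ, ∫⁻ y, ENNReal.ofReal (r z y ^ 2) ∂γ < ∞ :=
    ae_lt_top hm3 (by rw [htot]; exact ENNReal.ofReal_ne_top)
  have htot' : ∫⁻ z, ∫⁻ y, ENNReal.ofReal ((r z y - 1) ^ 2) ∂γ ∂γ = ENNReal.ofReal (c - 1) := by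
    simp_rw [← hsub] at htot
    rw [lintegral_add_right _ (by fun_prop)] at htot
    simp only [lintegral_const, measure_univ, mul_one] at htot
    rw [ENNReal.ofReal_sub _ (by norm_num), ← htot, ENNReal.ofReal_one,
      ENNReal.add_sub_cancel_right ENNReal.one_ne_top]
  rw [← htot', ← lintegral_mul_const _ hm4]
  refine lintegral_mono_ae ?_
  filter_upwards [hfin] with z hz
  have hrL2 : MemLp (r z) 2 γ := by
    rw [memLp_two_iff_integrable_sq (hrm z).aestronglyMeasurable]
    refine ⟨((hrm z).pow_const 2).aestronglyMeasurable, ?_⟩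
    rw [hasFiniteIntegral_iff_ofReal (ae_of_all _ fun y => sq_nonneg _)]
    exact hz
  have h_int : Integrable (fun y => r z y • g y) γ :=
    (hg2.smul hrL2 (r := 1)).integrable le_rfl
  rw [← integral_sub h_int (hg2.integrable (by norm_num))]
  -- Subtracting the mean replaces the density `r` by `r - 1`; Cauchy–Schwarz in `y` then separates
  -- the kernel from `g`.
  have e2 : ∀ y, r z y • g y - g y = (r z y - 1) • g y := fun y => by rw [sub_smul, one_smul]
  simp_rw [e2]
  calc ‖∫ y, (r z y - 1) • g y ∂γ‖ₑ ^ 2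
      ≤ (∫⁻ y, ‖r z y - 1‖ₑ * ‖g y‖ₑ ∂γ) ^ 2 := by
        gcongr
        refine (enorm_integral_le_lintegral_enorm _).trans_eq ?_
        simp_rw [enorm_smul]
    _ ≤ (∫⁻ y, ‖r z y - 1‖ₑ ^ 2 ∂γ) * ∫⁻ y, ‖g y‖ₑ ^ 2 ∂γ :=
        sq_lintegral_mul_le (by fun_prop) (by fun_prop)
    _ = _ := by
        congr 1
        refine lintegral_congr fun y => ?_
        rw [Real.enorm_eq_ofReal_abs, ← ENNReal.ofReal_pow (abs_nonneg _), sq_abs]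

/-- The Ornstein–Uhlenbeck operator `P_ρ` is close to the expectation in `L²` for small `ρ`. -/
theorem lintegral_enorm_sq_ornsteinUhlenbeck_sub_le {ρ : ℝ} (hρ : ρ ^ 2 < 1) {g : (ι → ℝ) → ℂ}
    (hg : Measurable g) (hg2 : MemLp g 2 (Measure.pi (fun _ : ι => gaussianReal 0 1))) :
    ∫⁻ z, ‖(∫ w, g (fun i => ρ * z i + √(1 - ρ ^ 2) * w i)
        ∂Measure.pi (fun _ : ι => gaussianReal 0 1))
        - ∫ w, g w ∂Measure.pi (fun _ : ι => gaussianReal 0 1)‖ₑ ^ 2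
        ∂Measure.pi (fun _ : ι => gaussianReal 0 1)
      ≤ ENNReal.ofReal (((1 - ρ ^ 2)⁻¹) ^ Fintype.card ι - 1) *
        ∫⁻ w, ‖g w‖ₑ ^ 2 ∂Measure.pi (fun _ : ι => gaussianReal 0 1) := by
  have hr0 : ∀ z y : ι → ℝ, 0 ≤ ∏ i, mehler ρ (z i) (y i) := fun z y =>
    Finset.prod_nonneg fun i _ => mehler_nonneg _ _ _
  have hrm2 : Measurable fun p : (ι → ℝ) × (ι → ℝ) => ∏ i, mehler ρ (p.1 i) (p.2 i) := by
    have h : ∀ i, Continuous fun p : (ι → ℝ) × (ι → ℝ) => mehler ρ (p.1 i) (p.2 i) := fun i => by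
      unfold mehler; fun_prop
    exact (continuous_finsetProd Finset.univ fun i _ => h i).measurable
  have haff : ∀ z : ι → ℝ, Measurable fun (w : ι → ℝ) i => ρ * z i + √(1 - ρ ^ 2) * w i :=
    fun z => measurable_pi_lambda _ fun i => ((measurable_pi_apply i).const_mul _).const_add _
  have hone : ∀ z : ι → ℝ, ∫⁻ y, ENNReal.ofReal (∏ i, mehler ρ (z i) (y i))
      ∂Measure.pi (fun _ : ι => gaussianReal 0 1) = 1 := fun z => by
    have : IsProbabilityMeasure ((Measure.pi (fun _ : ι => gaussianReal 0 1)).map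
        (fun w i => ρ * z i + √(1 - ρ ^ 2) * w i)) :=
      Measure.isProbabilityMeasure_map (haff z).aemeasurable
    rw [map_affine_pi_gaussianReal hρ] at this
    have h := this.measure_univ
    rwa [withDensity_apply _ MeasurableSet.univ, Measure.restrict_univ] at h
  have e1 : ∀ z : ι → ℝ, ∫ w, g (fun i => ρ * z i + √(1 - ρ ^ 2) * w i)
      ∂Measure.pi (fun _ : ι => gaussianReal 0 1)
      = ∫ y, (∏ i, mehler ρ (z i) (y i)) • g y ∂Measure.pi (fun _ : ι => gaussianReal 0 1) := by
    intro z
    have hrz : Measurable fun y : ι → ℝ => ENNReal.ofReal (∏ i, mehler ρ (z i) (y i)) :=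
      (hrm2.comp measurable_prodMk_left).ennreal_ofReal
    rw [← integral_map (φ := fun (w : ι → ℝ) i => ρ * z i + √(1 - ρ ^ 2) * w i)
      (haff z).aemeasurable hg.aestronglyMeasurable, map_affine_pi_gaussianReal hρ,
      integral_withDensity_eq_integral_toReal_smul hrz (by simp)]
    simp only [ENNReal.toReal_ofReal (hr0 z _)]
  simp_rw [e1]
  exact lintegral_enorm_sq_integral_kernel_sub_le _ hr0 hrm2 hone
    (lintegral_lintegral_prod_mehler_sq hρ) hg hg2

end Mehler
/-! ### Gebelein's inequality -/

section Gebelein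

open scoped ENNReal NNReal Matrix MatrixOrder
open WithLp (toLp ofLp)

variable {ι κ : Type*} [Fintype ι] [Fintype κ]

/-- The matrix of mixed second moments of two families of random variables. -/
noncomputable def momentMatrix {ι κ Ω : Type*} [MeasurableSpace Ω] (P : Measure Ω) (X : ι → Ω → ℝ)
    (Y : κ → Ω → ℝ) : Matrix ι κ ℝ :=
  Matrix.of fun i j => ∫ ω, X i ω * Y j ω ∂P

theorem integral_sum_mul_sum {Ω : Type*} [MeasurableSpace Ω] {P : Measure Ω} {X : ι → Ω → ℝ}
    {Y : κ → Ω → ℝ} (hX : ∀ i, MemLp (X i) 2 P) (hY : ∀ j, MemLp (Y j) 2 P) (a : ι → ℝ)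
    (b : κ → ℝ) :
    ∫ ω, (∑ i, a i * X i ω) * (∑ j, b j * Y j ω) ∂P = a ⬝ᵥ momentMatrix P X Y *ᵥ b := by
  have e2 : ∀ ω, (∑ i, a i * X i ω) * (∑ j, b j * Y j ω)
      = ∑ i, ∑ j, a i * b j * (X i ω * Y j ω) := fun ω => by
    rw [Finset.sum_mul_sum]
    exact Finset.sum_congr rfl fun i _ => Finset.sum_congr rfl fun j _ => by ring
  have hij : ∀ i j, Integrable (fun ω => a i * b j * (X i ω * Y j ω)) P := fun i j =>
    ((hX i).integrable_mul (hY j)).const_mul _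
  simp_rw [e2]
  rw [integral_finsetSum _ fun i _ => integrable_finsetSum _ fun j _ => hij i j]
  simp_rw [integral_finsetSum _ fun j _ => hij _ j, integral_const_mul]
  simp only [dotProduct, Matrix.mulVec, Finset.mul_sum, momentMatrix, Matrix.of_apply]
  exact Finset.sum_congr rfl fun i _ => Finset.sum_congr rfl fun j _ => by ring

theorem momentMatrix_transpose {ι κ Ω : Type*} [MeasurableSpace Ω] (P : Measure Ω) (X : ι → Ω → ℝ)
    (Y : κ → Ω → ℝ) : (momentMatrix P X Y)ᵀ = momentMatrix P Y X := by
  ext i j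
  simp [momentMatrix, mul_comm]

/-- The quadratic form is `A + B + 2C` with `C² ≤ AB`, hence nonnegative. For `r = 1` this is the
joint covariance matrix; for `r = ρ⁻¹` it says that cross-correlations bounded by `ρ` can be
inflated by `ρ⁻¹` and still be those of some Gaussian vector. -/
theorem posSemidef_fromBlocks_momentMatrix {Ω : Type*} [MeasurableSpace Ω] {P : Measure Ω}
    {X : ι → Ω → ℝ} {Y : κ → Ω → ℝ} (hX : ∀ i, MemLp (X i) 2 P) (hY : ∀ j, MemLp (Y j) 2 P)
    {r : ℝ} (hcorr : ∀ (a : ι → ℝ) (b : κ → ℝ),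
      (r * ∫ ω, (∑ i, a i * X i ω) * (∑ j, b j * Y j ω) ∂P) ^ 2
        ≤ (∫ ω, (∑ i, a i * X i ω) ^ 2 ∂P) * ∫ ω, (∑ j, b j * Y j ω) ^ 2 ∂P) :
    (Matrix.fromBlocks (momentMatrix P X X) (r • momentMatrix P X Y)
      (r • (momentMatrix P X Y)ᵀ) (momentMatrix P Y Y)).PosSemidef := by
  refine Matrix.PosSemidef.of_dotProduct_mulVec_nonneg ?_ fun x => ?_
  · rw [Matrix.IsHermitian, Matrix.conjTranspose_eq_transpose_of_trivial,
      Matrix.fromBlocks_transpose, Matrix.transpose_smul, Matrix.transpose_smul,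
      momentMatrix_transpose, momentMatrix_transpose, momentMatrix_transpose]
    simp [momentMatrix_transpose]
  · obtain ⟨a, b, rfl⟩ : ∃ a b, x = Sum.elim a b :=
      ⟨x ∘ Sum.inl, x ∘ Sum.inr, by ext i; cases i <;> rfl⟩
    have h1 := integral_sum_mul_sum hX hX a a
    have h2 := integral_sum_mul_sum hX hY a b
    have h2' := integral_sum_mul_sum hY hX b a
    have h3 := integral_sum_mul_sum hY hY b b
    have hc := hcorr a b
    simp only [← sq] at h1 h3
    have h2'' : b ⬝ᵥ momentMatrix P Y X *ᵥ a = a ⬝ᵥ momentMatrix P X Y *ᵥ b := by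
      rw [← h2, ← h2']; simp_rw [mul_comm]
    have n1 : 0 ≤ ∫ ω, (∑ i, a i * X i ω) ^ 2 ∂P := integral_nonneg fun _ => sq_nonneg _
    have n2 : 0 ≤ ∫ ω, (∑ i, b i * Y i ω) ^ 2 ∂P := integral_nonneg fun _ => sq_nonneg _
    have : star (Sum.elim a b) = Sum.elim a b := star_trivial _
    rw [this, Matrix.fromBlocks_mulVec, Matrix.dotProduct_block]
    simp only [Function.comp_def, Sum.elim_inl, Sum.elim_inr, dotProduct_add, Matrix.smul_mulVec,
      dotProduct_smul, smul_eq_mul, momentMatrix_transpose]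
    rw [h2'', ← h1, ← h2, ← h3]
    set A := ∫ ω, (∑ i, a i * X i ω) ^ 2 ∂P
    set B := ∫ ω, (∑ i, b i * Y i ω) ^ 2 ∂P
    set C := r * ∫ ω, (∑ i, a i * X i ω) * (∑ j, b j * Y j ω) ∂P
    have : (2 * C) ^ 2 ≤ (A + B) ^ 2 := by nlinarith [sq_nonneg (A - B)]
    have := abs_le_of_sq_le_sq' this (by positivity)
    linarith [this.1]

variable [DecidableEq ι] [DecidableEq κ]

/-- A centred multivariate Gaussian is a linear image of the standard one, and `z, w ↦ ρz +
√(1-ρ²)w` commutes with linear maps. No invertibility of the covariance is involved, so degenerate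
vectors are covered. -/
theorem lintegral_enorm_sq_ornsteinUhlenbeck_multivariateGaussian_sub_le {ρ : ℝ} (hρ : ρ ^ 2 < 1)
    (S : Matrix κ κ ℝ) {G : EuclideanSpace ℝ κ → ℂ} (hG : Measurable G)
    (hG2 : MemLp G 2 (multivariateGaussian 0 S)) :
    ∫⁻ z, ‖(∫ w, G (ρ • z + √(1 - ρ ^ 2) • w) ∂multivariateGaussian 0 S)
        - ∫ w, G w ∂multivariateGaussian 0 S‖ₑ ^ 2 ∂multivariateGaussian 0 S
      ≤ ENNReal.ofReal (((1 - ρ ^ 2)⁻¹) ^ Fintype.card κ - 1) *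
        ∫⁻ w, ‖G w‖ₑ ^ 2 ∂multivariateGaussian 0 S := by
  obtain ⟨B, hB⟩ : ∃ B : EuclideanSpace ℝ κ →L[ℝ] EuclideanSpace ℝ κ,
      multivariateGaussian 0 S = (stdGaussian (EuclideanSpace ℝ κ)).map B := by
    refine ⟨Matrix.toEuclideanCLM (𝕜 := ℝ) (CFC.sqrt S), ?_⟩
    simp [multivariateGaussian]
  have hν : multivariateGaussian 0 S
      = (Measure.pi (fun _ : κ => gaussianReal 0 1)).map (fun x => B (toLp 2 x)) := by
    rw [hB, ← map_pi_eq_stdGaussian, Measure.map_map (by fun_prop) (by fun_prop)]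
    rfl
  have hm : Measurable fun x : κ → ℝ => B (toLp 2 x) := by fun_prop
  rw [hν] at hG2 ⊢
  have hg2 := (memLp_map_measure_iff hG.aestronglyMeasurable hm.aemeasurable).1 hG2
  have key := lintegral_enorm_sq_ornsteinUhlenbeck_sub_le hρ (hG.comp hm) hg2
  have hQ : Measurable fun z => ‖(∫ w, G (ρ • z + √(1 - ρ ^ 2) • w)
      ∂(Measure.pi (fun _ : κ => gaussianReal 0 1)).map (fun x => B (toLp 2 x)))
        - ∫ w, G w ∂(Measure.pi (fun _ : κ => gaussianReal 0 1)).map (fun x => B (toLp 2 x))‖ₑ ^ 2 := by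
    refine Measurable.pow_const (Measurable.enorm (Measurable.sub_const ?_ _)) 2
    refine StronglyMeasurable.measurable ?_
    exact StronglyMeasurable.integral_prod_right'
      (f := fun p : EuclideanSpace ℝ κ × EuclideanSpace ℝ κ => G (ρ • p.1 + √(1 - ρ ^ 2) • p.2))
      (hG.comp (by fun_prop)).stronglyMeasurable
  rw [lintegral_map hQ hm, lintegral_map (by fun_prop) hm]
  refine le_trans (le_of_eq ?_) key
  refine lintegral_congr fun z => ?_
  have hz : Measurable fun w => G (ρ • B (toLp 2 z) + √(1 - ρ ^ 2) • w) := hG.comp (by fun_prop)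
  rw [integral_map hm.aemeasurable hG.aestronglyMeasurable,
    integral_map hm.aemeasurable hz.aestronglyMeasurable]
  congr 3
  refine integral_congr_ae (ae_of_all _ fun w => ?_)
  simp only [Function.comp]
  congr 1
  rw [← map_smul, ← map_smul, ← map_add]
  rfl

theorem map_toLp_eq_multivariateGaussian {Ω : Type*} [MeasurableSpace Ω] {P : Measure Ω}
    {T : ι → Ω → ℝ} (hT : HasGaussianLaw (fun ω i => T i ω) P)
    (h0 : ∀ i, ∫ ω, T i ω ∂P = 0) {S : Matrix ι ι ℝ} (hS : S.PosSemidef)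
    (hc : ∀ i j, ∫ ω, T i ω * T j ω ∂P = S i j) :
    P.map (fun ω => toLp 2 (fun i => T i ω)) = multivariateGaussian 0 S := by
  have := hT.isProbabilityMeasure
  have hL := hT.toLp_pi 2
  have hT2 : ∀ i, MemLp (T i) 2 P := fun i => (hT.eval i).memLp_two
  have := hL.isGaussian_map
  refine Measure.ext_of_charFun ?_
  ext t
  rw [hL.charFun_map_eq, charFun_multivariateGaussian hS]
  have e1 : ∀ ω, inner ℝ t (toLp 2 (fun i => T i ω)) = ∑ i, t i * T i ω := fun ω => by
    simp [PiLp.inner_apply, mul_comm]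
  simp_rw [e1]
  have hi : ∀ i, Integrable (fun ω => t i * T i ω) P := fun i =>
    ((hT2 i).integrable (by norm_num)).const_mul _
  have m0 : ∫ ω, ∑ i, t i * T i ω ∂P = 0 := by
    rw [integral_finsetSum _ fun i _ => hi i]
    simp [integral_const_mul, h0]
  have hv : Var[fun ω => ∑ i, t i * T i ω; P] = t ⬝ᵥ S *ᵥ t := by
    rw [variance_of_integral_eq_zero
      (Finset.aemeasurable_fun_sum _ fun i _ => (hi i).aemeasurable) m0]
    have e2 : ∀ ω, (∑ i, t i * T i ω) ^ 2 = ∑ i, ∑ j, t i * t j * (T i ω * T j ω) := fun ω => by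
      rw [sq, Finset.sum_mul_sum]
      exact Finset.sum_congr rfl fun i _ => Finset.sum_congr rfl fun j _ => by ring
    have hij : ∀ i j, Integrable (fun ω => t i * t j * (T i ω * T j ω)) P := fun i j =>
      ((hT2 i).integrable_mul (hT2 j)).const_mul _
    simp_rw [e2]
    rw [integral_finsetSum _ fun i _ => integrable_finsetSum _ fun j _ => hij i j]
    simp_rw [integral_finsetSum _ fun j _ => hij _ j, integral_const_mul, hc]
    simp only [dotProduct, Matrix.mulVec, Finset.mul_sum]
    exact Finset.sum_congr rfl fun i _ => Finset.sum_congr rfl fun j _ => by ring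
  rw [m0, hv]
  simp

/-- Write a pair `(X, Y)` as `(X, ρZ + √(1-ρ²)W)`, where `(X, Z)` has the inflated cross-covariance
`ρ⁻¹S₁₂` and `W` is independent of it. The cross-covariance becomes `ρ·ρ⁻¹S₁₂`, and the variance
`ρ²S₂₂ + (1-ρ²)S₂₂`. Characteristic functions turn this count into equality of laws. -/
theorem map_coupling_eq_multivariateGaussian {S₁₁ : Matrix ι ι ℝ} {S₁₂ : Matrix ι κ ℝ}
    {S₂₂ : Matrix κ κ ℝ} {ρ : ℝ} (hρ0 : ρ ≠ 0) (hρ : ρ ^ 2 < 1)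
    (hS : (Matrix.fromBlocks S₁₁ S₁₂ S₁₂ᵀ S₂₂).PosSemidef)
    (hM : (Matrix.fromBlocks S₁₁ (ρ⁻¹ • S₁₂) (ρ⁻¹ • S₁₂ᵀ) S₂₂).PosSemidef)
    (h₂₂ : S₂₂.PosSemidef) :
    ((multivariateGaussian 0 (Matrix.fromBlocks S₁₁ (ρ⁻¹ • S₁₂) (ρ⁻¹ • S₁₂ᵀ) S₂₂)).prod
        (multivariateGaussian 0 S₂₂)).map
      (fun q => toLp 2 (Sum.elim (fun i => q.1 (Sum.inl i))
        (fun j => ρ * q.1 (Sum.inr j) + √(1 - ρ ^ 2) * q.2 j)))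
      = multivariateGaussian 0 (Matrix.fromBlocks S₁₁ S₁₂ S₁₂ᵀ S₂₂) := by
  have h : 0 ≤ 1 - ρ ^ 2 := by linarith
  have hm : Measurable fun q : EuclideanSpace ℝ (ι ⊕ κ) × EuclideanSpace ℝ κ =>
      (toLp 2 (Sum.elim (fun i => q.1 (Sum.inl i))
        (fun j => ρ * q.1 (Sum.inr j) + √(1 - ρ ^ 2) * q.2 j)) : EuclideanSpace ℝ (ι ⊕ κ)) := by
    refine (WithLp.measurable_toLp 2 _).comp (measurable_pi_lambda _ fun a => ?_)
    cases a <;> simp only [Sum.elim_inl, Sum.elim_inr] <;> fun_prop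
  have := Measure.isProbabilityMeasure_map (μ := (multivariateGaussian 0
    (Matrix.fromBlocks S₁₁ (ρ⁻¹ • S₁₂) (ρ⁻¹ • S₁₂ᵀ) S₂₂)).prod
        (multivariateGaussian 0 S₂₂)) hm.aemeasurable
  refine Measure.ext_of_charFun ?_
  ext t
  rw [charFun_apply, integral_map hm.aemeasurable (by fun_prop)]
  have e : ∀ q : EuclideanSpace ℝ (ι ⊕ κ) × EuclideanSpace ℝ κ,
      Complex.exp ((inner ℝ (toLp 2 (Sum.elim (fun i => q.1 (Sum.inl i))
        (fun j => ρ * q.1 (Sum.inr j) + √(1 - ρ ^ 2) * q.2 j)) : EuclideanSpace ℝ (ι ⊕ κ)) t : ℝ) *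
          Complex.I)
      = Complex.exp ((inner ℝ q.1 (toLp 2 (Sum.elim (fun i => t (Sum.inl i))
          (fun j => ρ * t (Sum.inr j))) : EuclideanSpace ℝ (ι ⊕ κ)) : ℝ) * Complex.I) *
        Complex.exp ((inner ℝ q.2 (toLp 2 (fun j => √(1 - ρ ^ 2) * t (Sum.inr j)) :
          EuclideanSpace ℝ κ) : ℝ) * Complex.I) := fun q => by
    rw [← Complex.exp_add, ← add_mul, ← Complex.ofReal_add]
    congr 3
    simp only [PiLp.inner_apply, Fintype.sum_sum_type, Sum.elim_inl, Sum.elim_inr,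
      RCLike.inner_apply, conj_trivial]
    rw [add_assoc, ← Finset.sum_add_distrib]
    congr 1
    exact Finset.sum_congr rfl fun j _ => by ring
  simp_rw [e]
  rw [integral_prod_mul (μ := multivariateGaussian 0 _) (ν := multivariateGaussian 0 S₂₂)
    (fun x : EuclideanSpace ℝ (ι ⊕ κ) => Complex.exp ((inner ℝ x (toLp 2 (Sum.elim
      (fun i => t (Sum.inl i)) (fun j => ρ * t (Sum.inr j))) : EuclideanSpace ℝ (ι ⊕ κ)) : ℝ) *
        Complex.I))
    (fun x : EuclideanSpace ℝ κ => Complex.exp ((inner ℝ x (toLp 2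
      (fun j => √(1 - ρ ^ 2) * t (Sum.inr j)) : EuclideanSpace ℝ κ) : ℝ) * Complex.I)),
    ← charFun_apply, ← charFun_apply, charFun_multivariateGaussian hM,
    charFun_multivariateGaussian h₂₂, charFun_multivariateGaussian hS, ← Complex.exp_add]
  congr 1
  simp only [inner_zero_right, Complex.ofReal_zero, zero_mul, zero_sub]
  rw [← neg_add, ← add_div]
  norm_cast
  congr 2
  simp only [dotProduct, Matrix.mulVec, Fintype.sum_sum_type, Sum.elim_inl, Sum.elim_inr,
    Matrix.fromBlocks_apply₁₁, Matrix.fromBlocks_apply₁₂, Matrix.fromBlocks_apply₂₁,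
    Matrix.fromBlocks_apply₂₂, Matrix.smul_apply, smul_eq_mul]
  have a1 : ∀ x : ι, ∑ j, ρ⁻¹ * S₁₂ x j * (ρ * t (Sum.inr j)) = ∑ j, S₁₂ x j * t (Sum.inr j) :=
    fun x => Finset.sum_congr rfl fun j _ => by field_simp
  have a2 : ∀ j : κ, ρ * t (Sum.inr j) * (∑ i, ρ⁻¹ * S₁₂ᵀ j i * t (Sum.inl i)
        + ∑ l, S₂₂ j l * (ρ * t (Sum.inr l)))
      = t (Sum.inr j) * ∑ i, S₁₂ᵀ j i * t (Sum.inl i)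
        + ρ ^ 2 * (t (Sum.inr j) * ∑ l, S₂₂ j l * t (Sum.inr l)) := fun j => by
    simp_rw [mul_add, Finset.mul_sum]
    congr 1 <;> exact Finset.sum_congr rfl fun l _ => by field_simp
  have a3 : ∀ j : κ, √(1 - ρ ^ 2) * t (Sum.inr j) * ∑ l, S₂₂ j l * (√(1 - ρ ^ 2) * t (Sum.inr l))
      = (1 - ρ ^ 2) * (t (Sum.inr j) * ∑ l, S₂₂ j l * t (Sum.inr l)) := fun j => by
    simp_rw [Finset.mul_sum]
    refine Finset.sum_congr rfl fun l _ => ?_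
    calc _ = (√(1 - ρ ^ 2)) ^ 2 * (t (Sum.inr j) * (S₂₂ j l * t (Sum.inr l))) := by ring
      _ = _ := by rw [Real.sq_sqrt h]
  simp_rw [a1, a2, a3, mul_add, Finset.sum_add_distrib, ← Finset.mul_sum]
  ring

/-- A form of **Gebelein's inequality**: if every linear functional of `X` and every linear
functional of `Y` have correlation at most `ρ`, then so have, up to a dimensional constant, all
square integrable functions of `X` and `Y`. -/
theorem enorm_integral_mul_sub_sq_le_of_correlation {Ω : Type*} [MeasurableSpace Ω]
    {P : Measure Ω} {X : ι → Ω → ℝ} {Y : κ → Ω → ℝ}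
    (hXY : HasGaussianLaw (fun ω a => Sum.elim X Y a ω) P)
    (hX0 : ∀ i, ∫ ω, X i ω ∂P = 0) (hY0 : ∀ j, ∫ ω, Y j ω ∂P = 0) {ρ : ℝ} (hρ0 : ρ ≠ 0)
    (hρ : ρ ^ 2 < 1)
    (hcorr : ∀ (a : ι → ℝ) (b : κ → ℝ),
      (∫ ω, (∑ i, a i * X i ω) * (∑ j, b j * Y j ω) ∂P) ^ 2
        ≤ ρ ^ 2 * ((∫ ω, (∑ i, a i * X i ω) ^ 2 ∂P) * ∫ ω, (∑ j, b j * Y j ω) ^ 2 ∂P))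
    {F : EuclideanSpace ℝ ι → ℂ} {G : EuclideanSpace ℝ κ → ℂ} (hF : Measurable F)
    (hG : Measurable G) (hF2 : MemLp (fun ω => F (toLp 2 fun i => X i ω)) 2 P)
    (hG2 : MemLp (fun ω => G (toLp 2 fun i => Y i ω)) 2 P) :
    ‖(∫ ω, F (toLp 2 fun i => X i ω) * G (toLp 2 fun i => Y i ω) ∂P)
        - (∫ ω, F (toLp 2 fun i => X i ω) ∂P) * ∫ ω, G (toLp 2 fun i => Y i ω) ∂P‖ₑ ^ 2
      ≤ ENNReal.ofReal (((1 - ρ ^ 2)⁻¹) ^ Fintype.card κ - 1) *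
        (∫⁻ ω, ‖F (toLp 2 fun i => X i ω)‖ₑ ^ 2 ∂P) *
          ∫⁻ ω, ‖G (toLp 2 fun i => Y i ω)‖ₑ ^ 2 ∂P := by
  have := hXY.isProbabilityMeasure
  have hX2 : ∀ i, MemLp (X i) 2 P := fun i => (hXY.eval (Sum.inl i)).memLp_two
  have hY2 : ∀ j, MemLp (Y j) 2 P := fun j => (hXY.eval (Sum.inr j)).memLp_two
  have hYG : HasGaussianLaw (fun ω j => Y j ω) P :=
    hXY.map_fun (ContinuousLinearMap.pi fun j => ContinuousLinearMap.proj (Sum.inr j))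
  have hXm : AEMeasurable (fun ω => (toLp 2 fun i => X i ω : EuclideanSpace ℝ ι)) P :=
    (WithLp.measurable_toLp 2 _).comp_aemeasurable
      (aemeasurable_pi_lambda _ fun i => (hX2 i).aemeasurable)
  have hYm : AEMeasurable (fun ω => (toLp 2 fun i => Y i ω : EuclideanSpace ℝ κ)) P :=
    (WithLp.measurable_toLp 2 _).comp_aemeasurable
      (aemeasurable_pi_lambda _ fun i => (hY2 i).aemeasurable)
  set S₁₁ := momentMatrix P X X
  set S₁₂ := momentMatrix P X Y
  set S₂₂ := momentMatrix P Y Y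
  -- Dividing the correlation hypothesis by `ρ²` is what allows the inflated matrix to be a
  -- covariance; the vector `(X, Z)` exists for this reason.
  have hM : (Matrix.fromBlocks S₁₁ (ρ⁻¹ • S₁₂) (ρ⁻¹ • S₁₂ᵀ) S₂₂).PosSemidef := by
    refine posSemidef_fromBlocks_momentMatrix hX2 hY2 fun a b => ?_
    rw [mul_pow, inv_pow, inv_mul_le_iff₀ (by positivity)]
    exact hcorr a b
  have hS : (Matrix.fromBlocks S₁₁ S₁₂ S₁₂ᵀ S₂₂).PosSemidef := by
    have := posSemidef_fromBlocks_momentMatrix hX2 hY2 (r := 1) fun a b => by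
      rw [one_mul]
      refine (hcorr a b).trans (mul_le_of_le_one_left ?_ hρ.le)
      exact mul_nonneg (integral_nonneg fun _ => sq_nonneg _)
        (integral_nonneg fun _ => sq_nonneg _)
    simpa using this
  have h₂₂ : S₂₂.PosSemidef := hS.submatrix Sum.inr
  set μ := multivariateGaussian 0 (Matrix.fromBlocks S₁₁ (ρ⁻¹ • S₁₂) (ρ⁻¹ • S₁₂ᵀ) S₂₂) with hμ
  set ν := multivariateGaussian 0 S₂₂ with hν
  set c := √(1 - ρ ^ 2) with hc
  have lawXY : P.map (fun ω => (toLp 2 fun a => Sum.elim X Y a ω : EuclideanSpace ℝ (ι ⊕ κ)))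
      = (μ.prod ν).map (fun q => toLp 2 (Sum.elim (fun i => q.1 (Sum.inl i))
        (fun j => ρ * q.1 (Sum.inr j) + c * q.2 j))) := by
    rw [map_coupling_eq_multivariateGaussian hρ0 hρ hS hM h₂₂]
    refine map_toLp_eq_multivariateGaussian hXY ?_ hS ?_
    · rintro (i | j)
      exacts [hX0 i, hY0 j]
    · rintro (i | j) (i' | j') <;> simp [S₁₁, S₁₂, S₂₂, momentMatrix, mul_comm]
  have lawY : P.map (fun ω => (toLp 2 fun j => Y j ω : EuclideanSpace ℝ κ)) = ν :=
    map_toLp_eq_multivariateGaussian hYG hY0 h₂₂ fun i j => rfl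
  have lawZ : μ.map (fun p => (toLp 2 fun j => p (Sum.inr j) : EuclideanSpace ℝ κ)) = ν := by
    have hg : HasGaussianLaw (fun (p : EuclideanSpace ℝ (ι ⊕ κ)) j => p (Sum.inr j)) μ :=
      (IsGaussian.hasGaussianLaw_id (μ := μ)).map_fun
        (ContinuousLinearMap.pi fun j : κ => (EuclideanSpace.proj (Sum.inr j) :
          EuclideanSpace ℝ (ι ⊕ κ) →L[ℝ] ℝ))
    have h0 : ∀ a : ι ⊕ κ, ∫ p : EuclideanSpace ℝ (ι ⊕ κ), p a ∂μ = 0 := fun a => by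
      have h := (EuclideanSpace.proj a : EuclideanSpace ℝ (ι ⊕ κ) →L[ℝ] ℝ).integral_comp_comm
        (IsGaussian.integrable_fun_id (μ := μ))
      simpa [hμ] using h
    refine map_toLp_eq_multivariateGaussian hg (fun j => h0 _) h₂₂ fun i j => ?_
    have h := covariance_eval_multivariateGaussian (μ := 0) hM (Sum.inr i) (Sum.inr j)
    rw [covariance_eq_sub] at h
    · rw [← hμ, h0, zero_mul, sub_zero] at h
      exact h
    · exact (hg.eval i).memLp_two
    · exact (hg.eval j).memLp_two
  have hinl : Measurable fun p : EuclideanSpace ℝ (ι ⊕ κ) =>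
      (toLp 2 fun i => p (Sum.inl i) : EuclideanSpace ℝ ι) := by fun_prop
  have hinr : Measurable fun p : EuclideanSpace ℝ (ι ⊕ κ) =>
      (toLp 2 fun i => p (Sum.inr i) : EuclideanSpace ℝ κ) := by fun_prop
  have hXYm : AEMeasurable
      (fun ω => (toLp 2 fun a => Sum.elim X Y a ω : EuclideanSpace ℝ (ι ⊕ κ))) P :=
    (hXY.toLp_pi 2).aemeasurable
  have hcm : Measurable fun q : EuclideanSpace ℝ (ι ⊕ κ) × EuclideanSpace ℝ κ =>
      (toLp 2 (Sum.elim (fun i => q.1 (Sum.inl i))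
        (fun j => ρ * q.1 (Sum.inr j) + c * q.2 j)) : EuclideanSpace ℝ (ι ⊕ κ)) := by
    refine (WithLp.measurable_toLp 2 _).comp (measurable_pi_lambda _ fun a => ?_)
    cases a <;> simp only [Sum.elim_inl, Sum.elim_inr] <;> fun_prop
  have lawX : P.map (fun ω => (toLp 2 fun i => X i ω : EuclideanSpace ℝ ι))
      = μ.map (fun p => (toLp 2 fun i => p (Sum.inl i) : EuclideanSpace ℝ ι)) := by
    have h := congrArg (Measure.map fun p : EuclideanSpace ℝ (ι ⊕ κ) =>
      (toLp 2 fun i => p (Sum.inl i) : EuclideanSpace ℝ ι)) lawXY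
    rw [AEMeasurable.map_map_of_aemeasurable hinl.aemeasurable hXYm,
      Measure.map_map hinl hcm] at h
    refine h.trans ?_
    change (μ.prod ν).map ((fun p => (toLp 2 fun i => p (Sum.inl i) : EuclideanSpace ℝ ι)) ∘ Prod.fst) = _
    rw [← Measure.map_map hinl measurable_fst, Measure.map_fst_prod]
    simp
  have hGν : MemLp G 2 ν := by
    rw [← lawY]
    exact (memLp_map_measure_iff hG.aestronglyMeasurable hYm).2 hG2
  have hFμ : MemLp (fun p : EuclideanSpace ℝ (ι ⊕ κ) => F (toLp 2 fun i => p (Sum.inl i))) 2 μ := by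
    have h := (memLp_map_measure_iff hF.aestronglyMeasurable hXm).2 hF2
    rw [lawX] at h
    exact (memLp_map_measure_iff hF.aestronglyMeasurable hinl.aemeasurable).1 h
  have hH : Measurable fun p : EuclideanSpace ℝ (ι ⊕ κ) =>
      F (toLp 2 fun i => p (Sum.inl i)) * G (toLp 2 fun i => p (Sum.inr i)) :=
    (hF.comp hinl).mul (hG.comp hinr)
  have hGm : ∀ z : EuclideanSpace ℝ κ, Measurable fun w => G (ρ • z + c • w) := fun z =>
    hG.comp (by fun_prop)
  have iFG : Integrable (fun q : EuclideanSpace ℝ (ι ⊕ κ) × EuclideanSpace ℝ κ =>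
      F (toLp 2 fun i => q.1 (Sum.inl i)) *
        G (ρ • (toLp 2 fun j => q.1 (Sum.inr j)) + c • q.2)) (μ.prod ν) := by
    have h := (integrable_map_measure hH.aestronglyMeasurable hXYm).2
      (hF2.integrable_mul hG2)
    rw [lawXY] at h
    exact (integrable_map_measure hH.aestronglyMeasurable hcm.aemeasurable).1 h
  -- Integrating out `W` with `(X, Z)` fixed gives `E[F(X)G(Y)] = E[F(X)(P_ρG)(Z)]`.
  have e1 : ∫ ω, F (toLp 2 fun i => X i ω) * G (toLp 2 fun i => Y i ω) ∂P
      = ∫ p, F (toLp 2 fun i => p (Sum.inl i)) *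
        ∫ w, G (ρ • (toLp 2 fun j => p (Sum.inr j)) + c • w) ∂ν ∂μ := by
    have h := integral_map hXYm hH.aestronglyMeasurable
    rw [lawXY, integral_map hcm.aemeasurable hH.aestronglyMeasurable] at h
    refine h.symm.trans ((integral_prod _ iFG).trans ?_)
    refine integral_congr_ae (ae_of_all _ fun p => ?_)
    exact integral_const_mul (F (toLp 2 fun i => p (Sum.inl i)))
      fun w => G (ρ • (toLp 2 fun j => p (Sum.inr j)) + c • w)
  have e2 : ∫ ω, F (toLp 2 fun i => X i ω) ∂P = ∫ p, F (toLp 2 fun i => p (Sum.inl i)) ∂μ := by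
    rw [← integral_map hXm hF.aestronglyMeasurable, lawX,
      integral_map hinl.aemeasurable hF.aestronglyMeasurable]
  have e3 : ∫ ω, G (toLp 2 fun i => Y i ω) ∂P = ∫ w, G w ∂ν := by
    rw [← integral_map hYm hG.aestronglyMeasurable, lawY]
  have l2 : ∫⁻ ω, ‖F (toLp 2 fun i => X i ω)‖ₑ ^ 2 ∂P
      = ∫⁻ p, ‖F (toLp 2 fun i => p (Sum.inl i))‖ₑ ^ 2 ∂μ := by
    rw [← lintegral_map' (f := fun x => ‖F x‖ₑ ^ 2) (by fun_prop) hXm, lawX,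
      lintegral_map (by fun_prop) hinl]
  have l3 : ∫⁻ ω, ‖G (toLp 2 fun i => Y i ω)‖ₑ ^ 2 ∂P = ∫⁻ w, ‖G w‖ₑ ^ 2 ∂ν := by
    rw [← lintegral_map' (f := fun x => ‖G x‖ₑ ^ 2) (by fun_prop) hYm, lawY]
  have i1 : Integrable (fun p : EuclideanSpace ℝ (ι ⊕ κ) => F (toLp 2 fun i => p (Sum.inl i)) *
        ∫ w, G (ρ • (toLp 2 fun j => p (Sum.inr j)) + c • w) ∂ν) μ := by
    refine iFG.integral_prod_left.congr (ae_of_all _ fun p => ?_)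
    exact integral_const_mul (F (toLp 2 fun i => p (Sum.inl i)))
      fun w => G (ρ • (toLp 2 fun j => p (Sum.inr j)) + c • w)
  have i2 : Integrable (fun p : EuclideanSpace ℝ (ι ⊕ κ) => F (toLp 2 fun i => p (Sum.inl i)) *
        ∫ w, G w ∂ν) μ := (hFμ.integrable (by norm_num)).mul_const _
  set Q : EuclideanSpace ℝ κ → ℂ := fun z => (∫ w, G (ρ • z + c • w) ∂ν) - ∫ w, G w ∂ν with hQ
  have hQm : Measurable Q := by
    refine Measurable.sub_const ?_ _
    refine StronglyMeasurable.measurable ?_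
    exact StronglyMeasurable.integral_prod_right'
      (f := fun p : EuclideanSpace ℝ κ × EuclideanSpace ℝ κ => G (ρ • p.1 + c • p.2))
      (hG.comp (by fun_prop)).stronglyMeasurable
  rw [e1, e2, e3, ← integral_mul_const, ← integral_sub i1 i2, l2, l3]
  simp_rw [← mul_sub]
  -- What remains is `E[F(X)(P_ρG - EG)(Z)]`. Cauchy–Schwarz decouples it, and `Z` has the law of
  -- `Y`, so the estimate on `P_ρ` applies.
  calc _ ≤ (∫⁻ p, ‖F (toLp 2 fun i => p (Sum.inl i))‖ₑ * ‖Q (toLp 2 fun j => p (Sum.inr j))‖ₑ ∂μ) ^ 2 := by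
        gcongr
        refine (enorm_integral_le_lintegral_enorm _).trans_eq ?_
        simp_rw [enorm_mul]
        rfl
    _ ≤ (∫⁻ p, ‖F (toLp 2 fun i => p (Sum.inl i))‖ₑ ^ 2 ∂μ) *
          ∫⁻ p, ‖Q (toLp 2 fun j => p (Sum.inr j))‖ₑ ^ 2 ∂μ :=
        sq_lintegral_mul_le (hF.comp hinl).enorm.aemeasurable (hQm.comp hinr).enorm.aemeasurable
    _ = (∫⁻ p, ‖F (toLp 2 fun i => p (Sum.inl i))‖ₑ ^ 2 ∂μ) * ∫⁻ z, ‖Q z‖ₑ ^ 2 ∂ν := by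
        rw [← lawZ, lintegral_map (by fun_prop) hinr]
    _ ≤ (∫⁻ p, ‖F (toLp 2 fun i => p (Sum.inl i))‖ₑ ^ 2 ∂μ) *
          (ENNReal.ofReal (((1 - ρ ^ 2)⁻¹) ^ Fintype.card κ - 1) * ∫⁻ w, ‖G w‖ₑ ^ 2 ∂ν) := by
        gcongr
        exact lintegral_enorm_sq_ornsteinUhlenbeck_multivariateGaussian_sub_le hρ S₂₂ hG hGν
    _ = _ := by ring

end Gebelein
/-! ### Trigonometric moments of the Gaussian measure of variance `1/2` -/

section Moments

/-- The Gaussian measure `π^{-1/2} e^{-s²} ds`. -/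
noncomputable abbrev halfGaussian : Measure ℝ := gaussianReal 0 (1 / 2)

/-- `E[sⁿ e^{iκs}]` for the measure `π^{-1/2} e^{-s²} ds`. -/
noncomputable def expMoment (n : ℕ) (κ : ℝ) : ℂ :=
  ∫ s, (s : ℂ) ^ n * Complex.exp (κ * Complex.I * s) ∂halfGaussian

theorem hasDerivAt_expMoment (n : ℕ) (κ : ℝ) :
    HasDerivAt (expMoment n) (Complex.I * expMoment (n + 1) κ) κ := by
  have hz : ((κ : ℂ) * Complex.I).re ∈ interior (integrableExpSet id halfGaussian) := by
    simp [halfGaussian]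
  have h := hasDerivAt_integral_pow_mul_exp hz n
  have h2 : HasDerivAt (fun κ : ℝ => (κ : ℂ) * Complex.I) (1 * Complex.I) κ :=
    (Complex.ofRealCLM.hasDerivAt (x := κ)).mul_const Complex.I
  have h3 := h.scomp κ h2
  simp only [Function.comp_def, id, one_mul, smul_eq_mul] at h3
  exact h3

theorem expMoment_zero (κ : ℝ) : expMoment 0 κ = Real.exp (-(κ ^ 2 / 4)) := by
  have h := complexMGF_id_gaussianReal (μ := 0) (v := 1 / 2) (κ * Complex.I)
  rw [complexMGF] at h
  simp only [expMoment, pow_zero, one_mul]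
  refine h.trans ?_
  push_cast
  congr 1
  rw [mul_pow, Complex.I_sq]; ring

theorem hasDerivAt_exp_neg_sq_div_four (κ : ℝ) :
    HasDerivAt (fun κ : ℝ => Real.exp (-(κ ^ 2 / 4)))
      (Real.exp (-(κ ^ 2 / 4)) * (-(κ / 2))) κ := by
  have : HasDerivAt (fun κ : ℝ => -(κ ^ 2 / 4)) (-(κ / 2)) κ := by
    refine ((hasDerivAt_pow 2 κ).div_const 4).neg.congr_deriv ?_
    norm_num; ring
  exact this.exp

/-- Differentiation in `κ` raises `n` by one and preserves the form polynomial times `e^{-κ²/4}`,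
with the recursion `p ↦ -i(p' - κp/2)`. -/
theorem exists_expMoment_eq (n : ℕ) : ∃ p : Polynomial ℂ, ∀ κ : ℝ,
    expMoment n κ = p.eval (κ : ℂ) * Real.exp (-(κ ^ 2 / 4)) := by
  induction n with
  | zero => exact ⟨1, fun κ => by rw [expMoment_zero]; simp⟩
  | succ n ih =>
    obtain ⟨p, hp⟩ := ih
    refine ⟨Polynomial.C (-Complex.I) * (p.derivative - Polynomial.C (1 / 2) * Polynomial.X * p),
      fun κ => ?_⟩
    have h1 := hasDerivAt_expMoment n κ
    have h2 : HasDerivAt (fun κ : ℝ => p.eval (κ : ℂ)) (p.derivative.eval (κ : ℂ)) κ :=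
      (p.hasDerivAt (κ : ℂ)).comp_ofReal
    have h4 := h2.mul (hasDerivAt_exp_neg_sq_div_four κ).ofReal_comp
    have h5 : expMoment n = fun κ : ℝ => p.eval (κ : ℂ) * Real.exp (-(κ ^ 2 / 4)) := funext hp
    rw [h5] at h1
    have h6 := h1.unique h4
    have h7 : expMoment (n + 1) κ = -Complex.I * (Complex.I * expMoment (n + 1) κ) := by
      rw [← mul_assoc]; simp
    rw [h7, h6]
    simp only [Polynomial.eval_mul, Polynomial.eval_C, Polynomial.eval_sub, Polynomial.eval_X]
    push_cast
    ring

theorem exists_bound_complex_poly_mul_gaussian (p : Polynomial ℂ) :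
    ∃ C : ℝ, ∀ x : ℝ, ‖p.eval (x : ℂ)‖ * Real.exp (-(x ^ 2 / 8)) ≤ C := by
  induction p using Polynomial.induction_on' with
  | add p q hp hq =>
    obtain ⟨C, hC⟩ := hp
    obtain ⟨D, hD⟩ := hq
    refine ⟨C + D, fun x => ?_⟩
    have h1 : ‖(p + q).eval (x : ℂ)‖ ≤ ‖p.eval (x : ℂ)‖ + ‖q.eval (x : ℂ)‖ := by
      rw [Polynomial.eval_add]; exact norm_add_le _ _
    have h2 := mul_le_mul_of_nonneg_right h1 (Real.exp_pos (-(x ^ 2 / 8))).le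
    linarith [hC x, hD x]
  | monomial m a =>
    obtain ⟨C, hC⟩ := exists_bound_poly_mul_gaussian (Polynomial.X ^ m)
    refine ⟨‖a‖ * 2 ^ m * C, fun x => ?_⟩
    have h := hC (x / 2)
    have e : (x / 2) ^ 2 / 2 = x ^ 2 / 8 := by ring
    rw [Polynomial.eval_pow, Polynomial.eval_X, e, abs_pow, abs_div, div_pow, abs_two] at h
    rw [Polynomial.eval_monomial, norm_mul, norm_pow, Complex.norm_real, Real.norm_eq_abs]
    calc ‖a‖ * |x| ^ m * Real.exp (-(x ^ 2 / 8))
        = ‖a‖ * 2 ^ m * (|x| ^ m / 2 ^ m * Real.exp (-(x ^ 2 / 8))) := by field_simp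
      _ ≤ _ := by gcongr

/-- Half of the exponent `κ²/4` is given up to absorb the polynomial. -/
theorem exists_norm_expMoment_le (n : ℕ) : ∃ C : ℝ, 0 ≤ C ∧ ∀ κ : ℝ,
    ‖expMoment n κ‖ ≤ C * Real.exp (-(κ ^ 2 / 8)) := by
  obtain ⟨p, hp⟩ := exists_expMoment_eq n
  obtain ⟨C, hC⟩ := exists_bound_complex_poly_mul_gaussian p
  refine ⟨C, le_trans (by positivity) (hC 0), fun κ => ?_⟩
  have e : Real.exp (-(κ ^ 2 / 4)) = Real.exp (-(κ ^ 2 / 8)) * Real.exp (-(κ ^ 2 / 8)) := by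
    rw [← Real.exp_add]; congr 1; ring
  rw [hp, norm_mul, Complex.norm_real, Real.norm_eq_abs, abs_of_pos (Real.exp_pos _), e, ← mul_assoc]
  gcongr
  exact hC κ

theorem expMoment_one (κ : ℝ) :
    expMoment 1 κ = Complex.I * ((κ / 2 * Real.exp (-(κ ^ 2 / 4)) : ℝ) : ℂ) := by
  have h1 := hasDerivAt_expMoment 0 κ
  rw [funext expMoment_zero] at h1
  have h2 := h1.unique (hasDerivAt_exp_neg_sq_div_four κ).ofReal_comp
  have h3 : expMoment 1 κ = -Complex.I * (Complex.I * expMoment (0 + 1) κ) := by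
    rw [← mul_assoc]; simp
  rw [h3, h2]; push_cast; ring

theorem expMoment_two (κ : ℝ) :
    expMoment 2 κ = (((1 / 2 - κ ^ 2 / 4) * Real.exp (-(κ ^ 2 / 4)) : ℝ) : ℂ) := by
  have h1 := hasDerivAt_expMoment 1 κ
  rw [funext expMoment_one] at h1
  have h2 : HasDerivAt (fun κ : ℝ => κ / 2 * Real.exp (-(κ ^ 2 / 4)))
      (1 / 2 * Real.exp (-(κ ^ 2 / 4)) + κ / 2 * (Real.exp (-(κ ^ 2 / 4)) * (-(κ / 2)))) κ :=
    ((hasDerivAt_id κ).div_const 2).mul (hasDerivAt_exp_neg_sq_div_four κ)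
  have h4 := h1.unique (h2.ofReal_comp.const_mul Complex.I)
  have h5 := mul_left_cancel₀ Complex.I_ne_zero h4
  rw [h5]; push_cast; ring

theorem integrable_pow_mul_exp (n : ℕ) (κ : ℝ) :
    Integrable (fun s : ℝ => (s : ℂ) ^ n * Complex.exp (κ * Complex.I * s)) halfGaussian := by
  have h : Integrable (fun s : ℝ => ‖s‖ ^ n) halfGaussian :=
    (IsGaussian.memLp_id halfGaussian (n : ENNReal) (by simp)).integrable_norm_pow'
  refine Integrable.mono' h (by fun_prop) (ae_of_all _ fun s => ?_)
  rw [norm_mul, norm_pow, Complex.norm_real, mul_right_comm, ← Complex.ofReal_mul,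
    Complex.norm_exp_ofReal_mul_I, mul_one]

/-- The real function `s ↦ Re((A + b s) e^{-iks})`. -/
noncomputable def trigPoly (k : ℝ) (A b : ℂ) (s : ℝ) : ℝ :=
  ((A + b * s) * Complex.exp (-(k * Complex.I * s))).re

/-- `E[sⁿ e^{iσs} T(s)]` for `T = trigPoly k A b`. -/
noncomputable def trigPairing (k : ℝ) (A b : ℂ) (n : ℕ) (σ : ℝ) : ℂ :=
  1 / 2 * (A * expMoment n (σ - k) + b * expMoment (n + 1) (σ - k)
    + conj A * expMoment n (σ + k) + conj b * expMoment (n + 1) (σ + k))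

theorem hasDerivAt_trigPairing (k : ℝ) (A b : ℂ) (n : ℕ) (σ : ℝ) :
    HasDerivAt (trigPairing k A b n) (Complex.I * trigPairing k A b (n + 1) σ) σ := by
  have h1 : ∀ m, HasDerivAt (fun σ => expMoment m (σ - k))
      (Complex.I * expMoment (m + 1) (σ - k)) σ := fun m => by
    simpa using (hasDerivAt_expMoment m (σ - k)).comp_sub_const σ k
  have h2 : ∀ m, HasDerivAt (fun σ => expMoment m (σ + k))
      (Complex.I * expMoment (m + 1) (σ + k)) σ := fun m => by
    simpa using (hasDerivAt_expMoment m (σ + k)).comp_add_const σ k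
  have h := (((((h1 n).const_mul A).add ((h1 (n + 1)).const_mul b)).add
    ((h2 n).const_mul (conj A))).add ((h2 (n + 1)).const_mul (conj b))).const_mul (1 / 2)
  refine h.congr_deriv ?_
  rw [trigPairing]; ring

theorem ofReal_trigPoly (k : ℝ) (A b : ℂ) (s : ℝ) :
    (trigPoly k A b s : ℂ) = 1 / 2 * ((A + b * s) * Complex.exp (-(k * Complex.I * s))
      + (conj A + conj b * s) * Complex.exp (k * Complex.I * s)) := by
  rw [trigPoly, Complex.re_eq_add_conj, map_mul, map_add, map_mul, Complex.conj_ofReal,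
    ← Complex.exp_conj]
  have : conj (-(k * Complex.I * s) : ℂ) = k * Complex.I * s := by
    simp
  rw [this]; ring

theorem trigPoly_eq_re (k : ℝ) (A b : ℂ) (s : ℝ) :
    trigPoly k A b s = ((conj A + conj b * s) * Complex.exp (k * Complex.I * s)).re := by
  rw [trigPoly, ← Complex.conj_re, map_mul, map_add, map_mul, Complex.conj_ofReal,
    ← Complex.exp_conj]
  have : conj (-(k * Complex.I * s) : ℂ) = k * Complex.I * s := by
    simp
  rw [this]

theorem integral_trigPoly_mul_trigPoly (k k' : ℝ) (A b A' b' : ℂ) :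
    ∫ s, trigPoly k A b s * trigPoly k' A' b' s ∂halfGaussian
      = (conj A * trigPairing k' A' b' 0 k + conj b * trigPairing k' A' b' 1 k).re := by
  have e : ∀ s : ℝ, trigPoly k A b s * trigPoly k' A' b' s
      = (1 / 2 * conj A * A' * ((s : ℂ) ^ 0 * Complex.exp ((k - k' : ℝ) * Complex.I * s))
        + 1 / 2 * (conj A * b' + conj b * A') *
          ((s : ℂ) ^ 1 * Complex.exp ((k - k' : ℝ) * Complex.I * s))
        + 1 / 2 * conj b * b' * ((s : ℂ) ^ 2 * Complex.exp ((k - k' : ℝ) * Complex.I * s))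
        + 1 / 2 * conj A * conj A' * ((s : ℂ) ^ 0 * Complex.exp ((k + k' : ℝ) * Complex.I * s))
        + 1 / 2 * (conj A * conj b' + conj b * conj A') *
          ((s : ℂ) ^ 1 * Complex.exp ((k + k' : ℝ) * Complex.I * s))
        + 1 / 2 * conj b * conj b' *
          ((s : ℂ) ^ 2 * Complex.exp ((k + k' : ℝ) * Complex.I * s))).re := fun s => by
    rw [trigPoly_eq_re k, ← Complex.re_mul_ofReal, ofReal_trigPoly]
    have e1 : Complex.exp ((k - k' : ℝ) * Complex.I * s)
        = Complex.exp (k * Complex.I * s) * Complex.exp (-(k' * Complex.I * s)) := by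
      rw [← Complex.exp_add]; congr 1; push_cast; ring
    have e2 : Complex.exp ((k + k' : ℝ) * Complex.I * s)
        = Complex.exp (k * Complex.I * s) * Complex.exp (k' * Complex.I * s) := by
      rw [← Complex.exp_add]; congr 1; push_cast; ring
    rw [e1, e2]
    congr 1
    ring
  have i0 := fun (c : ℂ) n κ => (integrable_pow_mul_exp n κ).const_mul c
  simp_rw [e]
  have i1 := (i0 (1 / 2 * conj A * A') 0 (k - k')).add
    (i0 (1 / 2 * (conj A * b' + conj b * A')) 1 (k - k'))
  have i2 := i1.add (i0 (1 / 2 * conj b * b') 2 (k - k'))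
  have i3 := i2.add (i0 (1 / 2 * conj A * conj A') 0 (k + k'))
  have i4 := i3.add (i0 (1 / 2 * (conj A * conj b' + conj b * conj A')) 1 (k + k'))
  have i5 := i4.add (i0 (1 / 2 * conj b * conj b') 2 (k + k'))
  have := Complex.reCLM.integral_comp_comm i5
  simp only [Complex.reCLM_apply, Pi.add_apply] at this
  refine this.trans (congrArg Complex.re ?_)
  have a5 := integral_add i4 (i0 (1 / 2 * conj b * conj b') 2 (k + k'))
  have a4 := integral_add i3 (i0 (1 / 2 * (conj A * conj b' + conj b * conj A')) 1 (k + k'))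
  have a3 := integral_add i2 (i0 (1 / 2 * conj A * conj A') 0 (k + k'))
  have a2 := integral_add i1 (i0 (1 / 2 * conj b * b') 2 (k - k'))
  have a1 := integral_add (i0 (1 / 2 * conj A * A') 0 (k - k'))
    (i0 (1 / 2 * (conj A * b' + conj b * A')) 1 (k - k'))
  simp only [Pi.add_apply] at a1 a2 a3 a4 a5
  rw [a5, a4, a3, a2, a1]
  simp only [integral_const_mul]
  simp only [trigPairing, expMoment]
  ring

/-- The Gram form splits by parity in `s`: `A.re, b.im` multiply the even functions `cos ks, s sin
ks`, and `A.im, b.re` the odd functions `sin ks, s cos ks`. Lower bounds therefore reduce to two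
forms in two variables. -/
theorem integral_trigPoly_sq (k : ℝ) (A b : ℂ) :
    ∫ s, trigPoly k A b s ^ 2 ∂halfGaussian
      = (1 + Real.exp (-k ^ 2)) / 2 * A.re ^ 2 + k * Real.exp (-k ^ 2) * (A.re * b.im)
        + (1 - (1 - 2 * k ^ 2) * Real.exp (-k ^ 2)) / 4 * b.im ^ 2
        + (1 - Real.exp (-k ^ 2)) / 2 * A.im ^ 2 + k * Real.exp (-k ^ 2) * (A.im * b.re)
        + (1 + (1 - 2 * k ^ 2) * Real.exp (-k ^ 2)) / 4 * b.re ^ 2 := by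
  simp_rw [sq (trigPoly _ _ _ _)]
  rw [integral_trigPoly_mul_trigPoly]
  simp only [trigPairing, zero_add, one_add_one_eq_two, expMoment_zero, expMoment_one,
    expMoment_two, sub_self]
  have e : Real.exp (-((k + k) ^ 2 / 4)) = Real.exp (-k ^ 2) := by congr 1; ring
  rw [e]
  generalize Real.exp (-k ^ 2) = Q
  simp [-Complex.ofReal_mul, -Complex.ofReal_div, -Complex.ofReal_sub, -Complex.ofReal_pow]
  ring

/-- Completing the square in either variable bounds the form below by the determinant over a
diagonal entry times the square of the other variable; the two bounds are averaged. -/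
theorem quadratic_form_lower_bound {a b c d M N x y : ℝ} (ha : 0 < a) (haM : a ≤ M) (hcN : c ≤ N)
    (hd : 0 < d) (hdet : d ≤ a * c - b ^ 2) :
    d / (2 * N) * x ^ 2 + d / (2 * M) * y ^ 2 ≤ a * x ^ 2 + 2 * b * (x * y) + c * y ^ 2 := by
  have hc : 0 < c := by
    by_contra h
    nlinarith [sq_nonneg b, mul_nonneg ha.le (neg_nonneg.2 (not_lt.1 h))]
  have h1 : d / N * x ^ 2 ≤ a * x ^ 2 + 2 * b * (x * y) + c * y ^ 2 := by
    rw [div_mul_eq_mul_div, div_le_iff₀ (by linarith)]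
    have : d * x ^ 2 ≤ (a * x ^ 2 + 2 * b * (x * y) + c * y ^ 2) * c := by
      nlinarith [sq_nonneg (c * y + b * x), mul_le_mul_of_nonneg_right hdet (sq_nonneg x)]
    have h0 : 0 ≤ a * x ^ 2 + 2 * b * (x * y) + c * y ^ 2 := by
      by_contra h
      nlinarith [mul_nonneg hd.le (sq_nonneg x)]
    exact this.trans (mul_le_mul_of_nonneg_left hcN h0)
  have h2 : d / M * y ^ 2 ≤ a * x ^ 2 + 2 * b * (x * y) + c * y ^ 2 := by
    rw [div_mul_eq_mul_div, div_le_iff₀ (by linarith)]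
    have : d * y ^ 2 ≤ (a * x ^ 2 + 2 * b * (x * y) + c * y ^ 2) * a := by
      nlinarith [sq_nonneg (a * x + b * y), mul_le_mul_of_nonneg_right hdet (sq_nonneg y)]
    have h0 : 0 ≤ a * x ^ 2 + 2 * b * (x * y) + c * y ^ 2 := by
      by_contra h
      nlinarith [mul_nonneg hd.le (sq_nonneg y)]
    exact this.trans (mul_le_mul_of_nonneg_left haM h0)
  have e1 : d / (2 * N) = d / N / 2 := by rw [mul_comm, div_div]
  have e2 : d / (2 * M) = d / M / 2 := by rw [mul_comm, div_div]
  rw [e1, e2]; linarith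

theorem le_integral_trigPoly_sq_of_one_le {k : ℝ} (hk : 1 ≤ k) (A b : ℂ) :
    1 / 200 * (A.re ^ 2 + A.im ^ 2 + b.re ^ 2 + b.im ^ 2)
      ≤ ∫ s, trigPoly k A b s ^ 2 ∂halfGaussian := by
  rw [integral_trigPoly_sq]
  have hx : 1 ≤ k ^ 2 := by nlinarith
  have e1 : Real.exp (-1) ≤ 0.37 := by
    rw [Real.exp_neg, inv_le_comm₀ (Real.exp_pos _) (by norm_num)]
    exact le_trans (by norm_num) Real.exp_one_gt_d9.le
  have hQ0 : 0 < Real.exp (-k ^ 2) := Real.exp_pos _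
  have hQ1 : Real.exp (-k ^ 2) ≤ 0.37 := (Real.exp_le_exp.2 (by linarith)).trans e1
  have hxQ : k ^ 2 * Real.exp (-k ^ 2) ≤ 0.37 := by
    have h := Real.add_one_le_exp (k ^ 2 - 1)
    have h2 : Real.exp (k ^ 2 - 1) * Real.exp (-k ^ 2) = Real.exp (-1) := by
      rw [← Real.exp_add]; congr 1; ring
    nlinarith
  generalize Real.exp (-k ^ 2) = Q at *
  -- With `Q = e^{-k²}` the even and odd determinants are `(1 - Q² + 2k²Q)/8` and `(1 - Q² -
  -- 2k²Q)/8`. Since `Q` and `k²Q` are at most `0.37`, they exceed `0.1` and `0.015`.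
  have he := quadratic_form_lower_bound (a := (1 + Q) / 2) (b := k * Q / 2)
    (c := (1 - (1 - 2 * k ^ 2) * Q) / 4) (d := 0.1) (M := 1) (N := 1) (x := A.re) (y := b.im)
    (by linarith) (by linarith) (by linarith) (by norm_num) (by nlinarith)
  have ho := quadratic_form_lower_bound (a := (1 - Q) / 2) (b := k * Q / 2)
    (c := (1 + (1 - 2 * k ^ 2) * Q) / 4) (d := 0.015) (M := 1) (N := 1) (x := A.im) (y := b.re)
    (by linarith) (by linarith) (by nlinarith) (by norm_num) (by nlinarith)
  nlinarith [sq_nonneg A.re, sq_nonneg A.im, sq_nonneg b.re, sq_nonneg b.im]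

/-- Taylor expansion in `k` suggests the coordinates. The even part is to leading order `A.re + k
b.im s²`. The odd part starts with `(k A.im + b.re) s`, and its cubic term, beyond a multiple of
that coefficient, is of size `k² b.re`. In these four quantities the form stays uniformly
nondegenerate as `k → 0`. -/
theorem le_integral_trigPoly_sq_of_le_one {k : ℝ} (hk0 : 0 < k) (hk : k ≤ 1) (A b : ℂ) :
    1 / 144 * (A.re ^ 2 + (k * b.im) ^ 2 + (k * A.im + b.re) ^ 2 + (k ^ 2 * b.re) ^ 2)
      ≤ ∫ s, trigPoly k A b s ^ 2 ∂halfGaussian := by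
  rw [integral_trigPoly_sq]
  obtain ⟨x, hxk⟩ : ∃ x, x = k ^ 2 := ⟨_, rfl⟩
  have hx0 : 0 < x := by rw [hxk]; positivity
  have hx1 : x ≤ 1 := by rw [hxk]; nlinarith
  have e1 : 1 / 3 ≤ Real.exp (-1) := by
    rw [Real.exp_neg, le_inv_comm₀ (by norm_num) (Real.exp_pos _)]
    exact Real.exp_one_lt_d9.le.trans (by norm_num)
  have hQ0 : 1 / 3 ≤ Real.exp (-k ^ 2) := e1.trans (Real.exp_le_exp.2 (by linarith))
  have hE : 1 + x + x ^ 2 / 2 + x ^ 3 / 6 ≤ Real.exp x := by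
    have := Real.sum_le_exp_of_nonneg hx0.le 4
    simp [Finset.sum_range_succ, Nat.factorial] at this
    linarith
  have hQE : Real.exp (-k ^ 2) * Real.exp x = 1 := by
    rw [← Real.exp_add, hxk]; simp
  -- This and the next bound bracket `e^{-x}` between Taylor polynomials, each proved by multiplying
  -- with a polynomial bound on `e^x`. The third order is needed because the odd block degenerates
  -- to that order.
  have hQup : Real.exp (-k ^ 2) ≤ 1 - x + x ^ 2 / 2 := by
    have h1 : 1 ≤ (1 - x + x ^ 2 / 2) * (1 + x + x ^ 2 / 2 + x ^ 3 / 6) := by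
      have : (1 - x + x ^ 2 / 2) * (1 + x + x ^ 2 / 2 + x ^ 3 / 6)
        = 1 + x ^ 3 / 6 + x ^ 4 / 12 + x ^ 5 / 12 := by ring
      rw [this]; linarith [pow_pos hx0 3, pow_pos hx0 4, pow_pos hx0 5]
    have h2 : 0 < 1 - x + x ^ 2 / 2 := by nlinarith [sq_nonneg (x - 1)]
    have h3 := mul_le_mul_of_nonneg_left hE h2.le
    have hp := Real.exp_pos x
    by_contra h
    nlinarith [mul_lt_mul_of_pos_right (not_le.1 h) hp]
  have hQlo : 1 - x + x ^ 2 / 2 - x ^ 3 / 6 ≤ Real.exp (-k ^ 2) := by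
    have hE' : Real.exp x ≤ 1 + x + x ^ 2 / 2 + x ^ 3 / 6 + x ^ 4 * (5 / 96) := by
      have := Real.exp_bound' hx0.le hx1 (n := 4) (by norm_num)
      simp [Finset.sum_range_succ, Nat.factorial] at this
      linarith
    have h1 : (1 - x + x ^ 2 / 2 - x ^ 3 / 6) *
        (1 + x + x ^ 2 / 2 + x ^ 3 / 6 + x ^ 4 * (5 / 96)) ≤ 1 := by
      have : (1 - x + x ^ 2 / 2 - x ^ 3 / 6) *
          (1 + x + x ^ 2 / 2 + x ^ 3 / 6 + x ^ 4 * (5 / 96))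
          = 1 - x ^ 4 * (1 / 12 - 5 / 96 + (5 / 96) * x + (1 / 36 - 5 / 192) * x ^ 2
            + (5 / 576) * x ^ 3) := by ring
      rw [this]
      have : 0 ≤ x ^ 4 * (1 / 12 - 5 / 96 + (5 / 96) * x + (1 / 36 - 5 / 192) * x ^ 2
            + (5 / 576) * x ^ 3) := by
        have h32 : (0:ℝ) ≤ 1 / 12 - 5 / 96 + (5 / 96) * x + (1 / 36 - 5 / 192) * x ^ 2
            + (5 / 576) * x ^ 3 := by
          nlinarith [pow_pos hx0 2, pow_pos hx0 3]
        exact mul_nonneg (by positivity) h32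
      linarith
    have h2 : 0 ≤ 1 - x + x ^ 2 / 2 - x ^ 3 / 6 := by
      nlinarith [sq_nonneg (x - 1), mul_nonneg (sq_nonneg x) (sub_nonneg.2 hx1)]
    have h3 := mul_le_mul_of_nonneg_left hE' h2
    have hp := Real.exp_pos x
    by_contra h
    nlinarith [mul_lt_mul_of_pos_right (not_le.1 h) hp]
  -- Up to the factor `8` this is the determinant of the odd block; it equals `Q(e^x - e^{-x} -
  -- 2x)`, which vanishes exactly to third order at `0`.
  have hdet : x ^ 3 / 18 ≤ 1 - Real.exp (-k ^ 2) ^ 2 - 2 * x * Real.exp (-k ^ 2) := by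
    have h1 : 1 - Real.exp (-k ^ 2) ^ 2 - 2 * x * Real.exp (-k ^ 2)
        = Real.exp (-k ^ 2) * (Real.exp x - Real.exp (-k ^ 2) - 2 * x) := by
      linear_combination -hQE
    have h2 : x ^ 3 / 6 ≤ Real.exp x - Real.exp (-k ^ 2) - 2 * x := by linarith
    rw [h1]
    nlinarith [pow_pos hx0 3]
  clear hQE hE
  generalize Real.exp (-k ^ 2) = Q at *
  have he := quadratic_form_lower_bound (a := (1 + Q) / 2) (b := k * Q / 2)
    (c := (1 - (1 - 2 * k ^ 2) * Q) / 4) (d := x / 16) (M := 1) (N := 3 * x / 4) (x := A.re)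
    (y := b.im) (by linarith) (by nlinarith) (by rw [← hxk]; nlinarith) (by positivity)
    (by
      have : (1 + Q) / 2 * ((1 - (1 - 2 * k ^ 2) * Q) / 4) - (k * Q / 2) ^ 2
        = ((1 - Q) * (1 + Q) + 2 * x * Q) / 8 := by rw [hxk]; ring
      rw [this]; nlinarith)
  -- The odd form is rewritten in `k A.im + b.re` and `b.re`. The first diagonal entry is at most
  -- `1/2`, the second at most `x²/2`, and the determinant `(1 - Q² - 2xQ)/(8x)` is at least
  -- `x²/144`. The identity `eo` below verifies the substitution.
  have ho := quadratic_form_lower_bound (a := (1 - Q) / (2 * x)) (b := Q / 2 - (1 - Q) / (2 * x))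
    (c := (1 - Q) / (2 * x) - Q + (1 + (1 - 2 * x) * Q) / 4) (d := x ^ 2 / 144) (M := 1 / 2)
    (N := x ^ 2 / 2) (x := k * A.im + b.re) (y := b.re)
    (div_pos (by nlinarith) (by positivity))
    (by rw [div_le_iff₀ (by positivity)]; nlinarith)
    (by
      have : (1 - Q) / (2 * x) - Q + (1 + (1 - 2 * x) * Q) / 4
        = (2 + x - Q * (2 + 3 * x + 2 * x ^ 2)) / (4 * x) := by field_simp; ring
      rw [this, div_le_iff₀ (by positivity)]
      have h1 : (1 - x + x ^ 2 / 2 - x ^ 3 / 6) * (2 + 3 * x + 2 * x ^ 2)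
          ≤ Q * (2 + 3 * x + 2 * x ^ 2) := mul_le_mul_of_nonneg_right hQlo (by positivity)
      have h2 : (1 - x + x ^ 2 / 2 - x ^ 3 / 6) * (2 + 3 * x + 2 * x ^ 2)
          = 2 + x - 5 / 6 * x ^ 3 + x ^ 4 / 2 - x ^ 5 / 3 := by ring
      have h3 : 0 ≤ x ^ 4 * (1 / 2 - x / 3) := mul_nonneg (by positivity) (by linarith)
      nlinarith [pow_pos hx0 3])
    (by positivity)
    (by
      have : (1 - Q) / (2 * x) * ((1 - Q) / (2 * x) - Q + (1 + (1 - 2 * x) * Q) / 4)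
          - (Q / 2 - (1 - Q) / (2 * x)) ^ 2 = (1 - Q ^ 2 - 2 * x * Q) / (8 * x) := by
        field_simp; ring
      rw [this, le_div_iff₀ (by positivity)]
      linarith)
  have hk' : k ≠ 0 := hk0.ne'
  have eo : (1 - Q) / (2 * x) * (k * A.im + b.re) ^ 2
      + 2 * (Q / 2 - (1 - Q) / (2 * x)) * ((k * A.im + b.re) * b.re)
      + ((1 - Q) / (2 * x) - Q + (1 + (1 - 2 * x) * Q) / 4) * b.re ^ 2
      = (1 - Q) / 2 * A.im ^ 2 + k * Q * (A.im * b.re) + (1 + (1 - 2 * k ^ 2) * Q) / 4 * b.re ^ 2 := by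
    rw [hxk]; field_simp; ring
  rw [eo] at ho
  have c1 : x / 16 / (2 * (3 * x / 4)) = 1 / 24 := by field_simp; norm_num
  have c2 : x ^ 2 / 144 / (2 * (x ^ 2 / 2)) = 1 / 144 := by field_simp
  rw [c1] at he
  rw [c2] at ho
  have e2 : (k * b.im) ^ 2 = x * b.im ^ 2 := by rw [hxk]; ring
  have e3 : (k ^ 2 * b.re) ^ 2 = x ^ 2 * b.re ^ 2 := by rw [hxk]; ring
  rw [e2, e3]
  have n1 : 0 ≤ x * b.im ^ 2 := by positivity
  nlinarith [sq_nonneg A.re]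

end Moments
/-! ### Correlations of trigonometric polynomials at different frequencies -/

section Correlation

theorem sq_integral_mul_le {α : Type*} [MeasurableSpace α] {μ : Measure α} {f g : α → ℝ}
    (hf : MemLp f 2 μ) (hg : MemLp g 2 μ) :
    (∫ x, f x * g x ∂μ) ^ 2 ≤ (∫ x, f x ^ 2 ∂μ) * ∫ x, g x ^ 2 ∂μ := by
  have h : ∀ y : ℝ, 0 ≤ (∫ x, f x ^ 2 ∂μ) * (y * y) + (2 * ∫ x, f x * g x ∂μ) * y
      + ∫ x, g x ^ 2 ∂μ := fun y => by
    have e : ∀ x, (y * f x + g x) ^ 2 = y * y * f x ^ 2 + 2 * y * (f x * g x) + g x ^ 2 :=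
      fun x => by ring
    have h0 : 0 ≤ ∫ x, (y * f x + g x) ^ 2 ∂μ := integral_nonneg fun _ => sq_nonneg _
    simp_rw [e] at h0
    have i1 : Integrable (fun x => y * y * f x ^ 2) μ := hf.integrable_sq.const_mul _
    have i2 : Integrable (fun x => 2 * y * (f x * g x)) μ := (hf.integrable_mul hg).const_mul _
    have i3 : Integrable (fun x => y * y * f x ^ 2 + 2 * y * (f x * g x)) μ := i1.add i2
    rw [integral_add i3 hg.integrable_sq, integral_add i1 i2, integral_const_mul,
      integral_const_mul] at h0
    linarith
  have := discrim_le_zero h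
  rw [discrim] at this
  linarith

theorem memLp_trigPoly (k : ℝ) (A b : ℂ) : MemLp (trigPoly k A b) 2 halfGaussian := by
  have h1 : MemLp (fun s : ℝ => ‖A‖ + ‖b‖ * ‖s‖) 2 halfGaussian :=
    (memLp_const ‖A‖).add (((IsGaussian.memLp_id halfGaussian 2 (by simp)).norm).const_mul ‖b‖)
  have hm : Continuous (trigPoly k A b) := by unfold trigPoly; fun_prop
  refine h1.mono hm.aestronglyMeasurable (ae_of_all _ fun s => ?_)
  rw [Real.norm_eq_abs, Real.norm_of_nonneg (by positivity)]
  refine (Complex.abs_re_le_norm _).trans ?_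
  have : -(k * Complex.I * s : ℂ) = ((-(k * s) : ℝ) : ℂ) * Complex.I := by push_cast; ring
  rw [norm_mul, this, Complex.norm_exp_ofReal_mul_I, mul_one]
  refine (norm_add_le _ _).trans ?_
  rw [norm_mul, Complex.norm_real]

theorem expMoment_neg (n : ℕ) (κ : ℝ) : expMoment n (-κ) = conj (expMoment n κ) := by
  rw [expMoment, expMoment, ← integral_conj]
  refine integral_congr_ae (ae_of_all _ fun s => ?_)
  simp only [map_mul, map_pow, Complex.conj_ofReal, ← Complex.exp_conj, Complex.conj_I]
  congr 2; push_cast; ring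

/-- At `σ = 0` the pairing is a moment of a real function. The vanishing of its imaginary part
provides the powers of `k` in the small-frequency estimate. -/
theorem trigPairing_zero_im (k : ℝ) (A b : ℂ) (n : ℕ) : (trigPairing k A b n 0).im = 0 := by
  rw [trigPairing, zero_sub, zero_add, expMoment_neg, expMoment_neg]
  simp
  ring

/-- For nonnegative frequencies `(σ+k)² ≥ (σ-k)²`, so the sum frequency decays at least as fast as
the difference frequency. -/
theorem exists_norm_trigPairing_le (N : ℕ) : ∃ M : ℝ, 0 ≤ M ∧ ∀ n ≤ N, ∀ k σ : ℝ, 0 ≤ k → 0 ≤ σ →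
    ∀ A b : ℂ, ‖trigPairing k A b n σ‖ ≤ M * (‖A‖ + ‖b‖) * Real.exp (-((σ - k) ^ 2 / 8)) := by
  choose C hC0 hC using exists_norm_expMoment_le
  set M := ∑ m ∈ Finset.range (N + 2), C m with hM
  have hM0 : 0 ≤ M := Finset.sum_nonneg fun m _ => hC0 m
  refine ⟨M, hM0, fun n hn k σ hk hσ A b => ?_⟩
  have hCM : ∀ m ≤ N + 1, C m ≤ M := fun m hm =>
    Finset.single_le_sum (fun m _ => hC0 m) (Finset.mem_range.2 (by omega))
  have h1 : ∀ m ≤ N + 1, ‖expMoment m (σ - k)‖ ≤ M * Real.exp (-((σ - k) ^ 2 / 8)) := fun m hm =>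
    (hC m _).trans (by gcongr; exact hCM m hm)
  have h2 : ∀ m ≤ N + 1, ‖expMoment m (σ + k)‖ ≤ M * Real.exp (-((σ - k) ^ 2 / 8)) := fun m hm => by
    refine (hC m _).trans ?_
    exact mul_le_mul (hCM m hm) (Real.exp_le_exp.2 (by nlinarith [mul_nonneg hk hσ]))
      (Real.exp_pos _).le hM0
  set e := M * Real.exp (-((σ - k) ^ 2 / 8)) with he
  have e0 : 0 ≤ e := by positivity
  have a1 : ‖A * expMoment n (σ - k)‖ ≤ ‖A‖ * e := by
    rw [norm_mul]; gcongr; exact h1 n (by omega)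
  have a2 : ‖b * expMoment (n + 1) (σ - k)‖ ≤ ‖b‖ * e := by
    rw [norm_mul]; gcongr; exact h1 (n + 1) (by omega)
  have a3 : ‖conj A * expMoment n (σ + k)‖ ≤ ‖A‖ * e := by
    rw [norm_mul, RCLike.norm_conj]; gcongr; exact h2 n (by omega)
  have a4 : ‖conj b * expMoment (n + 1) (σ + k)‖ ≤ ‖b‖ * e := by
    rw [norm_mul, RCLike.norm_conj]; gcongr; exact h2 (n + 1) (by omega)
  have a5 := norm_add₄_le (a := A * expMoment n (σ - k)) (b := b * expMoment (n + 1) (σ - k))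
    (c := conj A * expMoment n (σ + k)) (d := conj b * expMoment (n + 1) (σ + k))
  have a6 : ‖(1 / 2 : ℂ)‖ = 1 / 2 := by norm_num
  rw [trigPairing, norm_mul, a6]
  calc _ ≤ 1 / 2 * (‖A‖ * e + ‖b‖ * e + ‖A‖ * e + ‖b‖ * e) := by linarith
    _ = _ := by rw [he]; ring

theorem abs_le_mul_of_hasDerivAt {f f' : ℝ → ℝ} {B k : ℝ} (hk : 0 ≤ k) (h0 : f 0 = 0)
    (hf : ∀ σ, HasDerivAt f (f' σ) σ) (hB : ∀ σ, 0 ≤ σ → σ ≤ k → |f' σ| ≤ B) :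
    |f k| ≤ B * k := by
  have h := Convex.norm_image_sub_le_of_norm_hasDerivWithin_le (f := f) (f' := f')
    (s := Set.Icc 0 k) (x := 0) (y := k) (C := B) (fun σ _ => (hf σ).hasDerivWithinAt)
    (fun σ hσ => hB σ hσ.1 hσ.2) (convex_Icc 0 k) ⟨le_rfl, hk⟩ ⟨hk, le_rfl⟩
  rwa [h0, sub_zero, sub_zero, Real.norm_eq_abs, Real.norm_eq_abs, abs_of_nonneg hk] at h

/-- The dual of the lower bound for `k ≤ 1`. In the same four coordinates the coefficients of the
pairing are divided differences at `0` of `H n σ`, so they remain bounded by derivatives of `H`,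
that is, by the higher moments. -/
theorem abs_integral_trigPoly_mul_le_of_pairing_bound {k k' B : ℝ} (hk0 : 0 < k) (hk : k ≤ 1)
    {A b A' b' : ℂ} (hB : ∀ n ≤ 3, ∀ σ, 0 ≤ σ → σ ≤ 1 → ‖trigPairing k' A' b' n σ‖ ≤ B) :
    |∫ s, trigPoly k A b s * trigPoly k' A' b' s ∂halfGaussian|
      ≤ B * (|A.re| + |k * b.im| + |k * A.im + b.re| + |k ^ 2 * b.re|) := by
  set H := trigPairing k' A' b' with hH
  have hre : ∀ n σ, HasDerivAt (fun σ => (H n σ).re) (-(H (n + 1) σ).im) σ := fun n σ => by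
    have := (Complex.reCLM.hasFDerivAt.comp_hasDerivAt σ (hasDerivAt_trigPairing k' A' b' n σ))
    refine this.congr_deriv ?_
    simp [hH]
  have him : ∀ n σ, HasDerivAt (fun σ => (H n σ).im) (H (n + 1) σ).re σ := fun n σ => by
    have := (Complex.imCLM.hasFDerivAt.comp_hasDerivAt σ (hasDerivAt_trigPairing k' A' b' n σ))
    refine this.congr_deriv ?_
    simp [hH]
  have bre : ∀ n ≤ 3, ∀ σ, 0 ≤ σ → σ ≤ 1 → |(H n σ).re| ≤ B := fun n hn σ h0 h1 =>
    (Complex.abs_re_le_norm _).trans (hB n hn σ h0 h1)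
  have R : ∀ n ≤ 2, ∀ σ, 0 ≤ σ → σ ≤ 1 → |(H n σ).im| ≤ B * σ := fun n hn σ h0 h1 =>
    abs_le_mul_of_hasDerivAt (f := fun σ => (H n σ).im) h0 (trigPairing_zero_im _ _ _ _) (him n)
      fun τ t0 t1 => bre (n + 1) (by omega) τ t0 (t1.trans h1)
  have hB0 : 0 ≤ B := (norm_nonneg _).trans (hB 0 (by norm_num) 0 le_rfl zero_le_one)
  -- The derivative of `Im H₀ - σ Re H₁` is `σ Im H₂`, which is at most `Bσ²` because `Im H₂`
  -- vanishes at `0`. Hence the third power of `k`.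
  have L : |(H 0 k).im - k * (H 1 k).re| ≤ B * k ^ 2 * k := by
    refine abs_le_mul_of_hasDerivAt (f := fun σ => (H 0 σ).im - σ * (H 1 σ).re)
      (f' := fun σ => σ * (H 2 σ).im) hk0.le ?_ (fun σ => ?_) fun σ h0 h1 => ?_
    · simp [hH, trigPairing_zero_im]
    · refine ((him 0 σ).sub ((hasDerivAt_id σ).mul (hre 1 σ))).congr_deriv ?_
      simp
    · rw [abs_mul, abs_of_nonneg h0]
      have := R 2 le_rfl σ h0 (h1.trans hk)
      calc σ * |(H 2 σ).im| ≤ σ * (B * σ) := by gcongr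
        _ = B * σ ^ 2 := by ring
        _ ≤ B * k ^ 2 := by gcongr
  rw [integral_trigPoly_mul_trigPoly]
  have e : (conj A * H 0 k + conj b * H 1 k).re
      = A.re * (H 0 k).re + (k * b.im) * ((H 1 k).im / k) + (k * A.im + b.re) * ((H 0 k).im / k)
        - (k ^ 2 * b.re) * (((H 0 k).im - k * (H 1 k).re) / k ^ 3) := by
    have := hk0.ne'
    simp
    field_simp
    ring
  rw [e]
  have b1 : |(H 1 k).im / k| ≤ B := by
    rw [abs_div, abs_of_pos hk0, div_le_iff₀ hk0]; exact R 1 (by norm_num) k hk0.le hk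
  have b2 : |(H 0 k).im / k| ≤ B := by
    rw [abs_div, abs_of_pos hk0, div_le_iff₀ hk0]; exact R 0 (by norm_num) k hk0.le hk
  have b3 : |((H 0 k).im - k * (H 1 k).re) / k ^ 3| ≤ B := by
    rw [abs_div, abs_of_pos (pow_pos hk0 3), div_le_iff₀ (pow_pos hk0 3)]
    refine L.trans_eq (by ring)
  have b0 := bre 0 (by norm_num) k hk0.le hk
  have t1 := mul_le_mul_of_nonneg_left b0 (abs_nonneg A.re)
  have t2 := mul_le_mul_of_nonneg_left b1 (abs_nonneg (k * b.im))
  have t3 := mul_le_mul_of_nonneg_left b2 (abs_nonneg (k * A.im + b.re))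
  have t4 := mul_le_mul_of_nonneg_left b3 (abs_nonneg (k ^ 2 * b.re))
  rw [← abs_mul] at t1 t2 t3 t4
  refine (abs_sub _ _).trans ?_
  refine (add_le_add_left ((abs_add_le _ _).trans (add_le_add_left (abs_add_le _ _) _)) _).trans ?_
  linarith

/-- The frequencies are compared with `1`. If both are at least `1`, coefficient norms control
everything; if only one is, the rescaled coordinates are used for the small one. If both are below
`1`, no decay is required: Cauchy–Schwarz suffices, with `e^{1/8}` compensating for the exponential.
-/
theorem exists_sq_integral_trigPoly_mul_le : ∃ C : ℝ, 0 ≤ C ∧ ∀ k k' : ℝ, 0 < k → 0 < k' →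
    ∀ A b A' b' : ℂ,
      (∫ s, trigPoly k A b s * trigPoly k' A' b' s ∂halfGaussian) ^ 2
        ≤ C * Real.exp (-((k - k') ^ 2 / 8)) * ((∫ s, trigPoly k A b s ^ 2 ∂halfGaussian) *
          ∫ s, trigPoly k' A' b' s ^ 2 ∂halfGaussian) := by
  obtain ⟨M, hM0, hM⟩ := exists_norm_trigPairing_le 3
  have hnn : ∀ k A b, 0 ≤ ∫ s, trigPoly k A b s ^ 2 ∂halfGaussian := fun k A b =>
    integral_nonneg fun _ => sq_nonneg _
  have hns : ∀ z : ℂ, ‖z‖ ^ 2 = z.re ^ 2 + z.im ^ 2 := fun z => by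
    rw [Complex.sq_norm, Complex.normSq_apply]; ring
  have hone : ∀ k : ℝ, 1 ≤ k → ∀ A b, (‖A‖ + ‖b‖) ^ 2
      ≤ 400 * ∫ s, trigPoly k A b s ^ 2 ∂halfGaussian := fun k hk A b => by
    have := le_integral_trigPoly_sq_of_one_le hk A b
    nlinarith [sq_nonneg (‖A‖ - ‖b‖), hns A, hns b]
  have large : ∀ k k' : ℝ, 1 ≤ k → 1 ≤ k' → ∀ A b A' b' : ℂ,
      (∫ s, trigPoly k A b s * trigPoly k' A' b' s ∂halfGaussian) ^ 2
        ≤ 400 ^ 2 * M ^ 2 * Real.exp (-((k - k') ^ 2 / 8)) *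
          ((∫ s, trigPoly k A b s ^ 2 ∂halfGaussian) *
          ∫ s, trigPoly k' A' b' s ^ 2 ∂halfGaussian) := by
    intro k k' hk hk' A b A' b'
    have h0 := hM 0 (by norm_num) k' k (by linarith) (by linarith) A' b'
    have h1 := hM 1 (by norm_num) k' k (by linarith) (by linarith) A' b'
    set e := Real.exp (-((k - k') ^ 2 / 8)) with he
    have he1 : e ≤ 1 := Real.exp_le_one_iff.2 (by have := sq_nonneg (k - k'); linarith)
    have he0 : 0 < e := Real.exp_pos _
    have hab : |∫ s, trigPoly k A b s * trigPoly k' A' b' s ∂halfGaussian|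
        ≤ (‖A‖ + ‖b‖) * (M * (‖A'‖ + ‖b'‖) * e) := by
      rw [integral_trigPoly_mul_trigPoly]
      refine (Complex.abs_re_le_norm _).trans ((norm_add_le _ _).trans ?_)
      rw [norm_mul, norm_mul, RCLike.norm_conj, RCLike.norm_conj, add_mul]
      gcongr
    rw [← sq_abs]
    calc _ ≤ ((‖A‖ + ‖b‖) * (M * (‖A'‖ + ‖b'‖) * e)) ^ 2 := by gcongr
      _ = M ^ 2 * (e * e) * ((‖A‖ + ‖b‖) ^ 2 * (‖A'‖ + ‖b'‖) ^ 2) := by ring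
      _ ≤ M ^ 2 * (1 * e) * ((400 * ∫ s, trigPoly k A b s ^ 2 ∂halfGaussian) *
          (400 * ∫ s, trigPoly k' A' b' s ^ 2 ∂halfGaussian)) := by
        gcongr
        · exact hone k hk A b
        · exact hone k' hk' A' b'
      _ = _ := by ring
  have mixed : ∀ k k' : ℝ, 0 < k → k ≤ 1 → 1 ≤ k' → ∀ A b A' b' : ℂ,
      (∫ s, trigPoly k A b s * trigPoly k' A' b' s ∂halfGaussian) ^ 2
        ≤ 4 * 144 * 400 * M ^ 2 * Real.exp (1 / 4) * Real.exp (-((k - k') ^ 2 / 8)) *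
          ((∫ s, trigPoly k A b s ^ 2 ∂halfGaussian) *
          ∫ s, trigPoly k' A' b' s ^ 2 ∂halfGaussian) := by
    intro k k' hk0 hk hk' A b A' b'
    -- Since `σ` and `k` lie in `[0,1]`, `(k-k')² ≤ 2(σ-k')² + 2`. Moving the pairing frequency from
    -- `k` to `σ` thus halves the exponent and costs `e^{1/8}`; squaring restores the exponent.
    have hB : ∀ n ≤ 3, ∀ σ, 0 ≤ σ → σ ≤ 1 → ‖trigPairing k' A' b' n σ‖
        ≤ M * (‖A'‖ + ‖b'‖) * Real.exp (1 / 8 - (k - k') ^ 2 / 16) := by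
      intro n hn σ h0 h1
      refine (hM n hn k' σ (by linarith) h0 A' b').trans ?_
      gcongr
      nlinarith [sq_nonneg ((σ - k') - (k - σ)), mul_nonneg h0 (sub_nonneg.2 h1),
        mul_nonneg hk0.le (sub_nonneg.2 hk)]
    have hab := abs_integral_trigPoly_mul_le_of_pairing_bound (A := A) (b := b) hk0 hk hB
    have hlow := le_integral_trigPoly_sq_of_le_one hk0 hk A b
    have h4 : (|A.re| + |k * b.im| + |k * A.im + b.re| + |k ^ 2 * b.re|) ^ 2
        ≤ 4 * 144 * ∫ s, trigPoly k A b s ^ 2 ∂halfGaussian := by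
      rw [← sq_abs A.re, ← sq_abs (k * b.im), ← sq_abs (k * A.im + b.re),
        ← sq_abs (k ^ 2 * b.re)] at hlow
      generalize |A.re| = x1 at *
      generalize |k * b.im| = x2 at *
      generalize |k * A.im + b.re| = x3 at *
      generalize |k ^ 2 * b.re| = x4 at *
      nlinarith [sq_nonneg (x1 - x2), sq_nonneg (x1 - x3), sq_nonneg (x1 - x4),
        sq_nonneg (x2 - x3), sq_nonneg (x2 - x4), sq_nonneg (x3 - x4)]
    have he : Real.exp (1 / 8 - (k - k') ^ 2 / 16) ^ 2
        = Real.exp (1 / 4) * Real.exp (-((k - k') ^ 2 / 8)) := by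
      rw [← Real.exp_nat_mul, ← Real.exp_add]; congr 1; push_cast; ring
    rw [← sq_abs]
    calc _ ≤ (M * (‖A'‖ + ‖b'‖) * Real.exp (1 / 8 - (k - k') ^ 2 / 16) *
          (|A.re| + |k * b.im| + |k * A.im + b.re| + |k ^ 2 * b.re|)) ^ 2 := by gcongr
      _ = M ^ 2 * Real.exp (1 / 8 - (k - k') ^ 2 / 16) ^ 2 *
          ((|A.re| + |k * b.im| + |k * A.im + b.re| + |k ^ 2 * b.re|) ^ 2 *
            (‖A'‖ + ‖b'‖) ^ 2) := by ring
      _ ≤ M ^ 2 * Real.exp (1 / 8 - (k - k') ^ 2 / 16) ^ 2 *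
          ((4 * 144 * ∫ s, trigPoly k A b s ^ 2 ∂halfGaussian) *
          (400 * ∫ s, trigPoly k' A' b' s ^ 2 ∂halfGaussian)) := by
        gcongr
        exact hone k' hk' A' b'
      _ = _ := by rw [he]; ring
  set C₁ := 400 ^ 2 * M ^ 2
  set C₂ := 4 * 144 * 400 * M ^ 2 * Real.exp (1 / 4)
  refine ⟨C₁ + C₂ + Real.exp (1 / 8), by positivity, fun k k' hk hk' A b A' b' => ?_⟩
  have hC : ∀ c ≤ C₁ + C₂ + Real.exp (1 / 8),
      c * Real.exp (-((k - k') ^ 2 / 8)) * ((∫ s, trigPoly k A b s ^ 2 ∂halfGaussian) *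
          ∫ s, trigPoly k' A' b' s ^ 2 ∂halfGaussian)
      ≤ (C₁ + C₂ + Real.exp (1 / 8)) * Real.exp (-((k - k') ^ 2 / 8)) *
        ((∫ s, trigPoly k A b s ^ 2 ∂halfGaussian) *
          ∫ s, trigPoly k' A' b' s ^ 2 ∂halfGaussian) := fun c hc => by
    gcongr
  have p1 : 0 ≤ C₁ := by positivity
  have p2 : 0 ≤ C₂ := by positivity
  have p3 := Real.exp_pos (1 / 8)
  rcases le_total 1 k with h | h <;> rcases le_total 1 k' with h' | h'
  · exact (large k k' h h' A b A' b').trans (hC _ (by linarith))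
  · have := mixed k' k hk' h' h A' b' A b
    have e : (k' - k) ^ 2 = (k - k') ^ 2 := by ring
    simp_rw [mul_comm (trigPoly k' A' b' _)] at this
    rw [mul_comm (∫ s, trigPoly k' A' b' s ^ 2 ∂halfGaussian), e] at this
    exact this.trans (hC _ (by linarith))
  · exact (mixed k k' hk h h' A b A' b').trans (hC _ (by linarith))
  · refine le_trans ?_ (hC (Real.exp (1 / 8)) (by linarith))
    refine (sq_integral_mul_le (memLp_trigPoly _ _ _) (memLp_trigPoly _ _ _)).trans ?_
    refine le_mul_of_one_le_left (mul_nonneg (hnn _ _ _) (hnn _ _ _)) ?_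
    rw [← Real.exp_add, Real.one_le_exp_iff]
    nlinarith

end Correlation
/-! ### Second moments of the noise -/

section NoiseMoments

variable {Ω : Type*} [MeasurableSpace Ω] {P : Measure Ω} [IsProbabilityMeasure P]
  {Φ : 𝓢(ℝ, ℂ) → Ω → ℂ}

theorem integral_fourier_mul_conj_fourier (φ ψ : 𝓢(ℝ, ℂ)) :
    ∫ ξ : ℝ, 𝓕 φ ξ * conj (𝓕 ψ ξ) = ∫ s : ℝ, φ s * conj (ψ s) := by
  have h := SchwartzMap.integral_inner_fourier_fourier ψ φ
  simpa [RCLike.inner_apply] using h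

theorem integral_fourier_mul_fourier_neg (φ ψ : 𝓢(ℝ, ℂ)) :
    ∫ ξ : ℝ, 𝓕 φ ξ * 𝓕 ψ (-ξ) = ∫ s : ℝ, φ s * ψ s := by
  have h := SchwartzMap.integral_fourier_mul_eq φ (𝓕⁻ ψ)
  have e : ∀ ξ : ℝ, (𝓕⁻ ψ) ξ = 𝓕 ψ (-ξ) := fun ξ => by
    rw [SchwartzMap.fourierInv_coe, SchwartzMap.fourier_coe, Real.fourierInv_eq_fourier_neg]
  simp_rw [e, FourierTransform.fourier_fourierInv_eq] at h
  exact h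

theorem IsComplexGaussianWhiteNoise.memLp (hΦ : IsComplexGaussianWhiteNoise Φ P) (φ : 𝓢(ℝ, ℂ)) :
    MemLp (Φ φ) 2 P :=
  (hΦ.gaussian.hasGaussianLaw_eval φ).memLp_two

/-- From `Re z Re w = ½ Re(z w̄ + zw)`, covariance and pseudocovariance combine through Plancherel:
`Re Φ(φ)` behaves as real white noise tested against `Re φ`. All second moments used below come from
this identity. -/
theorem IsComplexGaussianWhiteNoise.integral_re_mul_re (hΦ : IsComplexGaussianWhiteNoise Φ P)
    (φ ψ : 𝓢(ℝ, ℂ)) :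
    ∫ ω, (Φ φ ω).re * (Φ ψ ω).re ∂P = ∫ s : ℝ, (φ s).re * (ψ s).re := by
  have key : ∀ z w : ℂ, z.re * w.re = (1 / 2 : ℝ) * (z * conj w + z * w).re := fun z w => by
    simp; ring
  have h1 : Integrable (fun ω => Φ φ ω * Φ ψ ω) P := (hΦ.memLp φ).integrable_mul (hΦ.memLp ψ)
  have h2 : Integrable (fun ω => Φ φ ω * conj (Φ ψ ω)) P :=
    (hΦ.memLp φ).integrable_mul (hΦ.memLp ψ).star
  have g1 : Integrable (fun s => φ s * ψ s) :=
    ((φ.memLp 2 volume)).integrable_mul (ψ.memLp 2 volume)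
  have g2 : Integrable (fun s => φ s * conj (ψ s)) :=
    ((φ.memLp 2 volume)).integrable_mul (ψ.memLp 2 volume).star
  simp_rw [key, integral_const_mul]
  have a1 := Complex.reCLM.integral_comp_comm (h2.add h1)
  have a2 := Complex.reCLM.integral_comp_comm (g2.add g1)
  simp only [Complex.reCLM_apply, Pi.add_apply] at a1 a2
  rw [a1, a2, integral_add h2 h1, integral_add g2 g1, hΦ.covariance, hΦ.pseudocovariance,
    integral_fourier_mul_conj_fourier, integral_fourier_mul_fourier_neg]

theorem IsComplexGaussianWhiteNoise.hasGaussianLaw_pi (hΦ : IsComplexGaussianWhiteNoise Φ P)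
    {ι : Type*} [Fintype ι] (f : ι → 𝓢(ℝ, ℂ)) :
    HasGaussianLaw (fun ω i => Φ (f i) ω) P := by
  classical
  exact (hΦ.gaussian.hasGaussianLaw (Finset.univ.image f)).map_fun
    (ContinuousLinearMap.pi fun i => ContinuousLinearMap.proj
      (⟨f i, Finset.mem_image_of_mem f (Finset.mem_univ i)⟩ : (Finset.univ.image f : Finset _)))

/-! ### The Gaussian atoms -/

theorem atom_gaussianWindow_apply (t η s : ℝ) :
    atom gaussianWindow t η s
      = gaussianWindow (s - t) *
        Complex.exp (-(((2 * Real.pi * η : ℝ) : ℂ) * Complex.I * ((s - t : ℝ) : ℂ))) := by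
  rw [atom_apply]
  congr 2
  push_cast; ring

theorem dtAtom_gaussianWindow_apply (t η s : ℝ) :
    dtAtom gaussianWindow t η s
      = gaussianWindow (s - t) * (((s - t : ℝ) : ℂ) + ((2 * Real.pi * η : ℝ) : ℂ) * Complex.I) *
        Complex.exp (-(((2 * Real.pi * η : ℝ) : ℂ) * Complex.I * ((s - t : ℝ) : ℂ))) := by
  refine (hasDerivAt_atom gaussianWindow t η s).unique ?_
  simp_rw [atom_gaussianWindow_apply, gaussianWindow_apply]
  have h0 : HasDerivAt (fun τ : ℝ => s - τ) (-1) t := (hasDerivAt_id t).const_sub s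
  have h1 : HasDerivAt (fun τ : ℝ => -((s - τ) ^ 2 / 2)) (s - t) t := by
    refine ((h0.pow 2).div_const 2).neg.congr_deriv ?_
    simp; ring
  have h2 := (h1.exp.const_mul (Real.sqrt (2 * Real.pi))⁻¹).ofReal_comp
  have h3 := ((h0.ofReal_comp.const_mul (((2 * Real.pi * η : ℝ) : ℂ) * Complex.I)).neg).cexp
  simp only [Pi.neg_apply] at h3
  refine (h2.mul h3).congr_deriv ?_
  push_cast; ring

/-- `v = ∫ h² = 1 / (2√π)`. -/
noncomputable def windowEnergy : ℝ := (2 * Real.sqrt Real.pi)⁻¹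

theorem windowEnergy_pos : 0 < windowEnergy := by unfold windowEnergy; positivity

/-- Differentiating the window produces a factor `s - t`, hence the affine amplitude of `trigPoly`.
The common factor is the window, whose square is proportional to the density of `halfGaussian`. -/
theorem re_atom_combination (t η : ℝ) (a b : ℂ) (s : ℝ) :
    ((a • atom gaussianWindow t η + b • dtAtom gaussianWindow t η) s).re
      = ((Real.sqrt (2 * Real.pi))⁻¹ * Real.exp (-((s - t) ^ 2 / 2))) *
        trigPoly (2 * Real.pi * η) (a + b * (((2 * Real.pi * η : ℝ) : ℂ) * Complex.I)) b (s - t) := by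
  rw [trigPoly, ← Complex.re_ofReal_mul, ← gaussianWindow_apply, add_apply,
    smul_apply, smul_apply, atom_gaussianWindow_apply,
    dtAtom_gaussianWindow_apply, smul_eq_mul, smul_eq_mul]
  congr 1
  ring

theorem integral_gaussianWindow_sq_mul (t : ℝ) (f : ℝ → ℝ) :
    ∫ s : ℝ, ((Real.sqrt (2 * Real.pi))⁻¹ * Real.exp (-((s - t) ^ 2 / 2))) ^ 2 * f (s - t)
      = windowEnergy * ∫ u, f u ∂halfGaussian := by
  have h1 := integral_sub_right_eq_self (μ := volume) (fun u : ℝ =>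
    ((Real.sqrt (2 * Real.pi))⁻¹ * Real.exp (-(u ^ 2 / 2))) ^ 2 * f u) t
  rw [h1, integral_gaussianReal_eq_integral_smul (by norm_num), ← integral_const_mul]
  refine integral_congr_ae (ae_of_all _ fun u => ?_)
  simp only [smul_eq_mul]
  rw [← mul_assoc]
  congr 1
  rw [gaussianPDFReal, mul_pow, inv_pow, Real.sq_sqrt (by positivity), ← Real.exp_nat_mul,
    windowEnergy]
  have e1 : 2 * Real.pi * ((1 / 2 : NNReal) : ℝ) = Real.pi := by push_cast; ring
  rw [e1, ← mul_assoc, ← mul_inv]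
  congr 1
  · congr 1
    rw [mul_assoc, Real.mul_self_sqrt Real.pi_pos.le]
  · congr 1
    push_cast; ring

theorem IsComplexGaussianWhiteNoise.integral_re_combination_mul
    (hΦ : IsComplexGaussianWhiteNoise Φ P) (t η η' : ℝ) (a b a' b' : ℂ) :
    ∫ ω, (a * Φ (atom gaussianWindow t η) ω + b * Φ (dtAtom gaussianWindow t η) ω).re *
        (a' * Φ (atom gaussianWindow t η') ω + b' * Φ (dtAtom gaussianWindow t η') ω).re ∂P
      = windowEnergy * ∫ u,
        trigPoly (2 * Real.pi * η) (a + b * (((2 * Real.pi * η : ℝ) : ℂ) * Complex.I)) b u *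
        trigPoly (2 * Real.pi * η') (a' + b' * (((2 * Real.pi * η' : ℝ) : ℂ) * Complex.I)) b' u
          ∂halfGaussian := by
  rw [← integral_gaussianWindow_sq_mul t]
  have h := hΦ.integral_re_mul_re (a • atom gaussianWindow t η + b • dtAtom gaussianWindow t η)
    (a' • atom gaussianWindow t η' + b' • dtAtom gaussianWindow t η')
  simp_rw [re_atom_combination] at h
  refine Eq.trans ?_ (h.trans ?_)
  · refine integral_congr_ae ?_
    filter_upwards [hΦ.grp.linear a b (atom gaussianWindow t η) (dtAtom gaussianWindow t η),
      hΦ.grp.linear a' b' (atom gaussianWindow t η') (dtAtom gaussianWindow t η')] with ω h1 h2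
    rw [h1, h2]
  · refine integral_congr_ae (ae_of_all _ fun u => ?_)
    simp only
    ring

end NoiseMoments
/-! ### Decorrelation of functions of the noise at distant frequencies -/

section Decorrelation

open scoped ENNReal
open WithLp (toLp)

variable {Ω : Type*} [MeasurableSpace Ω] {P : Measure Ω}

/-- The bound that uses no decorrelation, for frequencies so close that the correlation estimate is
not small. -/
theorem enorm_integral_mul_sub_sq_le [IsProbabilityMeasure P] {f g : Ω → ℂ} (hf : MemLp f 2 P)
    (hg : MemLp g 2 P) :
    ‖(∫ ω, f ω * g ω ∂P) - (∫ ω, f ω ∂P) * ∫ ω, g ω ∂P‖ₑ ^ 2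
      ≤ 4 * (∫⁻ ω, ‖f ω‖ₑ ^ 2 ∂P) * ∫⁻ ω, ‖g ω‖ₑ ^ 2 ∂P := by
  have hone : ∀ {f : Ω → ℂ}, MemLp f 2 P → ‖∫ ω, f ω ∂P‖ₑ ^ 2 ≤ ∫⁻ ω, ‖f ω‖ₑ ^ 2 ∂P := by
    intro f hf
    calc ‖∫ ω, f ω ∂P‖ₑ ^ 2 ≤ (∫⁻ ω, ‖f ω‖ₑ * 1 ∂P) ^ 2 := by
          gcongr; simpa using enorm_integral_le_lintegral_enorm f
      _ ≤ (∫⁻ ω, ‖f ω‖ₑ ^ 2 ∂P) * ∫⁻ _, 1 ^ 2 ∂P :=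
          sq_lintegral_mul_le hf.aestronglyMeasurable.enorm aemeasurable_const
      _ = _ := by simp
  have h1 : ‖∫ ω, f ω * g ω ∂P‖ₑ ^ 2 ≤ (∫⁻ ω, ‖f ω‖ₑ ^ 2 ∂P) * ∫⁻ ω, ‖g ω‖ₑ ^ 2 ∂P := by
    refine le_trans ?_ (sq_lintegral_mul_le hf.aestronglyMeasurable.enorm
      hg.aestronglyMeasurable.enorm)
    gcongr
    refine (enorm_integral_le_lintegral_enorm _).trans_eq ?_
    simp_rw [enorm_mul]
  have h2 : ‖(∫ ω, f ω ∂P) * ∫ ω, g ω ∂P‖ₑ ^ 2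
      ≤ (∫⁻ ω, ‖f ω‖ₑ ^ 2 ∂P) * ∫⁻ ω, ‖g ω‖ₑ ^ 2 ∂P := by
    rw [enorm_mul, mul_pow]
    exact mul_le_mul' (hone hf) (hone hg)
  calc _ ≤ (‖∫ ω, f ω * g ω ∂P‖ₑ + ‖(∫ ω, f ω ∂P) * ∫ ω, g ω ∂P‖ₑ) ^ 2 := by
        gcongr; exact enorm_sub_le
    _ ≤ 2 * (‖∫ ω, f ω * g ω ∂P‖ₑ ^ 2 + ‖(∫ ω, f ω ∂P) * ∫ ω, g ω ∂P‖ₑ ^ 2) := by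
        simp only [enorm_eq_nnnorm]
        have h : ∀ x y : NNReal, (x + y) ^ 2 ≤ 2 * (x ^ 2 + y ^ 2) := fun x y => add_sq_le
        exact_mod_cast h _ _
    _ ≤ 2 * ((∫⁻ ω, ‖f ω‖ₑ ^ 2 ∂P) * (∫⁻ ω, ‖g ω‖ₑ ^ 2 ∂P)
        + (∫⁻ ω, ‖f ω‖ₑ ^ 2 ∂P) * ∫⁻ ω, ‖g ω‖ₑ ^ 2 ∂P) := by gcongr
    _ = _ := by ring

variable {Φ : 𝓢(ℝ, ℂ) → Ω → ℂ}

/-- The real and imaginary parts of `Φ(h_{t,η})` and `Φ(∂ₜh_{t,η})`. -/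
noncomputable def noiseCoord {Ω : Type*} (Φ : 𝓢(ℝ, ℂ) → Ω → ℂ) (t η : ℝ) : Fin 4 → Ω → ℝ :=
  ![fun ω => (Φ (atom gaussianWindow t η) ω).re, fun ω => (Φ (atom gaussianWindow t η) ω).im,
    fun ω => (Φ (dtAtom gaussianWindow t η) ω).re, fun ω => (Φ (dtAtom gaussianWindow t η) ω).im]

theorem sum_noiseCoord {Ω : Type*} {Φ : 𝓢(ℝ, ℂ) → Ω → ℂ} (t η : ℝ) (c : Fin 4 → ℝ) (ω : Ω) :
    ∑ i, c i * noiseCoord Φ t η i ω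
      = ((c 0 - c 1 * Complex.I) * Φ (atom gaussianWindow t η) ω
        + (c 2 - c 3 * Complex.I) * Φ (dtAtom gaussianWindow t η) ω).re := by
  simp [Fin.sum_univ_four, noiseCoord]
  ring

variable [IsProbabilityMeasure P]

theorem exists_correlation_noiseCoord_le (hΦ : IsComplexGaussianWhiteNoise Φ P) (t : ℝ) :
    ∃ C : ℝ, 0 < C ∧ ∀ η > 0, ∀ η' > 0, ∀ a b : Fin 4 → ℝ,
      (∫ ω, (∑ i, a i * noiseCoord Φ t η i ω) * (∑ j, b j * noiseCoord Φ t η' j ω) ∂P) ^ 2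
        ≤ C * Real.exp (-(2 * (η - η') ^ 2)) *
          ((∫ ω, (∑ i, a i * noiseCoord Φ t η i ω) ^ 2 ∂P) *
            ∫ ω, (∑ j, b j * noiseCoord Φ t η' j ω) ^ 2 ∂P) := by
  obtain ⟨C, hC0, hC⟩ := exists_sq_integral_trigPoly_mul_le
  -- The added `1` makes the constant strictly positive; the coupling divides by `ρ`, so `ρ` must
  -- not vanish.
  refine ⟨C + 1, by positivity, fun η hη η' hη' a b => ?_⟩
  simp_rw [sq (∑ i, _ * noiseCoord Φ t _ i _), sum_noiseCoord, hΦ.integral_re_combination_mul]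
  have h := hC (2 * Real.pi * η) (2 * Real.pi * η') (by positivity) (by positivity)
    ((a 0 - a 1 * Complex.I) + (a 2 - a 3 * Complex.I) * (((2 * Real.pi * η : ℝ) : ℂ) * Complex.I))
    (a 2 - a 3 * Complex.I)
    ((b 0 - b 1 * Complex.I) + (b 2 - b 3 * Complex.I) * (((2 * Real.pi * η' : ℝ) : ℂ) * Complex.I))
    (b 2 - b 3 * Complex.I)
  simp_rw [sq (trigPoly _ _ _ _)] at h
  -- With `k = 2πη` the exponent is `π²/2 · (η-η')²`, and `π²/2 ≥ 2`. As the estimate concerns the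
  -- squared correlation, the exponent `2` yields `e^{-(η-η')²}`.
  have hexp : Real.exp (-((2 * Real.pi * η - 2 * Real.pi * η') ^ 2 / 8))
      ≤ Real.exp (-(2 * (η - η') ^ 2)) := by
    refine Real.exp_le_exp.2 ?_
    have : (2 * Real.pi * η - 2 * Real.pi * η') ^ 2 / 8 = Real.pi ^ 2 / 2 * (η - η') ^ 2 := by ring
    rw [this]
    have h2 : 2 ≤ Real.pi ^ 2 / 2 := by nlinarith [Real.pi_gt_three]
    linarith [mul_le_mul_of_nonneg_right h2 (sq_nonneg (η - η'))]
  have hnn : ∀ k A b, 0 ≤ ∫ u, trigPoly k A b u * trigPoly k A b u ∂halfGaussian :=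
    fun k A b => integral_nonneg fun u => mul_self_nonneg _
  have n1 := hnn (2 * Real.pi * η) ((a 0 - a 1 * Complex.I) +
    (a 2 - a 3 * Complex.I) * (((2 * Real.pi * η : ℝ) : ℂ) * Complex.I))
    (a 2 - a 3 * Complex.I)
  have n2 := hnn (2 * Real.pi * η') ((b 0 - b 1 * Complex.I) +
    (b 2 - b 3 * Complex.I) * (((2 * Real.pi * η' : ℝ) : ℂ) * Complex.I))
    (b 2 - b 3 * Complex.I)
  have hv := windowEnergy_pos
  have hscale : ∀ c v x y : ℝ, c * (v * x * (v * y)) = v ^ 2 * (c * (x * y)) :=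
    fun c v x y => by ring
  rw [mul_pow, hscale]
  refine mul_le_mul_of_nonneg_left (h.trans ?_) (by positivity)
  refine mul_le_mul_of_nonneg_right ?_ (mul_nonneg n1 n2)
  exact mul_le_mul (by linarith) hexp (Real.exp_pos _).le (by linarith)

/-- Square integrable functions of the noise at the frequencies `η` and `η'` have a correlation
of order `e^{-(η-η')²}`. -/
theorem exists_enorm_integral_mul_sub_sq_le (hΦ : IsComplexGaussianWhiteNoise Φ P) (t : ℝ) :
    ∃ C : ℝ, 0 < C ∧ ∀ η > 0, ∀ η' > 0, ∀ F G : ℂ × ℂ → ℂ, Measurable F → Measurable G →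
      ∀ f g : Ω → ℂ,
      (f = fun ω => F (Φ (atom gaussianWindow t η) ω, Φ (dtAtom gaussianWindow t η) ω)) →
      (g = fun ω => G (Φ (atom gaussianWindow t η') ω, Φ (dtAtom gaussianWindow t η') ω)) →
      MemLp f 2 P → MemLp g 2 P →
      ‖(∫ ω, f ω * g ω ∂P) - (∫ ω, f ω ∂P) * ∫ ω, g ω ∂P‖ₑ ^ 2
        ≤ ENNReal.ofReal (C * Real.exp (-(2 * (η - η') ^ 2))) *
          (∫⁻ ω, ‖f ω‖ₑ ^ 2 ∂P) * ∫⁻ ω, ‖g ω‖ₑ ^ 2 ∂P := by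
  obtain ⟨C, hC0, hC⟩ := exists_correlation_noiseCoord_le hΦ t
  refine ⟨32 * C, by positivity, ?_⟩
  intro η hη η' hη' F G hF hG f g hf hg hf2 hg2
  set q := C * Real.exp (-(2 * (η - η') ^ 2)) with hq
  have hq0 : 0 < q := by positivity
  rw [mul_assoc 32, ← hq]
  -- For `q ≤ 1/8`, Gebelein's inequality with `ρ = √q` in dimension `4` gives `(1-q)⁻⁴ - 1 ≤ 8q`.
  -- For `q ≥ 1/8`, the trivial constant `4` is at most `32q`.
  rcases le_total q (1 / 8) with hq1 | hq1
  · have hcoord : ∀ η i, noiseCoord Φ t η i = fun ω => ((![1, -Complex.I, 1, -Complex.I] :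
        Fin 4 → ℂ) i * Φ ((![atom gaussianWindow t η, atom gaussianWindow t η,
          dtAtom gaussianWindow t η, dtAtom gaussianWindow t η] : Fin 4 → 𝓢(ℝ, ℂ)) i) ω).re := by
      intro η i
      fin_cases i <;> simp [noiseCoord]
    have h0 : ∀ η i, ∫ ω, noiseCoord Φ t η i ω ∂P = 0 := by
      intro η i
      rw [hcoord]
      have := Complex.reCLM.integral_comp_comm
        (((hΦ.memLp ((![atom gaussianWindow t η, atom gaussianWindow t η,
          dtAtom gaussianWindow t η, dtAtom gaussianWindow t η] : Fin 4 → 𝓢(ℝ, ℂ)) i)).integrable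
            (by norm_num)).const_mul ((![1, -Complex.I, 1, -Complex.I] : Fin 4 → ℂ) i))
      simp only [Complex.reCLM_apply] at this
      rw [this, integral_const_mul, hΦ.mean, mul_zero, Complex.zero_re]
    have hlaw : HasGaussianLaw
        (fun ω a => Sum.elim (noiseCoord Φ t η) (noiseCoord Φ t η') a ω) P := by
      have h := hΦ.hasGaussianLaw_pi (ι := Fin 4 ⊕ Fin 4) (Sum.elim
        (![atom gaussianWindow t η, atom gaussianWindow t η,
          dtAtom gaussianWindow t η, dtAtom gaussianWindow t η] : Fin 4 → 𝓢(ℝ, ℂ))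
        (![atom gaussianWindow t η', atom gaussianWindow t η',
          dtAtom gaussianWindow t η', dtAtom gaussianWindow t η'] : Fin 4 → 𝓢(ℝ, ℂ)))
      have h2 := h.map_fun (ContinuousLinearMap.pi fun a : Fin 4 ⊕ Fin 4 =>
        (Complex.reCLM ∘L ContinuousLinearMap.mul ℝ ℂ (Sum.elim
          (![1, -Complex.I, 1, -Complex.I] : Fin 4 → ℂ)
          (![1, -Complex.I, 1, -Complex.I] : Fin 4 → ℂ) a)) ∘L
          (ContinuousLinearMap.proj a : (Fin 4 ⊕ Fin 4 → ℂ) →L[ℝ] ℂ))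
      refine h2.congr (ae_of_all _ fun ω => ?_)
      funext a
      rcases a with i | i
      · simp only [Sum.elim_inl, hcoord]; rfl
      · simp only [Sum.elim_inr, hcoord]; rfl
    have hm : Measurable fun x : EuclideanSpace ℝ (Fin 4) =>
        (((x 0 : ℝ) + (x 1 : ℝ) * Complex.I : ℂ), ((x 2 : ℝ) + (x 3 : ℝ) * Complex.I : ℂ)) := by
      fun_prop
    have hrep : ∀ η ω, (Φ (atom gaussianWindow t η) ω, Φ (dtAtom gaussianWindow t η) ω)
        = (fun x : EuclideanSpace ℝ (Fin 4) =>
        (((x 0 : ℝ) + (x 1 : ℝ) * Complex.I : ℂ), ((x 2 : ℝ) + (x 3 : ℝ) * Complex.I : ℂ)))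
          (toLp 2 fun i => noiseCoord Φ t η i ω) := by
      intro η ω
      simp [noiseCoord, Complex.re_add_im]
    have hsq : √q ^ 2 = q := Real.sq_sqrt hq0.le
    have key := enorm_integral_mul_sub_sq_le_of_correlation hlaw (h0 η) (h0 η') (ρ := √q)
      (by positivity) (by rw [hsq]; linarith) (by rw [hsq]; exact hC η hη η' hη')
      (F := fun x => F (((x 0 : ℝ) + (x 1 : ℝ) * Complex.I : ℂ),
        ((x 2 : ℝ) + (x 3 : ℝ) * Complex.I : ℂ)))
      (G := fun x => G (((x 0 : ℝ) + (x 1 : ℝ) * Complex.I : ℂ),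
        ((x 2 : ℝ) + (x 3 : ℝ) * Complex.I : ℂ))) (hF.comp hm) (hG.comp hm)
      (by
        rw [hf] at hf2
        simpa only [hrep η] using hf2)
      (by
        rw [hg] at hg2
        simpa only [hrep η'] using hg2)
    rw [hsq] at key
    subst hf hg
    simp only [hrep η, hrep η']
    refine key.trans ?_
    gcongr
    rw [Fintype.card_fin]
    have hb : 1 - 4 * q ≤ (1 - q) ^ 4 := by nlinarith [sq_nonneg q, sq_nonneg (q * (1 - q))]
    have : ((1 - q)⁻¹) ^ 4 ≤ 1 + 8 * q := by
      rw [inv_pow]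
      refine inv_le_of_inv_le₀ (by positivity) ?_
      rw [inv_le_iff_one_le_mul₀ (by positivity)]
      nlinarith
    linarith
  · refine (enorm_integral_mul_sub_sq_le hf2 hg2).trans ?_
    gcongr
    rw [show (4 : ℝ≥0∞) = ENNReal.ofReal 4 by simp]
    exact ENNReal.ofReal_le_ofReal (by linarith)

end Decorrelation
/-! ### Gaussian small ball estimates -/

section SmallBall

open scoped ENNReal

/-- The Gaussian density is at most `1/(√π σ)`, and the Lebesgue integral of `e^{-(m+x)²/λ}` is
`√(πλ)` whatever the shift `m`. -/
theorem lintegral_exp_neg_sq_gaussianReal_le {w : NNReal} {σ lam : ℝ} (hσ : 0 < σ)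
    (hw : σ ^ 2 ≤ w) (hlam : 0 < lam) (m : ℝ) :
    ∫⁻ x, ENNReal.ofReal (Real.exp (-((m + x) ^ 2 / lam))) ∂gaussianReal 0 w
      ≤ ENNReal.ofReal (√lam / σ) := by
  have hw0 : (0 : ℝ) < w := lt_of_lt_of_le (by positivity) hw
  have hw0' : w ≠ 0 := by
    rintro rfl
    simp at hw0
  have hpi := Real.pi_pos
  have hpdf : ∀ x, gaussianPDF 0 w x ≤ ENNReal.ofReal ((√Real.pi * σ)⁻¹) := by
    intro x
    refine ENNReal.ofReal_le_ofReal ?_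
    rw [gaussianPDFReal]
    calc (√(2 * Real.pi * w))⁻¹ * Real.exp (-(x - 0) ^ 2 / (2 * w))
        ≤ (√(2 * Real.pi * w))⁻¹ * 1 := by
          gcongr
          rw [Real.exp_le_one_iff]
          exact div_nonpos_of_nonpos_of_nonneg (by nlinarith [sq_nonneg (x - 0)]) (by positivity)
      _ ≤ (√Real.pi * σ)⁻¹ := by
          rw [mul_one]
          refine inv_anti₀ (by positivity) ?_
          refine Real.le_sqrt_of_sq_le ?_
          rw [mul_pow, Real.sq_sqrt hpi.le]
          nlinarith [mul_le_mul_of_nonneg_left hw hpi.le]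
  have hmeas : Measurable fun x : ℝ => ENNReal.ofReal (Real.exp (-((m + x) ^ 2 / lam))) := by
    fun_prop
  have h_int : Integrable fun x : ℝ => Real.exp (-lam⁻¹ * x ^ 2) :=
    integrable_exp_neg_mul_sq (by positivity)
  have hvol : ∫⁻ x : ℝ, ENNReal.ofReal (Real.exp (-((m + x) ^ 2 / lam)))
      = ENNReal.ofReal (√(Real.pi * lam)) := by
    rw [lintegral_add_left_eq_self (μ := volume)
      (fun x : ℝ => ENNReal.ofReal (Real.exp (-(x ^ 2 / lam)))) m]
    have e : ∀ x : ℝ, -(x ^ 2 / lam) = -lam⁻¹ * x ^ 2 := fun x => by ring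
    simp_rw [e]
    rw [← ofReal_integral_eq_lintegral_ofReal h_int (ae_of_all _ fun _ => (Real.exp_pos _).le),
      integral_gaussian, div_inv_eq_mul]
  rw [gaussianReal_of_var_ne_zero _ hw0',
    lintegral_withDensity_eq_lintegral_mul _ (measurable_gaussianPDF _ _) hmeas]
  calc ∫⁻ x, (gaussianPDF 0 w * fun x => ENNReal.ofReal (Real.exp (-((m + x) ^ 2 / lam)))) x
      ≤ ∫⁻ x : ℝ, ENNReal.ofReal ((√Real.pi * σ)⁻¹) *
          ENNReal.ofReal (Real.exp (-((m + x) ^ 2 / lam))) :=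
        lintegral_mono fun x => mul_le_mul_left (hpdf x) _
    _ = ENNReal.ofReal ((√Real.pi * σ)⁻¹) * ENNReal.ofReal (√(Real.pi * lam)) := by
        rw [lintegral_const_mul _ hmeas, hvol]
    _ = ENNReal.ofReal (√lam / σ) := by
        rw [← ENNReal.ofReal_mul (by positivity), Real.sqrt_mul hpi.le]
        congr 1
        field_simp

/-- The fourth moment of the standard normal distribution. -/
noncomputable def fourthMoment : ℝ := ∫ x, x ^ 4 ∂gaussianReal 0 1

theorem fourthMoment_nonneg : 0 ≤ fourthMoment := integral_nonneg fun x => by positivity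

theorem integral_pow_four_gaussianReal (w : NNReal) :
    ∫ x, x ^ 4 ∂gaussianReal 0 w = (w : ℝ) ^ 2 * fourthMoment := by
  have h := gaussianReal_map_const_mul (μ := 0) (v := 1) (√w)
  have hv : NNReal.mk ((√w : ℝ) ^ 2) (sq_nonneg _) * 1 = w := by
    rw [mul_one]
    exact NNReal.eq (Real.sq_sqrt w.coe_nonneg)
  rw [mul_zero, hv] at h
  rw [← h, integral_map (by fun_prop) (by fun_prop), fourthMoment, ← integral_const_mul]
  refine integral_congr_ae (ae_of_all _ fun x => ?_)
  have : (√w : ℝ) ^ 4 = (w : ℝ) ^ 2 := by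
    rw [show 4 = 2 * 2 by norm_num, pow_mul, Real.sq_sqrt w.coe_nonneg]
  simp only [mul_pow, this]

variable {Ω : Type*} [MeasurableSpace Ω] {P : Measure Ω}

theorem map_eq_gaussianReal_of_centered {X : Ω → ℝ} (hX : HasGaussianLaw X P)
    (h0 : ∫ ω, X ω ∂P = 0) : P.map X = gaussianReal 0 (∫ ω, X ω ^ 2 ∂P).toNNReal := by
  rw [hX.map_eq_gaussianReal, variance_of_integral_eq_zero hX.aemeasurable h0, h0]

theorem integrable_pow_four_of_hasGaussianLaw {X : Ω → ℝ} (hX : HasGaussianLaw X P) :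
    Integrable (fun ω => X ω ^ 4) P := by
  have := hX.isProbabilityMeasure
  have h : MemLp X ((4 : ℕ) : ℝ≥0∞) P := hX.memLp (by simp)
  refine (h.integrable_norm_pow (by norm_num)).congr (ae_of_all _ fun ω => ?_)
  simp only [Real.norm_eq_abs]
  exact (by decide : Even 4).pow_abs _

theorem integral_pow_four_of_centered {X : Ω → ℝ} (hX : HasGaussianLaw X P)
    (h0 : ∫ ω, X ω ∂P = 0) : ∫ ω, X ω ^ 4 ∂P = (∫ ω, X ω ^ 2 ∂P) ^ 2 * fourthMoment := by
  have h := integral_map (μ := P) hX.aemeasurable (f := fun x : ℝ => x ^ 4) (by fun_prop)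
  rw [← h, map_eq_gaussianReal_of_centered hX h0, integral_pow_four_gaussianReal,
    Real.coe_toNNReal _ (integral_nonneg fun _ => sq_nonneg _)]

theorem lintegral_exp_neg_sq_add_sq_le {X Y : Ω → ℝ} {σ lam : ℝ} (hσ : 0 < σ) (hlam : 0 < lam)
    (hX : HasGaussianLaw X P) (hY : HasGaussianLaw Y P) (hX0 : ∫ ω, X ω ∂P = 0)
    (hY0 : ∫ ω, Y ω ∂P = 0) (hXσ : σ ^ 2 ≤ ∫ ω, X ω ^ 2 ∂P) (hYσ : σ ^ 2 ≤ ∫ ω, Y ω ^ 2 ∂P)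
    (hXY : IndepFun X Y P) (m n : ℝ) :
    ∫⁻ ω, ENNReal.ofReal (Real.exp (-(((m + X ω) ^ 2 + (n + Y ω) ^ 2) / lam))) ∂P
      ≤ ENNReal.ofReal (lam / σ ^ 2) := by
  have hone : ∀ {X : Ω → ℝ} (m : ℝ), HasGaussianLaw X P → ∫ ω, X ω ∂P = 0 →
      σ ^ 2 ≤ ∫ ω, X ω ^ 2 ∂P →
      ∫⁻ ω, ENNReal.ofReal (Real.exp (-((m + X ω) ^ 2 / lam))) ∂P
        ≤ ENNReal.ofReal (√lam / σ) := by
    intro X m hX h0 hσX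
    have h := lintegral_map' (μ := P) (g := X)
      (f := fun x : ℝ => ENNReal.ofReal (Real.exp (-((m + x) ^ 2 / lam)))) (by fun_prop)
      hX.aemeasurable
    rw [← h, map_eq_gaussianReal_of_centered hX h0]
    exact lintegral_exp_neg_sq_gaussianReal_le hσ (hσX.trans (Real.le_coe_toNNReal _)) hlam m
  have hind := hXY.comp
    (φ := fun x : ℝ => ENNReal.ofReal (Real.exp (-((m + x) ^ 2 / lam))))
    (ψ := fun x : ℝ => ENNReal.ofReal (Real.exp (-((n + x) ^ 2 / lam))))
    (by fun_prop) (by fun_prop)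
  have hprod := lintegral_mul_eq_lintegral_mul_lintegral_of_indepFun'' (μ := P)
    (f := fun ω => ENNReal.ofReal (Real.exp (-((m + X ω) ^ 2 / lam))))
    (g := fun ω => ENNReal.ofReal (Real.exp (-((n + Y ω) ^ 2 / lam))))
    (Measurable.comp_aemeasurable (g := fun x : ℝ => ENNReal.ofReal
      (Real.exp (-((m + x) ^ 2 / lam)))) (by fun_prop) hX.aemeasurable)
    (Measurable.comp_aemeasurable (g := fun x : ℝ => ENNReal.ofReal
      (Real.exp (-((n + x) ^ 2 / lam)))) (by fun_prop) hY.aemeasurable) hind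
  have e : ∀ ω, ENNReal.ofReal (Real.exp (-(((m + X ω) ^ 2 + (n + Y ω) ^ 2) / lam)))
      = ENNReal.ofReal (Real.exp (-((m + X ω) ^ 2 / lam))) *
        ENNReal.ofReal (Real.exp (-((n + Y ω) ^ 2 / lam))) := fun ω => by
    rw [← ENNReal.ofReal_mul (Real.exp_pos _).le, ← Real.exp_add]
    congr 2; ring
  simp_rw [e]
  rw [hprod]
  refine (mul_le_mul' (hone m hX hX0 hXσ) (hone n hY hY0 hYσ)).trans_eq ?_
  rw [← ENNReal.ofReal_mul (by positivity), div_mul_div_comm, Real.mul_self_sqrt hlam.le, sq]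

end SmallBall
-- Second moments confined by a quotient of Gaussians
section QuotientMoment

open scoped ENNReal

variable {Ω : Type*} [MeasurableSpace Ω] {P : Measure Ω}

/-- Fubini with the first variable frozen, in place of conditional expectation. -/
theorem lintegral_le_of_indepFun [IsProbabilityMeasure P] {E F : Type*} [MeasurableSpace E]
    [MeasurableSpace F] {f : Ω → E} {g : Ω → F} (hf : AEMeasurable f P) (hg : AEMeasurable g P)
    (hfg : IndepFun f g P) {H : E × F → ℝ≥0∞} (hH : Measurable H) {B : E → ℝ≥0∞}
    (hB : Measurable B) (hHB : ∀ x, ∫⁻ ω, H (x, g ω) ∂P ≤ B x) :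
    ∫⁻ ω, H (f ω, g ω) ∂P ≤ ∫⁻ ω, B (f ω) ∂P := by
  have hprob := Measure.isProbabilityMeasure_map (μ := P) hg
  have h1 : ∫⁻ ω, H (f ω, g ω) ∂P = ∫⁻ p, H p ∂(P.map fun ω => (f ω, g ω)) :=
    (lintegral_map' hH.aemeasurable (hf.prodMk hg)).symm
  rw [h1, (indepFun_iff_map_prod_eq_prod_map_map hf hg).1 hfg, lintegral_prod _ hH.aemeasurable,
    ← lintegral_map' hB.aemeasurable hf]
  refine lintegral_mono fun x => ?_
  exact (lintegral_map' (hH.comp measurable_prodMk_left).aemeasurable hg).trans_le (hHB x)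

/-- Here `p` stands for `|V|`, `q` for `|Z|`, and `S` for a quantity independent of `Z`. If `p ≤
2S`, replacing `p` by `2S` in both places decouples the two. Otherwise `p ≤ 2Lq`, the exponent is at
least `c/(4αL²)`, and `e^{-x} ≤ 1/x` already gives a factor `α`. -/
theorem sq_mul_exp_neg_le {p q S L c α : ℝ} (hp : 0 ≤ p) (hS : 0 < S) (hL : 0 < L)
    (hc : 0 < c) (hα : 0 < α) (h : p ≤ S + L * q) :
    p ^ 2 * Real.exp (-(c * q ^ 2 / (α * p ^ 2)))
      ≤ 4 * S ^ 2 * Real.exp (-(q ^ 2 / (4 * α * S ^ 2 / c))) + 4 * α * L ^ 2 / c * p ^ 2 := by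
  rcases hp.eq_or_lt with rfl | hp0
  · simp only [ne_eq, OfNat.ofNat_ne_zero, not_false_eq_true, zero_pow, zero_mul, mul_zero,
      add_zero]
    positivity
  rcases le_or_gt p (2 * S) with hpS | hpS
  · have hp2 : p ^ 2 ≤ 4 * S ^ 2 := by nlinarith
    have h1 : q ^ 2 / (4 * α * S ^ 2 / c) ≤ c * q ^ 2 / (α * p ^ 2) := by
      rw [div_div_eq_mul_div, mul_comm (q ^ 2)]
      refine div_le_div_of_nonneg_left (by positivity) (by positivity) ?_
      nlinarith
    have h2 := Real.exp_le_exp.2 (neg_le_neg h1)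
    have h3 := mul_le_mul hp2 h2 (Real.exp_pos _).le (by positivity)
    have h4 : 0 ≤ 4 * α * L ^ 2 / c * p ^ 2 := by positivity
    linarith
  · have hpq : p ≤ 2 * L * q := by linarith
    have hp2 : p ^ 2 ≤ 4 * L ^ 2 * q ^ 2 := by nlinarith
    set x := c * q ^ 2 / (α * p ^ 2) with hx
    have hxl : c / (4 * α * L ^ 2) ≤ x := by
      rw [hx, div_le_div_iff₀ (by positivity) (by positivity)]
      nlinarith [mul_le_mul_of_nonneg_left hp2 (mul_pos hc hα).le]
    have h0 : 0 < c / (4 * α * L ^ 2) := by positivity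
    have hexp : Real.exp (-x) ≤ 4 * α * L ^ 2 / c := by
      rw [Real.exp_neg, ← inv_div]
      refine inv_anti₀ h0 ?_
      linarith [Real.add_one_le_exp x]
    have h3 := mul_le_mul_of_nonneg_left hexp (sq_nonneg p)
    have h4 : 0 ≤ 4 * S ^ 2 * Real.exp (-(q ^ 2 / (4 * α * S ^ 2 / c))) := by positivity
    linarith

/-- The residual of the regression of `V` on `X`. -/
noncomputable def residual (P : Measure Ω) (V X : Ω → ℝ) (ω : Ω) : ℝ :=
  V ω - (∫ ω', V ω' * X ω' ∂P) / (∫ ω', X ω' ^ 2 ∂P) * X ω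

theorem integral_residual_sq_le {V X : Ω → ℝ} (hV : MemLp V 2 P) (hX : MemLp X 2 P) :
    ∫ ω, residual P V X ω ^ 2 ∂P ≤ ∫ ω, V ω ^ 2 ∂P := by
  set c := ∫ ω', V ω' * X ω' ∂P with hc
  set q := ∫ ω', X ω' ^ 2 ∂P with hq
  have hq0 : 0 ≤ q := integral_nonneg fun _ => sq_nonneg _
  have i1 : Integrable (fun ω => V ω ^ 2) P := hV.integrable_sq
  have i2 : Integrable (fun ω => X ω ^ 2) P := hX.integrable_sq
  have i3 : Integrable (fun ω => V ω * X ω) P := hV.integrable_mul hX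
  have e : ∀ ω, residual P V X ω ^ 2
      = V ω ^ 2 - (2 * (c / q)) * (V ω * X ω) + (c / q) ^ 2 * X ω ^ 2 := fun ω => by
    rw [residual]; ring
  simp_rw [e]
  have i4 : Integrable (fun ω => V ω ^ 2 - (2 * (c / q)) * (V ω * X ω)) P :=
    i1.sub (i3.const_mul _)
  rw [integral_add i4 (i2.const_mul _), integral_sub i1 (i3.const_mul _), integral_const_mul, integral_const_mul, ← hc, ← hq]
  rcases hq0.eq_or_lt with h | h
  · rw [← h]; simp
  · have : -(2 * (c / q) * c) + (c / q) ^ 2 * q = -(c ^ 2 / q) := by field_simp; ring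
    have h2 : 0 ≤ c ^ 2 / q := by positivity
    linarith

theorem integral_residual_mul_self {V X : Ω → ℝ} (hV : MemLp V 2 P) (hX : MemLp X 2 P)
    (h0 : ∫ ω, X ω ^ 2 ∂P ≠ 0) : ∫ ω, residual P V X ω * X ω ∂P = 0 := by
  have i2 : Integrable (fun ω => X ω ^ 2) P := hX.integrable_sq
  have i3 : Integrable (fun ω => V ω * X ω) P := hV.integrable_mul hX
  have e : ∀ ω, residual P V X ω * X ω = V ω * X ω -
      (∫ ω', V ω' * X ω' ∂P) / (∫ ω', X ω' ^ 2 ∂P) * X ω ^ 2 := fun ω => by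
    rw [residual]; ring
  simp_rw [e]
  rw [integral_sub i3 (i2.const_mul _), integral_const_mul, div_mul_cancel₀ _ h0, sub_self]

theorem integral_residual_mul {V X Y : Ω → ℝ} (hV : MemLp V 2 P) (hX : MemLp X 2 P)
    (hY : MemLp Y 2 P) (hVY : ∫ ω, V ω * Y ω ∂P = 0) (hXY : ∫ ω, X ω * Y ω ∂P = 0) :
    ∫ ω, residual P V X ω * Y ω ∂P = 0 := by
  have i2 : Integrable (fun ω => X ω * Y ω) P := hX.integrable_mul hY
  have i3 : Integrable (fun ω => V ω * Y ω) P := hV.integrable_mul hY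
  have e : ∀ ω, residual P V X ω * Y ω = V ω * Y ω -
      (∫ ω', V ω' * X ω' ∂P) / (∫ ω', X ω' ^ 2 ∂P) * (X ω * Y ω) := fun ω => by
    rw [residual]; ring
  simp_rw [e]
  rw [integral_sub i3 (i2.const_mul _), integral_const_mul, hVY, hXY, mul_zero, sub_self]

theorem abs_regression_le {V X : Ω → ℝ} {v σ : ℝ} (hV : MemLp V 2 P) (hX : MemLp X 2 P)
    (hσ : 0 < σ) (hv : ∫ ω, V ω ^ 2 ∂P ≤ v) (hσX : σ ^ 2 ≤ ∫ ω, X ω ^ 2 ∂P) :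
    |(∫ ω', V ω' * X ω' ∂P) / (∫ ω', X ω' ^ 2 ∂P)| ≤ √v / σ := by
  have hq : 0 < ∫ ω', X ω' ^ 2 ∂P := lt_of_lt_of_le (by positivity) hσX
  refine abs_le_of_sq_le_sq' ?_ (by positivity) |> abs_le.2
  have h := sq_integral_mul_le hV hX
  have h0 : 0 ≤ ∫ ω, V ω ^ 2 ∂P := integral_nonneg fun _ => sq_nonneg _
  rw [div_pow, div_pow, Real.sq_sqrt (h0.trans hv), div_le_div_iff₀ (by positivity) (by positivity)]
  generalize (∫ ω', X ω' ^ 2 ∂P) = q at *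
  generalize (∫ ω', V ω' ^ 2 ∂P) = w at *
  calc _ ≤ (w * q) * σ ^ 2 := by gcongr
    _ ≤ (v * q) * q := by
        have := h0.trans hv
        gcongr
    _ = _ := by ring

variable [IsProbabilityMeasure P]

theorem lintegral_ofReal_mul_pow_four_le {R R' : Ω → ℝ} {B B' k : ℝ}
    (hR : Integrable (fun ω => R ω ^ 4) P) (hR' : Integrable (fun ω => R' ω ^ 4) P)
    (hB : ∫ ω, R ω ^ 4 ∂P ≤ B) (hB' : ∫ ω, R' ω ^ 4 ∂P ≤ B') (a : ℝ) (hk : 0 ≤ k) :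
    ∫⁻ ω, ENNReal.ofReal (k * (a + |R ω| + |R' ω|) ^ 4) ∂P
      ≤ ENNReal.ofReal (k * (27 * (a ^ 4 + B + B'))) := by
  have i1 : Integrable (fun ω => a ^ 4 + R ω ^ 4) P := (integrable_const _).add hR
  have i2 : Integrable (fun ω => a ^ 4 + R ω ^ 4 + R' ω ^ 4) P := i1.add hR'
  have i : Integrable (fun ω => k * (27 * (a ^ 4 + R ω ^ 4 + R' ω ^ 4))) P :=
    (i2.const_mul _).const_mul _
  calc _ ≤ ∫⁻ ω, ENNReal.ofReal (k * (27 * (a ^ 4 + R ω ^ 4 + R' ω ^ 4))) ∂P := by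
        refine lintegral_mono fun ω => ENNReal.ofReal_le_ofReal ?_
        gcongr
        have h4 : ∀ x y z : ℝ, (x + y + z) ^ 4 ≤ 27 * (x ^ 4 + y ^ 4 + z ^ 4) := fun x y z => by
          have h1 : (x + y + z) ^ 2 ≤ 3 * (x ^ 2 + y ^ 2 + z ^ 2) := by
            nlinarith [sq_nonneg (x - y), sq_nonneg (x - z), sq_nonneg (y - z)]
          have h2 := pow_le_pow_left₀ (sq_nonneg _) h1 2
          nlinarith [sq_nonneg (x ^ 2 - y ^ 2), sq_nonneg (x ^ 2 - z ^ 2),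
            sq_nonneg (y ^ 2 - z ^ 2)]
        have h5 := h4 a |R ω| |R' ω|
        rwa [(by decide : Even 4).pow_abs, (by decide : Even 4).pow_abs] at h5
    _ = ENNReal.ofReal (∫ ω, k * (27 * (a ^ 4 + R ω ^ 4 + R' ω ^ 4)) ∂P) :=
        (ofReal_integral_eq_lintegral_ofReal i (ae_of_all _ fun ω => by positivity)).symm
    _ ≤ _ := by
        refine ENNReal.ofReal_le_ofReal ?_
        rw [integral_const_mul, integral_const_mul, integral_add i1 hR',
          integral_add (integrable_const _) hR]
        simp only [integral_const, probReal_univ, one_smul]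
        gcongr

theorem lintegral_ofReal_mul_add_sq_le {V W : Ω → ℝ} {v w b k : ℝ} (hV : MemLp V 2 P)
    (hW : MemLp W 2 P) (hv : ∫ ω, V ω ^ 2 ∂P ≤ v) (hw : ∫ ω, W ω ^ 2 ∂P ≤ w) (hb : 0 ≤ b)
    (hk : 0 ≤ k) :
    ∫⁻ ω, ENNReal.ofReal (k * (b + V ω ^ 2 + W ω ^ 2)) ∂P ≤ ENNReal.ofReal (k * (b + v + w)) := by
  have iV : Integrable (fun ω => V ω ^ 2) P := hV.integrable_sq
  have iW : Integrable (fun ω => W ω ^ 2) P := hW.integrable_sq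
  have i1 : Integrable (fun ω => b + V ω ^ 2) P := (integrable_const _).add iV
  have i2 : Integrable (fun ω => b + V ω ^ 2 + W ω ^ 2) P := i1.add iW
  rw [← ofReal_integral_eq_lintegral_ofReal (i2.const_mul k) (ae_of_all _ fun ω => by positivity)]
  refine ENNReal.ofReal_le_ofReal ?_
  rw [integral_const_mul, integral_add i1 iW, integral_add (integrable_const _) iV]
  simp only [integral_const, probReal_univ, one_smul]
  gcongr

set_option maxHeartbeats 1000000 in
-- Orthogonality leaves only `V` correlated with `Y` and `W` with `X`. Regressing these out gives
-- residuals independent of `(X, Y)`, so `|m+V+iW| ≤ S + L|n+X+iY|` with `S` a function of the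
-- residuals. With `S` frozen, the small ball estimate for `(X, Y)` gives a multiple of `αS⁴`, and
-- fourth moments of residuals are bounded. Only `X` and `Y` need variance bounded below; `V` and
-- `W` may degenerate.
theorem exists_lintegral_sq_mul_exp_le {σ v M c : ℝ} (hσ : 0 < σ) (hv : 0 ≤ v) (hM : 0 ≤ M)
    (hc : 0 < c) (P : Measure Ω) [IsProbabilityMeasure P] :
    ∃ C : ℝ, 0 ≤ C ∧ ∀ X Y V W : Ω → ℝ,
      HasGaussianLaw (fun ω => ![X ω, Y ω, V ω, W ω]) P →
      ∫ ω, X ω ∂P = 0 → ∫ ω, Y ω ∂P = 0 → ∫ ω, V ω ∂P = 0 → ∫ ω, W ω ∂P = 0 →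
      ∫ ω, X ω * Y ω ∂P = 0 → ∫ ω, V ω * X ω ∂P = 0 → ∫ ω, W ω * Y ω ∂P = 0 →
      σ ^ 2 ≤ ∫ ω, X ω ^ 2 ∂P → σ ^ 2 ≤ ∫ ω, Y ω ^ 2 ∂P →
      ∫ ω, V ω ^ 2 ∂P ≤ v → ∫ ω, W ω ^ 2 ∂P ≤ v → ∀ m n : ℂ, ‖m‖ ≤ M → ‖n‖ ≤ M → ∀ α > 0,
      ∫⁻ ω, ENNReal.ofReal (‖m + (V ω + W ω * Complex.I)‖ ^ 2 *
        Real.exp (-(c * ‖n + (X ω + Y ω * Complex.I)‖ ^ 2 /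
          (α * ‖m + (V ω + W ω * Complex.I)‖ ^ 2)))) ∂P ≤ ENNReal.ofReal (C * α) := by
  set ℓ := √v / σ with hℓ
  have hℓ0 : 0 ≤ ℓ := by positivity
  -- Regression coefficients are at most `ℓ`, and `|X|, |Y| ≤ q + M` with `q = |n+X+iY|`; collecting
  -- terms gives `a` and `L`. The summands `1` keep `S` and `L` positive when the rest vanishes.
  set a := 1 + M + 2 * ℓ * M with ha
  have ha0 : 0 < a := by positivity
  set L := 2 * ℓ + 1 with hLdef
  have hκ := fourthMoment_nonneg
  refine ⟨16 / (c * σ ^ 2) * (27 * (a ^ 4 + v ^ 2 * fourthMoment + v ^ 2 * fourthMoment))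
    + 4 * L ^ 2 / c * (3 * (M ^ 2 + v + v)), by positivity, ?_⟩
  intro X Y V W hlaw hX0 hY0 hV0 hW0 hXY hVX hWY hXσ hYσ hVv hWv m n hm hn α hα
  have hgX : HasGaussianLaw X P := hlaw.eval 0
  have hgY : HasGaussianLaw Y P := hlaw.eval 1
  have hgV : HasGaussianLaw V P := hlaw.eval 2
  have hgW : HasGaussianLaw W P := hlaw.eval 3
  have hX2 := hgX.memLp_two
  have hY2 := hgY.memLp_two
  have hV2 := hgV.memLp_two
  have hW2 := hgW.memLp_two
  have hYX : ∫ ω, Y ω * X ω ∂P = 0 := by simp_rw [mul_comm (Y _)]; exact hXY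
  have hqX : ∫ ω, X ω ^ 2 ∂P ≠ 0 := (lt_of_lt_of_le (by positivity) hXσ).ne'
  have hqY : ∫ ω, Y ω ^ 2 ∂P ≠ 0 := (lt_of_lt_of_le (by positivity) hYσ).ne'
  set R := residual P V Y with hR
  set R' := residual P W X with hR'
  set β := (∫ ω', V ω' * Y ω' ∂P) / (∫ ω', Y ω' ^ 2 ∂P) with hβ
  set γ := (∫ ω', W ω' * X ω' ∂P) / (∫ ω', X ω' ^ 2 ∂P) with hγ
  have hβℓ : |β| ≤ ℓ := abs_regression_le hV2 hY2 hσ hVv hYσ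
  have hγℓ : |γ| ≤ ℓ := abs_regression_le hW2 hX2 hσ hWv hXσ
  have hjoint : HasGaussianLaw (fun ω => (fun i => (![R, R'] : Fin 2 → Ω → ℝ) i ω,
      fun j => (![X, Y] : Fin 2 → Ω → ℝ) j ω)) P := by
    have h := hlaw.map_fun ((ContinuousLinearMap.pi (![
        ContinuousLinearMap.proj 2 - β • ContinuousLinearMap.proj 1,
        ContinuousLinearMap.proj 3 - γ • ContinuousLinearMap.proj 0] :
          Fin 2 → ((Fin 4 → ℝ) →L[ℝ] ℝ))).prod
      (ContinuousLinearMap.pi (![ContinuousLinearMap.proj 0, ContinuousLinearMap.proj 1] :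
          Fin 2 → ((Fin 4 → ℝ) →L[ℝ] ℝ))))
    refine h.congr (ae_of_all _ fun ω => ?_)
    refine Prod.ext ?_ ?_ <;> funext i <;> fin_cases i <;>
      simp [hR, hR', residual, hβ, hγ]
  have hgR : HasGaussianLaw R P := hjoint.fst.eval 0
  have hgR' : HasGaussianLaw R' P := hjoint.fst.eval 1
  have hR0 : ∫ ω, R ω ∂P = 0 := by
    simp only [hR, residual]
    rw [integral_sub hgV.integrable (hgY.integrable.const_mul _), integral_const_mul, hV0, hY0]
    simp
  have hR'0 : ∫ ω, R' ω ∂P = 0 := by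
    simp only [hR', residual]
    rw [integral_sub hgW.integrable (hgX.integrable.const_mul _), integral_const_mul, hW0, hX0]
    simp
  have hcov : ∀ {f g : Ω → ℝ}, MemLp f 2 P → MemLp g 2 P → ∫ ω, f ω ∂P = 0 →
      ∫ ω, f ω * g ω ∂P = 0 → cov[f, g; P] = 0 := by
    intro f g hf hg h0 h
    rw [covariance_eq_sub hf hg, h0, zero_mul, sub_zero]
    exact h
  -- For jointly Gaussian vectors it suffices that the four covariances vanish: two do by
  -- construction of the residuals, two by the orthogonality hypotheses.
  have hind : IndepFun (fun ω i => (![R, R'] : Fin 2 → Ω → ℝ) i ω)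
      (fun ω j => (![X, Y] : Fin 2 → Ω → ℝ) j ω) P := by
    refine hjoint.indepFun_of_covariance_eval fun i j => ?_
    fin_cases i <;> fin_cases j
    · exact hcov hgR.memLp_two hX2 hR0 (integral_residual_mul hV2 hY2 hX2 hVX hYX)
    · exact hcov hgR.memLp_two hY2 hR0 (integral_residual_mul_self hV2 hY2 hqY)
    · exact hcov hgR'.memLp_two hX2 hR'0 (integral_residual_mul_self hW2 hX2 hqX)
    · exact hcov hgR'.memLp_two hY2 hR'0 (integral_residual_mul hW2 hX2 hY2 hWY hXY)
  have hXYind : IndepFun X Y P := by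
    have h := hlaw.map_fun ((ContinuousLinearMap.proj 0 : (Fin 4 → ℝ) →L[ℝ] ℝ).prod
      (ContinuousLinearMap.proj 1))
    have h' : HasGaussianLaw (fun ω => (X ω, Y ω)) P :=
      h.congr (ae_of_all _ fun ω => by simp)
    exact h'.indepFun_of_covariance_eq_zero (hcov hX2 hY2 hX0 hXY)
  set S : Ω → ℝ := fun ω => a + |R ω| + |R' ω| with hS
  have hnsq : ∀ ω, ‖n + (X ω + Y ω * Complex.I)‖ ^ 2 = (n.re + X ω) ^ 2 + (n.im + Y ω) ^ 2 := by
    intro ω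
    rw [← Complex.normSq_eq_norm_sq, Complex.normSq_apply]
    simp; ring
  have hbound : ∀ ω, ‖m + (V ω + W ω * Complex.I)‖
      ≤ S ω + L * ‖n + (X ω + Y ω * Complex.I)‖ := by
    intro ω
    set q := ‖n + (X ω + Y ω * Complex.I)‖ with hq
    have hq0 : 0 ≤ q := norm_nonneg _
    have h1 : ‖(X ω + Y ω * Complex.I : ℂ)‖ ≤ q + M := by
      have : (X ω + Y ω * Complex.I : ℂ) = (n + (X ω + Y ω * Complex.I)) - n := by ring
      rw [this]
      exact (norm_sub_le _ _).trans (by linarith)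
    have h2 : |X ω| ≤ q + M := by
      refine le_trans ?_ h1
      simpa using Complex.abs_re_le_norm (X ω + Y ω * Complex.I : ℂ)
    have h3 : |Y ω| ≤ q + M := by
      refine le_trans ?_ h1
      simpa using Complex.abs_im_le_norm (X ω + Y ω * Complex.I : ℂ)
    have h4 : |V ω| ≤ |R ω| + ℓ * (q + M) := by
      have : V ω = R ω + β * Y ω := by simp only [hR, residual]; ring
      rw [this]
      refine (abs_add_le _ _).trans ?_
      rw [abs_mul]
      gcongr
    have h5 : |W ω| ≤ |R' ω| + ℓ * (q + M) := by
      have : W ω = R' ω + γ * X ω := by simp only [hR', residual]; ring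
      rw [this]
      refine (abs_add_le _ _).trans ?_
      rw [abs_mul]
      gcongr
    have h6 : ‖m + (V ω + W ω * Complex.I)‖ ≤ M + (|V ω| + |W ω|) := by
      refine (norm_add_le _ _).trans (add_le_add hm ((norm_add_le _ _).trans ?_))
      simp
    simp only [hS, ha, hLdef]
    linarith
  have hSpos : ∀ ω, 0 < S ω := fun ω => by simp only [hS]; positivity
  have hL : 0 < L := by positivity
  have hpt : ∀ ω, ENNReal.ofReal (‖m + (V ω + W ω * Complex.I)‖ ^ 2 *
        Real.exp (-(c * ‖n + (X ω + Y ω * Complex.I)‖ ^ 2 /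
          (α * ‖m + (V ω + W ω * Complex.I)‖ ^ 2))))
      ≤ ENNReal.ofReal (4 * S ω ^ 2 * Real.exp (-(((n.re + X ω) ^ 2 + (n.im + Y ω) ^ 2) /
          (4 * α * S ω ^ 2 / c))))
        + ENNReal.ofReal (4 * α * L ^ 2 / c * 3 * (M ^ 2 + V ω ^ 2 + W ω ^ 2)) := by
    intro ω
    rw [← ENNReal.ofReal_add (by positivity) (by positivity)]
    refine ENNReal.ofReal_le_ofReal ?_
    refine (sq_mul_exp_neg_le (norm_nonneg _) (hSpos ω) hL hc hα
      (hbound ω)).trans ?_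
    rw [hnsq ω, mul_assoc (4 * α * L ^ 2 / c)]
    gcongr
    have h6 : ‖m + (V ω + W ω * Complex.I)‖ ≤ M + |V ω| + |W ω| := by
      rw [add_assoc]
      refine (norm_add_le _ _).trans (add_le_add hm ((norm_add_le _ _).trans ?_))
      simp
    have h7 := pow_le_pow_left₀ (norm_nonneg _) h6 2
    rw [← sq_abs (V ω), ← sq_abs (W ω)]
    nlinarith [sq_nonneg (M - |V ω|), sq_nonneg (M - |W ω|), sq_nonneg (|V ω| - |W ω|)]
  have hmain : ∫⁻ ω, ENNReal.ofReal (4 * S ω ^ 2 *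
        Real.exp (-(((n.re + X ω) ^ 2 + (n.im + Y ω) ^ 2) / (4 * α * S ω ^ 2 / c)))) ∂P
      ≤ ∫⁻ ω, ENNReal.ofReal (16 * α / (c * σ ^ 2) * S ω ^ 4) ∂P := by
    refine lintegral_le_of_indepFun hjoint.fst.aemeasurable hjoint.snd.aemeasurable hind
      (H := fun p : (Fin 2 → ℝ) × (Fin 2 → ℝ) => ENNReal.ofReal
        (4 * (a + |p.1 0| + |p.1 1|) ^ 2 * Real.exp (-(((n.re + p.2 0) ^ 2 + (n.im + p.2 1) ^ 2) /
          (4 * α * (a + |p.1 0| + |p.1 1|) ^ 2 / c))))) (by fun_prop)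
      (B := fun x => ENNReal.ofReal (16 * α / (c * σ ^ 2) * (a + |x 0| + |x 1|) ^ 4))
      (by fun_prop) fun x => ?_
    set s := a + |x 0| + |x 1| with hs
    have hs0 : 0 < s := by positivity
    have h := lintegral_exp_neg_sq_add_sq_le (lam := 4 * α * s ^ 2 / c) hσ (by positivity) hgX hgY
      hX0 hY0 hXσ hYσ hXYind n.re n.im
    change ∫⁻ ω, ENNReal.ofReal (4 * s ^ 2 * Real.exp (-(((n.re + X ω) ^ 2 + (n.im + Y ω) ^ 2) /
      (4 * α * s ^ 2 / c)))) ∂P ≤ ENNReal.ofReal (16 * α / (c * σ ^ 2) * s ^ 4)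
    simp_rw [ENNReal.ofReal_mul (show 0 ≤ 4 * s ^ 2 by positivity)]
    rw [lintegral_const_mul' _ _ ENNReal.ofReal_ne_top]
    refine (mul_le_mul_right h _).trans_eq ?_
    rw [← ENNReal.ofReal_mul (by positivity)]
    congr 1
    field_simp
    ring
  have hR4 : ∫ ω, R ω ^ 4 ∂P ≤ v ^ 2 * fourthMoment := by
    rw [integral_pow_four_of_centered hgR hR0]
    have h1 := (integral_residual_sq_le hV2 hY2).trans hVv
    have h0 : 0 ≤ ∫ ω, R ω ^ 2 ∂P := integral_nonneg fun _ => sq_nonneg _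
    gcongr
  have hR'4 : ∫ ω, R' ω ^ 4 ∂P ≤ v ^ 2 * fourthMoment := by
    rw [integral_pow_four_of_centered hgR' hR'0]
    have h1 := (integral_residual_sq_le hW2 hX2).trans hWv
    have h0 : 0 ≤ ∫ ω, R' ω ^ 2 ∂P := integral_nonneg fun _ => sq_nonneg _
    gcongr
  have iR := integrable_pow_four_of_hasGaussianLaw hgR
  have iR' := integrable_pow_four_of_hasGaussianLaw hgR'
  have hfirst := lintegral_ofReal_mul_pow_four_le iR iR' hR4 hR'4 a
    (show 0 ≤ 16 * α / (c * σ ^ 2) by positivity)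
  have hsecond := lintegral_ofReal_mul_add_sq_le hV2 hW2 hVv hWv (sq_nonneg M)
    (show 0 ≤ 4 * α * L ^ 2 / c * 3 by positivity)
  calc _ ≤ ∫⁻ ω, (ENNReal.ofReal (4 * S ω ^ 2 * Real.exp (-(((n.re + X ω) ^ 2 + (n.im + Y ω) ^ 2) /
          (4 * α * S ω ^ 2 / c))))
        + ENNReal.ofReal (4 * α * L ^ 2 / c * 3 * (M ^ 2 + V ω ^ 2 + W ω ^ 2))) ∂P :=
        lintegral_mono hpt
    _ = _ := lintegral_add_right' _ (by
        have := hgV.aemeasurable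
        have := hgW.aemeasurable
        fun_prop)
    _ ≤ _ := add_le_add (hmain.trans hfirst) hsecond
    _ = _ := by
        rw [← ENNReal.ofReal_add (by positivity) (by positivity)]
        congr 1
        ring

end QuotientMoment
/-! ### The transform of the signal -/

/-- The deterministic part `∫ f h_{t,η}` of the transform. -/
noncomputable def signalMean (A ξ₀ t η : ℝ) : ℂ :=
  ∫ s : ℝ, signal A ξ₀ s * atom gaussianWindow t η s

theorem norm_signal (A ξ₀ s : ℝ) : ‖signal A ξ₀ s‖ = |A| := by
  have : 2 * Real.pi * Complex.I * ξ₀ * s = ((2 * Real.pi * ξ₀ * s : ℝ) : ℂ) * Complex.I := by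
    push_cast; ring
  rw [signal, norm_mul, this, Complex.norm_exp_ofReal_mul_I, mul_one, Complex.norm_real,
    Real.norm_eq_abs]

theorem continuous_signal (A ξ₀ : ℝ) : Continuous (signal A ξ₀) := by
  unfold signal; fun_prop

theorem norm_atom (t η s : ℝ) :
    ‖atom gaussianWindow t η s‖ = ‖gaussianWindow (s - t)‖ := by
  rw [atom_apply, norm_mul]
  have := norm_modulation η (s - t)
  rw [modulation] at this
  rw [this, mul_one]

theorem integrable_norm_gaussianWindow_sub (t : ℝ) :
    Integrable fun s : ℝ => ‖gaussianWindow (s - t)‖ :=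
  (gaussianWindow.integrable (μ := volume)).norm.comp_sub_right t

theorem norm_signal_mul_atom (A ξ₀ t η s : ℝ) :
    ‖signal A ξ₀ s * atom gaussianWindow t η s‖ = |A| * ‖gaussianWindow (s - t)‖ := by
  rw [norm_mul, norm_signal, norm_atom]

theorem norm_signalMean_le (A ξ₀ t η : ℝ) :
    ‖signalMean A ξ₀ t η‖ ≤ |A| * ∫ s : ℝ, ‖gaussianWindow s‖ := by
  refine (norm_integral_le_integral_norm _).trans_eq ?_
  simp_rw [norm_signal_mul_atom]
  rw [integral_const_mul, integral_sub_right_eq_self (fun s => ‖gaussianWindow s‖)]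

theorem continuous_signalMean (A ξ₀ t : ℝ) : Continuous (signalMean A ξ₀ t) := by
  refine continuous_of_dominated (bound := fun s => |A| * ‖gaussianWindow (s - t)‖)
    (fun η => ?_) (fun η => ae_of_all _ fun s => (norm_signal_mul_atom _ _ _ _ _).le)
    ((integrable_norm_gaussianWindow_sub t).const_mul _) (ae_of_all _ fun s => ?_)
  · exact ((continuous_signal A ξ₀).mul (atom gaussianWindow t η).continuous).aestronglyMeasurable
  · simp_rw [atom_apply]; fun_prop

/-- Sliding the window along a pure exponential only multiplies the transform by a phase, which
makes its `t`-derivative explicit. -/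
theorem signalMean_eq_exp_mul (A ξ₀ t η : ℝ) :
    signalMean A ξ₀ t η
      = Complex.exp (2 * Real.pi * Complex.I * ξ₀ * t) * signalMean A ξ₀ 0 η := by
  rw [signalMean, signalMean, ← integral_const_mul, ← integral_sub_right_eq_self (μ := volume)
    (fun s : ℝ => Complex.exp (2 * Real.pi * Complex.I * ξ₀ * t) *
      (signal A ξ₀ s * atom gaussianWindow 0 η s)) t]
  refine integral_congr_ae (ae_of_all _ fun s => ?_)
  simp only [atom_apply, signal, sub_zero]
  have : Complex.exp (2 * Real.pi * Complex.I * ξ₀ * s)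
      = Complex.exp (2 * Real.pi * Complex.I * ξ₀ * t) *
        Complex.exp (2 * Real.pi * Complex.I * ξ₀ * ((s - t : ℝ) : ℂ)) := by
    rw [← Complex.exp_add]; congr 1; push_cast; ring
  rw [this]; ring

theorem deriv_signalMean (A ξ₀ t η : ℝ) :
    deriv (fun τ => ∫ s : ℝ, signal A ξ₀ s * atom gaussianWindow τ η s) t
      = 2 * Real.pi * Complex.I * ξ₀ * signalMean A ξ₀ t η := by
  have e : (fun τ => ∫ s : ℝ, signal A ξ₀ s * atom gaussianWindow τ η s)
      = fun τ : ℝ => Complex.exp (2 * Real.pi * Complex.I * ξ₀ * τ) * signalMean A ξ₀ 0 η :=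
    funext fun τ => signalMean_eq_exp_mul A ξ₀ τ η
  rw [e, signalMean_eq_exp_mul A ξ₀ t]
  have h1 : HasDerivAt (fun τ : ℝ => 2 * Real.pi * Complex.I * ξ₀ * (τ : ℂ))
      (2 * Real.pi * Complex.I * ξ₀ * 1) t :=
    (Complex.ofRealCLM.hasDerivAt (x := t)).const_mul _
  rw [(h1.cexp.mul_const _).deriv]
  ring

section

variable {Ω : Type*} (Φ : 𝓢(ℝ, ℂ) → Ω → ℂ)

theorem stft_gaussianWindow (A ξ₀ t η : ℝ) (ω : Ω) :
    stft gaussianWindow (signal A ξ₀) Φ t η ω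
      = signalMean A ξ₀ t η + Φ (atom gaussianWindow t η) ω := rfl

theorem dtStft_gaussianWindow (A ξ₀ t η : ℝ) (ω : Ω) :
    dtStft gaussianWindow (signal A ξ₀) Φ t η ω
      = 2 * Real.pi * Complex.I * ξ₀ * signalMean A ξ₀ t η
        + Φ (dtAtom gaussianWindow t η) ω := by
  rw [dtStft, deriv_signalMean]

end

/-! ### Variances of the real and imaginary parts of the noise -/

/-- An odd function times an even one against a symmetric measure. This yields all the orthogonality
relations between the components of `Z` and of `V`. -/
theorem integral_trigPoly_odd_mul_even (k a b c d : ℝ) :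
    ∫ u, trigPoly k (a * Complex.I) b u * trigPoly k c (d * Complex.I) u ∂halfGaussian = 0 := by
  rw [integral_trigPoly_mul_trigPoly]
  simp only [trigPairing, zero_add, one_add_one_eq_two, expMoment_zero, expMoment_one,
    expMoment_two, sub_self]
  generalize Real.exp (-((k + k) ^ 2 / 4)) = Q
  simp [-Complex.ofReal_mul, -Complex.ofReal_div, -Complex.ofReal_sub, -Complex.ofReal_pow]

/-- For `κ = 2πξ` this is the variance of `Re Z` divided by `windowEnergy`. When `k < 1` the odd
coordinates are `k(k-κ) + 1` and `k²`: the first is at least `1/2` if `kκ ≤ 1/2`, and otherwise `k >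
1/(2κ)` bounds the second. -/
theorem exists_le_integral_trigPoly_odd {κ : ℝ} (hκ : 0 < κ) :
    ∃ c : ℝ, 0 < c ∧ ∀ k > 0,
      c ≤ ∫ u, trigPoly k ((k - κ : ℝ) * Complex.I) 1 u ^ 2 ∂halfGaussian := by
  refine ⟨min (1 / 576) (1 / (144 * (16 * κ ^ 4))), by positivity, fun k hk => ?_⟩
  rcases le_or_gt 1 k with h1 | h1
  · refine le_trans ?_ (le_integral_trigPoly_sq_of_one_le h1 _ _)
    refine (min_le_left _ _).trans ?_
    simp
    nlinarith [sq_nonneg (k - κ)]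
  · refine le_trans ?_ (le_integral_trigPoly_sq_of_le_one hk h1.le _ _)
    simp only [Complex.mul_re, Complex.mul_im, Complex.ofReal_re, Complex.ofReal_im, Complex.I_re,
      Complex.I_im, Complex.one_re, Complex.one_im, mul_zero, mul_one, sub_zero, add_zero]
    rcases le_or_gt (k * κ) (1 / 2) with h2 | h2
    · refine (min_le_left _ _).trans ?_
      have h3 : 1 / 2 ≤ k * (k - κ) + 1 := by nlinarith
      nlinarith [sq_nonneg (k ^ 2)]
    · refine (min_le_right _ _).trans ?_
      have h3 : (1 / 2) ^ 4 ≤ (k * κ) ^ 4 := pow_le_pow_left₀ (by norm_num) h2.le 4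
      have h4 : 1 / (144 * (16 * κ ^ 4)) ≤ 1 / 144 * (k ^ 2) ^ 2 := by
        rw [div_le_iff₀ (by positivity)]
        nlinarith
      nlinarith [sq_nonneg (k * (k - κ) + 1)]

/-- The same for `Im Z`: the even coordinates are `k - κ` and `-k`, and `(k-κ)² + k² ≥ κ²/2`. As `k
→ 0` the variance is kept positive by `κ ≠ 0`. -/
theorem exists_le_integral_trigPoly_even {κ : ℝ} (hκ : 0 < κ) :
    ∃ c : ℝ, 0 < c ∧ ∀ k > 0,
      c ≤ ∫ u, trigPoly k (k - κ : ℝ) ((-1 : ℝ) * Complex.I) u ^ 2 ∂halfGaussian := by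
  refine ⟨min (1 / 200) (κ ^ 2 / 288), by positivity, fun k hk => ?_⟩
  rcases le_or_gt 1 k with h1 | h1
  · refine le_trans ?_ (le_integral_trigPoly_sq_of_one_le h1 _ _)
    refine (min_le_left _ _).trans ?_
    simp only [Complex.mul_re, Complex.mul_im, Complex.ofReal_re, Complex.ofReal_im, Complex.I_re,
      Complex.I_im, mul_zero, mul_one, sub_zero, add_zero]
    nlinarith [sq_nonneg (k - κ)]
  · refine le_trans ?_ (le_integral_trigPoly_sq_of_le_one hk h1.le _ _)
    refine (min_le_right _ _).trans ?_
    simp only [Complex.mul_re, Complex.mul_im, Complex.ofReal_re, Complex.ofReal_im, Complex.I_re,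
      Complex.I_im, mul_zero, mul_one, sub_zero, add_zero]
    nlinarith [sq_nonneg (k - κ + k)]

/-! ### Second moment of the synchrosqueezing integrand -/

section Variance

open scoped ENNReal

variable {Ω : Type*} [MeasurableSpace Ω] {P : Measure Ω} [IsProbabilityMeasure P]
  {Φ : 𝓢(ℝ, ℂ) → Ω → ℂ}

theorem IsComplexGaussianWhiteNoise.integral_re_combination
    (hΦ : IsComplexGaussianWhiteNoise Φ P) (φ ψ : 𝓢(ℝ, ℂ)) (a b : ℂ) :
    ∫ ω, (a * Φ φ ω + b * Φ ψ ω).re ∂P = 0 := by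
  have i1 := ((hΦ.memLp φ).integrable (by norm_num)).const_mul a
  have i2 := ((hΦ.memLp ψ).integrable (by norm_num)).const_mul b
  have := Complex.reCLM.integral_comp_comm (i1.add i2)
  simp only [Complex.reCLM_apply, Pi.add_apply] at this
  rw [this, integral_add i1 i2, integral_const_mul, integral_const_mul, hΦ.mean, hΦ.mean]
  simp

/-- Since `ξ - Ω = -Z/(2πiV)`, squaring the modulus doubles the exponent `|Z|²/(4π²α|V|²)`. At `V =
0` both sides vanish, whatever value the quotients take there. -/
theorem enorm_sstIntegrand_sq {Ω : Type*} {Φ : 𝓢(ℝ, ℂ) → Ω → ℂ} (A ξ₀ t ξ α η : ℝ) (hα : 0 < α) (ω : Ω) :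
    ‖sstIntegrand gaussianWindow (signal A ξ₀) Φ t ξ α η ω‖ₑ ^ 2
      = ENNReal.ofReal (((Real.pi * α)⁻¹) ^ 2 * (‖stft gaussianWindow (signal A ξ₀) Φ t η ω‖ ^ 2 *
        Real.exp (-((2 * Real.pi ^ 2)⁻¹ * ‖dtStft gaussianWindow (signal A ξ₀) Φ t η ω
          - 2 * Real.pi * ξ * Complex.I * stft gaussianWindow (signal A ξ₀) Φ t η ω‖ ^ 2 /
            (α * ‖stft gaussianWindow (signal A ξ₀) Φ t η ω‖ ^ 2))))) := by
  have hpi := Real.pi_pos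
  rw [← ofReal_norm, ← ENNReal.ofReal_pow (norm_nonneg _), sstIntegrand, reassignment]
  generalize stft gaussianWindow (signal A ξ₀) Φ t η ω = V
  generalize dtStft gaussianWindow (signal A ξ₀) Φ t η ω = U
  congr 1
  rw [norm_mul, Complex.norm_real, Real.norm_eq_abs, abs_of_nonneg (by positivity), mul_pow,
    mul_pow, ← Real.exp_nat_mul, one_div]
  rcases eq_or_ne V 0 with rfl | hV
  · simp
  have hz : (ξ : ℂ) - 1 / (2 * Real.pi * Complex.I) * (U / V)
      = -((U - 2 * Real.pi * ξ * Complex.I * V) / (2 * Real.pi * Complex.I * V)) := by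
    have : (Real.pi : ℂ) ≠ 0 := by exact_mod_cast hpi.ne'
    field_simp
    ring
  have hn : ‖(2 * Real.pi * Complex.I * V : ℂ)‖ = 2 * Real.pi * ‖V‖ := by
    simp [abs_of_pos hpi]
  rw [hz, norm_neg, norm_div, hn]
  have hV' : 0 < ‖V‖ := norm_pos_iff.2 hV
  have he : ((2 : ℕ) : ℝ) * (-(1 / α) * (‖U - 2 * Real.pi * ξ * Complex.I * V‖ /
      (2 * Real.pi * ‖V‖)) ^ 2) = -((2 * Real.pi ^ 2)⁻¹ *
        ‖U - 2 * Real.pi * ξ * Complex.I * V‖ ^ 2 / (α * ‖V‖ ^ 2)) := by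
    push_cast
    field_simp
  rw [he]
  ring

/-- The prefactor contributes `α⁻²` and the confinement of `Z` gains `α`. The constant is
independent of `η` because the variance bounds for `Z` and the bounds on the means are. -/
theorem exists_lintegral_enorm_sstIntegrand_sq_le (hΦ : IsComplexGaussianWhiteNoise Φ P)
    (A ξ₀ t : ℝ) {ξ : ℝ} (hξ : 0 < ξ) :
    ∃ C : ℝ, 0 ≤ C ∧ ∀ η > 0, ∀ α > 0,
      ∫⁻ ω, ‖sstIntegrand gaussianWindow (signal A ξ₀) Φ t ξ α η ω‖ₑ ^ 2 ∂P
        ≤ ENNReal.ofReal (C * α⁻¹) := by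
  have hpi := Real.pi_pos
  set κ := 2 * Real.pi * ξ with hκdef
  have hκ : 0 < κ := by positivity
  obtain ⟨c₁, hc₁, h₁⟩ := exists_le_integral_trigPoly_odd hκ
  obtain ⟨c₂, hc₂, h₂⟩ := exists_le_integral_trigPoly_even hκ
  have hw := windowEnergy_pos
  set σ := √(windowEnergy * min c₁ c₂) with hσdef
  have hmin : 0 < min c₁ c₂ := lt_min hc₁ hc₂
  have hσ : 0 < σ := Real.sqrt_pos.2 (by positivity)
  have hσ2 : σ ^ 2 = windowEnergy * min c₁ c₂ := Real.sq_sqrt (by positivity)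
  set B := |A| * ∫ s : ℝ, ‖gaussianWindow s‖ with hB
  have hB0 : 0 ≤ B := mul_nonneg (abs_nonneg _) (integral_nonneg fun _ => norm_nonneg _)
  set M := B + 2 * Real.pi * |ξ₀ - ξ| * B with hM
  obtain ⟨C, hC0, hC⟩ := exists_lintegral_sq_mul_exp_le (M := M) (c := (2 * Real.pi ^ 2)⁻¹) hσ
    hw.le (by positivity) (by positivity) P
  refine ⟨(Real.pi⁻¹) ^ 2 * C, by positivity, fun η hη α hα => ?_⟩
  set k := 2 * Real.pi * η with hk
  have hk0 : 0 < k := by positivity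
  set N := Φ (atom gaussianWindow t η) with hN
  set D := Φ (dtAtom gaussianWindow t η) with hD
  -- The coefficients are chosen so that `G 0, G 1` are the real and imaginary parts of the noise in
  -- `Z`, and `G 2, G 3` those of the noise in `V`.
  set a : Fin 4 → ℂ := ![-(κ * Complex.I), -κ, 1, -Complex.I] with ha
  set b : Fin 4 → ℂ := ![1, -Complex.I, 0, 0] with hb
  set G : Fin 4 → Ω → ℝ := fun i ω => (a i * N ω + b i * D ω).re with hG
  have hmean : ∀ i, ∫ ω, G i ω ∂P = 0 := fun i => hΦ.integral_re_combination _ _ _ _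
  have hprod : ∀ i j, ∫ ω, G i ω * G j ω ∂P
      = windowEnergy * ∫ u, trigPoly k (a i + b i * (k * Complex.I)) (b i) u *
        trigPoly k (a j + b j * (k * Complex.I)) (b j) u ∂halfGaussian :=
    fun i j => hΦ.integral_re_combination_mul t η η (a i) (b i) (a j) (b j)
  have hlaw : HasGaussianLaw (fun ω => ![G 0 ω, G 1 ω, G 2 ω, G 3 ω]) P := by
    have h := (hΦ.hasGaussianLaw_pi (ι := Fin 2)
      ![atom gaussianWindow t η, dtAtom gaussianWindow t η]).map_fun
      (ContinuousLinearMap.pi fun i : Fin 4 => Complex.reCLM ∘L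
        (ContinuousLinearMap.mul ℝ ℂ (a i) ∘L
            (ContinuousLinearMap.proj 0 : (Fin 2 → ℂ) →L[ℝ] ℂ)
          + ContinuousLinearMap.mul ℝ ℂ (b i) ∘L
            (ContinuousLinearMap.proj 1 : (Fin 2 → ℂ) →L[ℝ] ℂ)))
    refine h.congr (ae_of_all _ fun ω => ?_)
    funext i
    fin_cases i <;> rfl
  have e0 : a 0 + b 0 * (k * Complex.I) = ((k - κ : ℝ) : ℂ) * Complex.I := by
    simp [ha, hb]; ring
  have e1 : a 1 + b 1 * (k * Complex.I) = ((k - κ : ℝ) : ℂ) := by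
    simp only [ha, hb, Matrix.cons_val_one, Matrix.cons_val_zero]
    push_cast
    linear_combination (-(k : ℂ)) * Complex.I_mul_I
  have e2 : a 2 + b 2 * (k * Complex.I) = ((1 : ℝ) : ℂ) := by simp [ha, hb]
  have e3 : a 3 + b 3 * (k * Complex.I) = ((-1 : ℝ) : ℂ) * Complex.I := by simp [ha, hb]
  have b0 : b 0 = ((1 : ℝ) : ℂ) := by simp [hb]
  have b1 : b 1 = ((-1 : ℝ) : ℂ) * Complex.I := by simp [hb]
  have b2 : b 2 = ((0 : ℝ) : ℂ) * Complex.I := by simp [hb]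
  have b3 : b 3 = ((0 : ℝ) : ℂ) := by simp [hb]
  have hsq : ∀ i, ∫ ω, G i ω ^ 2 ∂P
      = windowEnergy * ∫ u, trigPoly k (a i + b i * (k * Complex.I)) (b i) u ^ 2 ∂halfGaussian := by
    intro i
    simp_rw [sq]
    exact hprod i i
  have hQ : Real.exp (-k ^ 2) ≤ 1 := Real.exp_le_one_iff.2 (by nlinarith)
  have hQ0 := Real.exp_pos (-k ^ 2)
  have key := hC (G 0) (G 1) (G 2) (G 3) hlaw (hmean 0) (hmean 1) (hmean 2) (hmean 3)
    (by rw [hprod, e0, e1, b0, b1, integral_trigPoly_odd_mul_even, mul_zero])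
    (by
      simp_rw [mul_comm (G 2 _)]
      rw [hprod, e0, e2, b0, b2, integral_trigPoly_odd_mul_even, mul_zero])
    (by rw [hprod, e3, e1, b3, b1, integral_trigPoly_odd_mul_even, mul_zero])
    (by
      rw [hsq, hσ2, e0, b0, Complex.ofReal_one]
      gcongr
      exact (min_le_left _ _).trans (h₁ k hk0))
    (by
      rw [hsq, hσ2, e1, b1]
      gcongr
      exact (min_le_right _ _).trans (h₂ k hk0))
    (by
      rw [hsq, e2, b2, integral_trigPoly_sq]
      simp
      nlinarith)
    (by
      rw [hsq, e3, b3, integral_trigPoly_sq]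
      simp
      nlinarith)
    (signalMean A ξ₀ t η) (2 * Real.pi * Complex.I * (ξ₀ - ξ) * signalMean A ξ₀ t η)
    ((norm_signalMean_le A ξ₀ t η).trans (le_add_of_nonneg_right (by positivity)))
    (by
      rw [norm_mul]
      have : ‖(2 * Real.pi * Complex.I * (ξ₀ - ξ) : ℂ)‖ = 2 * Real.pi * |ξ₀ - ξ| := by
        rw [← Complex.ofReal_sub, norm_mul, norm_mul, norm_mul, Complex.norm_real (ξ₀ - ξ)]
        simp [abs_of_pos hpi]
      rw [this]
      have h := norm_signalMean_le A ξ₀ t η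
      calc _ ≤ 2 * Real.pi * |ξ₀ - ξ| * B := by gcongr
        _ ≤ M := le_add_of_nonneg_left hB0) α hα
  have hV : ∀ ω, signalMean A ξ₀ t η + ((G 2 ω : ℂ) + G 3 ω * Complex.I)
      = stft gaussianWindow (signal A ξ₀) Φ t η ω := by
    intro ω
    rw [stft_gaussianWindow]
    congr 1
    apply Complex.ext <;> simp [hG, ha, hb, hN]
  have hZ : ∀ ω, 2 * Real.pi * Complex.I * (ξ₀ - ξ) * signalMean A ξ₀ t η
        + ((G 0 ω : ℂ) + G 1 ω * Complex.I)
      = dtStft gaussianWindow (signal A ξ₀) Φ t η ω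
          - 2 * Real.pi * ξ * Complex.I * stft gaussianWindow (signal A ξ₀) Φ t η ω := by
    intro ω
    have : (G 0 ω : ℂ) + G 1 ω * Complex.I = D ω - κ * Complex.I * N ω := by
      apply Complex.ext
      · simp [hG, ha, hb]; ring
      · simp [hG, ha, hb]; ring
    rw [this, stft_gaussianWindow, dtStft_gaussianWindow, hκdef]
    push_cast
    ring
  simp_rw [hV, hZ] at key
  simp_rw [enorm_sstIntegrand_sq A ξ₀ t ξ α η hα,
    ENNReal.ofReal_mul (show 0 ≤ ((Real.pi * α)⁻¹) ^ 2 by positivity)]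
  rw [lintegral_const_mul' _ _ ENNReal.ofReal_ne_top]
  refine (mul_le_mul_right key _).trans_eq ?_
  rw [← ENNReal.ofReal_mul (by positivity)]
  congr 1
  field_simp

end Variance
/-! ### The synchrosqueezing integrand as a Lipschitz function of the transform -/

/-- `V (πα)⁻¹ exp(-|ξ - (2πi)⁻¹ U/V|²/α)`. -/
noncomputable def squeeze (ξ α : ℝ) (V U : ℂ) : ℂ :=
  V * ((1 / (Real.pi * α) *
    Real.exp (-(1 / α) * ‖(ξ : ℂ) - 1 / (2 * Real.pi * Complex.I) * (U / V)‖ ^ 2) : ℝ) : ℂ)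

theorem measurable_squeeze (ξ α : ℝ) : Measurable fun p : ℂ × ℂ => squeeze ξ α p.1 p.2 := by
  unfold squeeze
  fun_prop

theorem norm_squeeze_le (ξ : ℝ) {α : ℝ} (hα : 0 < α) (V U : ℂ) :
    ‖squeeze ξ α V U‖ ≤ 1 / (Real.pi * α) * ‖V‖ := by
  have hpi := Real.pi_pos
  rw [squeeze, norm_mul, Complex.norm_real, Real.norm_eq_abs, abs_of_nonneg (by positivity),
    mul_comm]
  refine mul_le_mul_of_nonneg_right ?_ (norm_nonneg _)
  refine mul_le_of_le_one_right (by positivity) ?_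
  rw [Real.exp_le_one_iff, neg_mul]
  exact neg_nonpos.2 (by positivity)

/-- The weight `1 + a` pays for the growth of the quotient `U/V` in the Lipschitz estimate. If `b ≤
2a + 1`, the tangent bound and `(a²/α)e^{-a²/α} ≤ 1` suffice; otherwise `b - a` already exceeds `1 +
a`. -/
theorem one_add_mul_exp_sub_exp_le {α a b : ℝ} (hα : 0 < α) (ha : 0 ≤ a) (hab : a ≤ b) :
    (1 + a) * (Real.exp (-(1 / α) * a ^ 2) - Real.exp (-(1 / α) * b ^ 2))
      ≤ (5 + 3 / α) * (b - a) := by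
  set E := Real.exp (-(1 / α) * a ^ 2) with hE
  have hE0 : 0 < E := Real.exp_pos _
  have hE1 : E ≤ 1 := by
    rw [hE, Real.exp_le_one_iff, neg_mul]
    exact neg_nonpos.2 (by positivity)
  have hb0 := Real.exp_pos (-(1 / α) * b ^ 2)
  have h3 : 0 < 3 / α := by positivity
  rcases le_or_gt b (2 * a + 1) with h | h
  · have hEa : a ^ 2 / α * E ≤ 1 := by
      have h1 := Real.add_one_le_exp (a ^ 2 / α)
      have h2 : Real.exp (a ^ 2 / α) * E = 1 := by
        rw [hE, ← Real.exp_add, Real.exp_eq_one_iff]; ring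
      nlinarith
    have hdiff : E - Real.exp (-(1 / α) * b ^ 2) ≤ E * ((b - a) * (b + a) / α) := by
      have h1 := Real.add_one_le_exp (-((b - a) * (b + a) / α))
      have h2 : Real.exp (-(1 / α) * b ^ 2) = E * Real.exp (-((b - a) * (b + a) / α)) := by
        rw [hE, ← Real.exp_add]; congr 1; field_simp; ring
      rw [h2]
      nlinarith
    have hpoly : (1 + a) * (b + a) ≤ 5 * a ^ 2 + 3 := by
      nlinarith [sq_nonneg (a - 1), mul_le_mul_of_nonneg_left h (by linarith : 0 ≤ 1 + a)]
    have hba : 0 ≤ b - a := by linarith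
    calc (1 + a) * (E - Real.exp (-(1 / α) * b ^ 2))
        ≤ (1 + a) * (E * ((b - a) * (b + a) / α)) := by gcongr
      _ = ((1 + a) * (b + a)) * (E * (b - a) / α) := by ring
      _ ≤ (5 * a ^ 2 + 3) * (E * (b - a) / α) := by gcongr
      _ = (5 * (a ^ 2 / α * E) + 3 / α * E) * (b - a) := by ring
      _ ≤ (5 * 1 + 3 / α * 1) * (b - a) := by gcongr
      _ = _ := by ring
  · have h1 : (1 + a) * (E - Real.exp (-(1 / α) * b ^ 2)) ≤ (1 + a) * 1 := by
      gcongr; linarith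
    nlinarith

/-- With `z` the reassigned frequency, changes of `z` are singular like `1/V`, but they appear only
multiplied by `V'`, and `V'(z-z') = (V'-V)z + (U-U')/(2πi)`. The remaining growth in `z` is absorbed
by the Gaussian, provided `z` belongs to the point closer to `ξ`; by symmetry this may be assumed.
-/
theorem exists_norm_squeeze_sub_le {ξ α : ℝ} (hξ : 0 < ξ) (hα : 0 < α) :
    ∃ L : ℝ, 0 ≤ L ∧ ∀ V U V' U' : ℂ,
      ‖squeeze ξ α V U - squeeze ξ α V' U'‖ ≤ L * (‖V - V'‖ + ‖U - U'‖) := by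
  have hpi := Real.pi_pos
  have hpi3 := Real.pi_gt_three
  set K := 5 + 3 / α with hK
  have hK0 : 0 < K := by positivity
  set B := 1 / (Real.pi * α) with hB
  have hB0 : 0 < B := by positivity
  refine ⟨B * (1 + K * (1 + ξ)), by positivity, ?_⟩
  have hKξ : 0 ≤ K * (1 + ξ) := by positivity
  have hzero : ∀ V U U' : ℂ, ‖squeeze ξ α V U - squeeze ξ α 0 U'‖
      ≤ B * (1 + K * (1 + ξ)) * (‖V - 0‖ + ‖U - U'‖) := by
    intro V U U'
    have h0 : squeeze ξ α 0 U' = 0 := by simp [squeeze]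
    rw [h0, sub_zero, sub_zero]
    refine (norm_squeeze_le ξ hα V U).trans ?_
    rw [mul_assoc]
    refine mul_le_mul_of_nonneg_left ?_ hB0.le
    nlinarith [norm_nonneg V, norm_nonneg (U - U'), mul_nonneg hKξ (norm_nonneg V),
      mul_nonneg hKξ (norm_nonneg (U - U'))]
  have hmain : ∀ V U V' U' : ℂ, V ≠ 0 → V' ≠ 0 →
      ‖(ξ : ℂ) - 1 / (2 * Real.pi * Complex.I) * (U / V)‖
        ≤ ‖(ξ : ℂ) - 1 / (2 * Real.pi * Complex.I) * (U' / V')‖ →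
      ‖squeeze ξ α V U - squeeze ξ α V' U'‖
        ≤ B * (1 + K * (1 + ξ)) * (‖V - V'‖ + ‖U - U'‖) := by
    intro V U V' U' hV hV' hab
    set z := 1 / (2 * Real.pi * Complex.I) * (U / V) with hz
    set z' := 1 / (2 * Real.pi * Complex.I) * (U' / V') with hz'
    set a := ‖(ξ : ℂ) - z‖ with ha
    set b := ‖(ξ : ℂ) - z'‖ with hb
    have ha0 : 0 ≤ a := norm_nonneg _
    have hzz : V' * (z - z') = (V' - V) * z + (U - U') / (2 * Real.pi * Complex.I) := by
      rw [hz, hz']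
      have : (Real.pi : ℂ) ≠ 0 := by exact_mod_cast hpi.ne'
      field_simp
      ring
    have hzn : ‖z‖ ≤ ξ + a := by
      have : z = ξ - (ξ - z) := by ring
      rw [this]
      refine (norm_sub_le _ _).trans ?_
      rw [Complex.norm_real, Real.norm_eq_abs, abs_of_pos hξ]
    have hba : b - a ≤ ‖z - z'‖ := by
      have := norm_sub_norm_le ((ξ : ℂ) - z') (ξ - z)
      rwa [sub_sub_sub_cancel_left] at this
    have h1 : ‖V'‖ * (b - a) ≤ (ξ + a) * ‖V - V'‖ + ‖U - U'‖ := by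
      calc ‖V'‖ * (b - a) ≤ ‖V'‖ * ‖z - z'‖ := by gcongr
        _ = ‖(V' - V) * z + (U - U') / (2 * Real.pi * Complex.I)‖ := by rw [← norm_mul, hzz]
        _ ≤ ‖V - V'‖ * ‖z‖ + ‖U - U'‖ := by
            refine (norm_add_le _ _).trans ?_
            rw [norm_mul, norm_sub_rev V' V]
            refine add_le_add le_rfl ?_
            rw [norm_div]
            refine div_le_self (norm_nonneg _) ?_
            simp [abs_of_pos hpi]
            linarith
        _ ≤ (ξ + a) * ‖V - V'‖ + ‖U - U'‖ := by
            rw [mul_comm]; gcongr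
    have h2 := one_add_mul_exp_sub_exp_le hα ha0 hab
    set Ea := Real.exp (-(1 / α) * a ^ 2) with hEa
    set Eb := Real.exp (-(1 / α) * b ^ 2) with hEb
    have hEa0 : 0 < Ea := Real.exp_pos _
    have hEa1 : Ea ≤ 1 := by
      rw [hEa, Real.exp_le_one_iff, neg_mul]
      exact neg_nonpos.2 (by positivity)
    have hEba : Eb ≤ Ea := by
      refine Real.exp_le_exp.2 ?_
      rw [neg_mul, neg_mul, neg_le_neg_iff]
      gcongr
    have h3 : ‖V'‖ * (Ea - Eb) ≤ K * (1 + ξ) * (‖V - V'‖ + ‖U - U'‖) := by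
      have h4 : (1 + a) * (‖V'‖ * (Ea - Eb)) ≤ K * ((ξ + a) * ‖V - V'‖ + ‖U - U'‖) := by
        calc (1 + a) * (‖V'‖ * (Ea - Eb)) = ‖V'‖ * ((1 + a) * (Ea - Eb)) := by ring
          _ ≤ ‖V'‖ * (K * (b - a)) := by gcongr
          _ = K * (‖V'‖ * (b - a)) := by ring
          _ ≤ _ := by gcongr
      have h5 : (ξ + a) * ‖V - V'‖ + ‖U - U'‖
          ≤ (1 + a) * ((1 + ξ) * (‖V - V'‖ + ‖U - U'‖)) := by
        have n1 := norm_nonneg (V - V')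
        have n2 := norm_nonneg (U - U')
        have : (1 + a) * ((1 + ξ) * (‖V - V'‖ + ‖U - U'‖))
          = (ξ + a) * ‖V - V'‖ + ‖U - U'‖ + ((1 + a * ξ) * ‖V - V'‖
            + (a + ξ + a * ξ) * ‖U - U'‖) := by ring
        rw [this]
        exact le_add_of_nonneg_right (by positivity)
      have h6 : (1 + a) * (‖V'‖ * (Ea - Eb))
          ≤ (1 + a) * (K * (1 + ξ) * (‖V - V'‖ + ‖U - U'‖)) := by
        refine h4.trans ((mul_le_mul_of_nonneg_left h5 hK0.le).trans_eq ?_)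
        ring
      exact le_of_mul_le_mul_left h6 (by positivity)
    -- The exponential difference is attached to `V'`, the factor for which `h1` controls `b - a`.
    have hdec : squeeze ξ α V U - squeeze ξ α V' U'
        = ((B * Ea : ℝ) : ℂ) * (V - V') + ((B * (Ea - Eb) : ℝ) : ℂ) * V' := by
      simp only [squeeze, ← hz, ← hz', ← ha, ← hb, ← hB, ← hEa, ← hEb]
      push_cast
      ring
    rw [hdec]
    refine (norm_add_le _ _).trans ?_
    rw [norm_mul, norm_mul, Complex.norm_real, Complex.norm_real, Real.norm_eq_abs,
      Real.norm_eq_abs, abs_of_nonneg (by positivity),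
      abs_of_nonneg (mul_nonneg hB0.le (by linarith))]
    calc B * Ea * ‖V - V'‖ + B * (Ea - Eb) * ‖V'‖
        = B * (Ea * ‖V - V'‖ + ‖V'‖ * (Ea - Eb)) := by ring
      _ ≤ B * (1 * (‖V - V'‖ + ‖U - U'‖) + K * (1 + ξ) * (‖V - V'‖ + ‖U - U'‖)) := by
          gcongr
          exact le_add_of_nonneg_right (norm_nonneg _)
      _ = _ := by ring
  intro V U V' U'
  rcases eq_or_ne V' 0 with rfl | hV'
  · exact hzero V U U'
  rcases eq_or_ne V 0 with rfl | hV
  · rw [norm_sub_rev, norm_sub_rev 0 V', norm_sub_rev U U']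
    exact hzero V' U' U
  rcases le_total ‖(ξ : ℂ) - 1 / (2 * Real.pi * Complex.I) * (U / V)‖
    ‖(ξ : ℂ) - 1 / (2 * Real.pi * Complex.I) * (U' / V')‖ with h | h
  · exact hmain V U V' U' hV hV' h
  · rw [norm_sub_rev, norm_sub_rev V V', norm_sub_rev U U']
    exact hmain V' U' V U hV' hV h

/-! ### Mean square continuity -/

section Continuity

open scoped ENNReal

variable {Ω : Type*} [MeasurableSpace Ω] {P : Measure Ω} [IsProbabilityMeasure P]
  {Φ : 𝓢(ℝ, ℂ) → Ω → ℂ}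

theorem IsComplexGaussianWhiteNoise.integral_norm_sq (hΦ : IsComplexGaussianWhiteNoise Φ P)
    (φ : 𝓢(ℝ, ℂ)) : ∫ ω, ‖Φ φ ω‖ ^ 2 ∂P = ∫ s : ℝ, ‖φ s‖ ^ 2 := by
  have h := hΦ.covariance φ φ
  rw [integral_fourier_mul_conj_fourier] at h
  simp_rw [Complex.mul_conj, Complex.normSq_eq_norm_sq] at h
  rw [integral_complex_ofReal, integral_complex_ofReal] at h
  exact_mod_cast h

/-- The noise is an isometry from `L²(ds)` to `L²(P)`, so mean square continuity reduces to
dominated convergence of test functions. -/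
theorem IsComplexGaussianWhiteNoise.tendsto_eLpNorm_sub (hΦ : IsComplexGaussianWhiteNoise Φ P)
    {φ : ℝ → 𝓢(ℝ, ℂ)} {ψ : 𝓢(ℝ, ℂ)} {η₀ : ℝ} (hc : ∀ s, Continuous fun η => φ η s)
    (hψ : ∀ᶠ η in 𝓝 η₀, ∀ s, ‖φ η s‖ ≤ ‖ψ s‖) :
    Tendsto (fun η => eLpNorm (Φ (φ η) - Φ (φ η₀)) 2 P) (𝓝 η₀) (𝓝 0) := by
  have h_int : Tendsto (fun η => ∫ s : ℝ, ‖φ η s - φ η₀ s‖ ^ 2) (𝓝 η₀) (𝓝 0) := by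
    have h0 : (0 : ℝ) = ∫ s : ℝ, ‖φ η₀ s - φ η₀ s‖ ^ 2 := by simp
    rw [h0]
    refine tendsto_integral_filter_of_dominated_convergence (fun s => 4 * ‖ψ s‖ ^ 2)
      (Eventually.of_forall fun η => ?_) ?_ ?_ (ae_of_all _ fun s => ?_)
    · exact ((((φ η).continuous.sub (φ η₀).continuous).norm).pow 2).aestronglyMeasurable
    · filter_upwards [hψ] with η hη
      refine ae_of_all _ fun s => ?_
      have h1 := norm_sub_le (φ η s) (φ η₀ s)
      have h2 := hη s
      have h3 := hψ.self_of_nhds s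
      rw [Real.norm_eq_abs, abs_of_nonneg (by positivity)]
      nlinarith [norm_nonneg (φ η s - φ η₀ s), norm_nonneg (ψ s)]
    · exact ((ψ.memLp 2 volume).integrable_norm_pow (by norm_num)).const_mul _
    · exact ((((hc s).sub continuous_const).norm).pow 2).tendsto η₀
  have heq : ∀ η, eLpNorm (Φ (φ η) - Φ (φ η₀)) 2 P
      = ENNReal.ofReal ((∫ s : ℝ, ‖φ η s - φ η₀ s‖ ^ 2) ^ (2 : ℝ)⁻¹) := by
    intro η
    have hlin : Φ (φ η) - Φ (φ η₀) =ᵐ[P] Φ (φ η - φ η₀) := by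
      have h := hΦ.grp.linear 1 (-1) (φ η) (φ η₀)
      have e : (1 : ℂ) • φ η + (-1 : ℂ) • φ η₀ = φ η - φ η₀ := by
        rw [one_smul, neg_one_smul, sub_eq_add_neg]
      rw [e] at h
      filter_upwards [h] with ω hω
      rw [hω, Pi.sub_apply]
      ring
    rw [eLpNorm_congr_ae hlin, (hΦ.memLp _).eLpNorm_eq_integral_rpow_norm (by norm_num)
      (by norm_num)]
    have := hΦ.integral_norm_sq (φ η - φ η₀)
    simp only [ENNReal.toReal_ofNat, Real.rpow_ofNat, this]
    rfl
  simp_rw [heq]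
  have h := (h_int.rpow_const (p := (2 : ℝ)⁻¹) (Or.inr (by norm_num)))
  rw [Real.zero_rpow (by norm_num)] at h
  simpa using ENNReal.tendsto_ofReal h

theorem continuous_atom_apply (t s : ℝ) : Continuous fun η => atom gaussianWindow t η s := by
  simp_rw [atom_apply]; fun_prop

theorem continuous_dtAtom_apply (t s : ℝ) : Continuous fun η => dtAtom gaussianWindow t η s := by
  simp_rw [dtAtom_gaussianWindow_apply]; fun_prop

theorem norm_dtAtom (t η s : ℝ) : ‖dtAtom gaussianWindow t η s‖
    = ‖gaussianWindow (s - t)‖ * √((s - t) ^ 2 + (2 * Real.pi * η) ^ 2) := by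
  rw [dtAtom_gaussianWindow_apply, norm_mul, norm_mul, Complex.norm_add_mul_I]
  have : -(((2 * Real.pi * η : ℝ) : ℂ) * Complex.I * ((s - t : ℝ) : ℂ))
      = ((-(2 * Real.pi * η * (s - t)) : ℝ) : ℂ) * Complex.I := by
    push_cast; ring
  rw [this, Complex.norm_exp_ofReal_mul_I, mul_one]

theorem sstIntegrand_eq_squeeze {Ω : Type*} {Φ : 𝓢(ℝ, ℂ) → Ω → ℂ} (A ξ₀ t ξ α η : ℝ) (ω : Ω) :
    sstIntegrand gaussianWindow (signal A ξ₀) Φ t ξ α η ω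
      = squeeze ξ α (signalMean A ξ₀ t η + Φ (atom gaussianWindow t η) ω)
        (2 * Real.pi * Complex.I * ξ₀ * signalMean A ξ₀ t η
          + Φ (dtAtom gaussianWindow t η) ω) := by
  rw [← stft_gaussianWindow, ← dtStft_gaussianWindow]
  rfl

theorem IsComplexGaussianWhiteNoise.memLp_const_add (hΦ : IsComplexGaussianWhiteNoise Φ P)
    (c : ℂ) (φ : 𝓢(ℝ, ℂ)) : MemLp (fun ω => c + Φ φ ω) 2 P :=
  (memLp_const c).add (hΦ.memLp φ)

theorem eLpNorm_const_add_sub_const_add_le (c d : ℂ) {f g : Ω → ℂ} (hf : MemLp f 2 P)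
    (hg : MemLp g 2 P) :
    eLpNorm (fun ω => (c + f ω) - (d + g ω)) 2 P ≤ ‖c - d‖ₑ + eLpNorm (f - g) 2 P := by
  have e : (fun ω => (c + f ω) - (d + g ω)) = (fun _ => c - d) + (f - g) := by
    funext ω; simp; ring
  rw [e]
  refine (eLpNorm_add_le aestronglyMeasurable_const
    (hf.sub hg).aestronglyMeasurable (by norm_num)).trans ?_
  gcongr
  rw [eLpNorm_const _ (by norm_num) (NeZero.ne P)]
  simp

theorem memLp_sstIntegrand (hΦ : IsComplexGaussianWhiteNoise Φ P) (A ξ₀ t ξ : ℝ) {α : ℝ}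
    (hα : 0 < α) (η : ℝ) :
    MemLp (sstIntegrand gaussianWindow (signal A ξ₀) Φ t ξ α η) 2 P := by
  have h1 : MemLp (fun ω => signalMean A ξ₀ t η + Φ (atom gaussianWindow t η) ω) 2 P :=
    hΦ.memLp_const_add _ _
  have h2 : MemLp (fun ω => 2 * Real.pi * Complex.I * ξ₀ * signalMean A ξ₀ t η
      + Φ (dtAtom gaussianWindow t η) ω) 2 P := hΦ.memLp_const_add _ _
  have e : sstIntegrand gaussianWindow (signal A ξ₀) Φ t ξ α η = fun ω =>
      squeeze ξ α (signalMean A ξ₀ t η + Φ (atom gaussianWindow t η) ω)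
        (2 * Real.pi * Complex.I * ξ₀ * signalMean A ξ₀ t η
          + Φ (dtAtom gaussianWindow t η) ω) :=
    funext fun ω => sstIntegrand_eq_squeeze A ξ₀ t ξ α η ω
  rw [e]
  refine h1.of_le_mul ?_ (ae_of_all _ fun ω => norm_squeeze_le ξ hα _ _)
  exact ((measurable_squeeze ξ α).comp_aemeasurable
    (h1.aestronglyMeasurable.aemeasurable.prodMk
      h2.aestronglyMeasurable.aemeasurable)).aestronglyMeasurable

theorem tendsto_eLpNorm_sstIntegrand_sub (hΦ : IsComplexGaussianWhiteNoise Φ P) (A ξ₀ t : ℝ)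
    {ξ α : ℝ} (hξ : 0 < ξ) (hα : 0 < α) (η₀ : ℝ) :
    Tendsto (fun η => eLpNorm (sstIntegrand gaussianWindow (signal A ξ₀) Φ t ξ α η
      - sstIntegrand gaussianWindow (signal A ξ₀) Φ t ξ α η₀) 2 P) (𝓝 η₀) (𝓝 0) := by
  obtain ⟨L, hL0, hL⟩ := exists_norm_squeeze_sub_le hξ hα
  have hN := hΦ.tendsto_eLpNorm_sub (φ := atom gaussianWindow t) (ψ := atom gaussianWindow t 0)
    (η₀ := η₀) (continuous_atom_apply t)
    (Eventually.of_forall fun η s => by rw [norm_atom, norm_atom])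
  -- The modulus of `∂ₜh_{t,η}` increases with `|η|`, so the function at `|η₀| + 1` dominates on the
  -- unit ball around `η₀`.
  have hD := hΦ.tendsto_eLpNorm_sub (φ := dtAtom gaussianWindow t)
    (ψ := dtAtom gaussianWindow t (|η₀| + 1)) (η₀ := η₀) (continuous_dtAtom_apply t) (by
      filter_upwards [Metric.ball_mem_nhds η₀ one_pos] with η hη s
      rw [norm_dtAtom, norm_dtAtom]
      have hle : |η| ≤ |η₀| + 1 := by
        rw [Metric.mem_ball, Real.dist_eq] at hη
        have := abs_sub_abs_le_abs_sub η η₀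
        linarith
      have hsq : η ^ 2 ≤ (|η₀| + 1) ^ 2 := by
        rw [← sq_abs η]
        exact pow_le_pow_left₀ (abs_nonneg _) hle 2
      rw [mul_pow _ η, mul_pow _ (|η₀| + 1)]
      gcongr)
  have hm := continuous_signalMean A ξ₀ t
  have hm1 : Tendsto (fun η => ‖signalMean A ξ₀ t η - signalMean A ξ₀ t η₀‖ₑ) (𝓝 η₀) (𝓝 0) := by
    have h := (hm.sub (continuous_const (y := signalMean A ξ₀ t η₀))).enorm.tendsto η₀
    simpa using h
  have hm2 : Tendsto (fun η => ‖2 * Real.pi * Complex.I * ξ₀ * signalMean A ξ₀ t η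
      - 2 * Real.pi * Complex.I * ξ₀ * signalMean A ξ₀ t η₀‖ₑ) (𝓝 η₀) (𝓝 0) := by
    have h := ((hm.const_mul (2 * Real.pi * Complex.I * ξ₀)).sub
      (continuous_const (y := 2 * Real.pi * Complex.I * ξ₀ * signalMean A ξ₀ t η₀))).enorm.tendsto η₀
    simpa using h
  have hsum := ENNReal.Tendsto.const_mul (a := ENNReal.ofReal L)
    ((hm1.add hN).add (hm2.add hD)) (Or.inr ENNReal.ofReal_ne_top)
  simp only [add_zero, mul_zero] at hsum
  refine tendsto_of_tendsto_of_tendsto_of_le_of_le tendsto_const_nhds hsum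
    (fun η => zero_le) fun η => ?_
  set V : ℝ → Ω → ℂ := fun η ω => signalMean A ξ₀ t η + Φ (atom gaussianWindow t η) ω with hV
  set U : ℝ → Ω → ℂ := fun η ω => 2 * Real.pi * Complex.I * ξ₀ * signalMean A ξ₀ t η
      + Φ (dtAtom gaussianWindow t η) ω with hU
  have mV : ∀ η, MemLp (V η) 2 P := fun η => hΦ.memLp_const_add _ _
  have mU : ∀ η, MemLp (U η) 2 P := fun η => hΦ.memLp_const_add _ _
  calc eLpNorm (sstIntegrand gaussianWindow (signal A ξ₀) Φ t ξ α η
      - sstIntegrand gaussianWindow (signal A ξ₀) Φ t ξ α η₀) 2 P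
      ≤ ENNReal.ofReal L *
        eLpNorm ((fun ω => ‖V η ω - V η₀ ω‖) + fun ω => ‖U η ω - U η₀ ω‖) 2 P := by
        refine eLpNorm_le_mul_eLpNorm_of_ae_le_mul (ae_of_all _ fun ω => ?_) 2
        rw [Pi.sub_apply, sstIntegrand_eq_squeeze, sstIntegrand_eq_squeeze, Pi.add_apply,
          Real.norm_eq_abs, abs_of_nonneg (by positivity)]
        exact hL _ _ _ _
    _ ≤ _ := by
        gcongr
        refine (eLpNorm_add_le ((mV η).sub (mV η₀)).norm.aestronglyMeasurable
          ((mU η).sub (mU η₀)).norm.aestronglyMeasurable (by norm_num)).trans ?_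
        rw [eLpNorm_norm, eLpNorm_norm]
        exact add_le_add (eLpNorm_const_add_sub_const_add_le _ _ (hΦ.memLp _) (hΦ.memLp _))
          (eLpNorm_const_add_sub_const_add_le _ _ (hΦ.memLp _) (hΦ.memLp _))

theorem complexCov_eq_sub {X Z : Ω → ℂ} (hX : MemLp X 2 P) (hZ : MemLp Z 2 P) :
    complexCov X Z P = (∫ ω, X ω * conj (Z ω) ∂P) - (∫ ω, X ω ∂P) * ∫ ω, conj (Z ω) ∂P := by
  have i1 : Integrable (fun ω => X ω * conj (Z ω)) P := hX.integrable_mul hZ.star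
  have i2 : Integrable X P := hX.integrable (by norm_num)
  have i3 : Integrable (fun ω => conj (Z ω)) P := hZ.star.integrable (by norm_num)
  rw [complexCov]
  set x := ∫ ω, X ω ∂P with hx
  have hz : conj (∫ ω, Z ω ∂P) = ∫ ω, conj (Z ω) ∂P := integral_conj.symm
  have e : ∀ ω, (X ω - x) * conj (Z ω - ∫ ω', Z ω' ∂P)
      = X ω * conj (Z ω) - x * conj (Z ω) - X ω * (∫ ω', conj (Z ω') ∂P)
        + x * ∫ ω', conj (Z ω') ∂P := fun ω => by
    rw [map_sub, hz]; ring
  simp_rw [e]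
  have i4 : Integrable (fun ω => X ω * conj (Z ω) - x * conj (Z ω)) P := i1.sub (i3.const_mul _)
  have i5 : Integrable (fun ω => X ω * conj (Z ω) - x * conj (Z ω)
      - X ω * (∫ ω', conj (Z ω') ∂P)) P := i4.sub (i2.mul_const _)
  rw [integral_add i5 (integrable_const _), integral_sub i4 (i2.mul_const _),
    integral_sub i1 (i3.const_mul _), integral_const_mul, integral_mul_const, ← hx]
  simp

/-- The covariance is a polynomial in `L²` inner products of `X`, `Z` and the constant `1`. -/
theorem continuous_complexCov {X Z : ℝ → Ω → ℂ} (hX : ∀ η, MemLp (X η) 2 P)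
    (hZ : ∀ η, MemLp (Z η) 2 P)
    (hXc : ∀ η₀, Tendsto (fun η => eLpNorm (X η - X η₀) 2 P) (𝓝 η₀) (𝓝 0))
    (hZc : ∀ η₀, Tendsto (fun η => eLpNorm (Z η - Z η₀) 2 P) (𝓝 η₀) (𝓝 0)) :
    Continuous fun p : ℝ × ℝ => complexCov (X p.1) (Z p.2) P := by
  have cX : Continuous fun η => (hX η).toLp (X η) := continuous_iff_continuousAt.2 fun η₀ =>
    (Lp.tendsto_Lp_iff_tendsto_eLpNorm'' X hX (X η₀) (hX η₀)).2 (hXc η₀)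
  have cZ : Continuous fun η => (hZ η).toLp (Z η) := continuous_iff_continuousAt.2 fun η₀ =>
    (Lp.tendsto_Lp_iff_tendsto_eLpNorm'' Z hZ (Z η₀) (hZ η₀)).2 (hZc η₀)
  have hone : MemLp (fun _ : Ω => (1 : ℂ)) 2 P := memLp_const _
  have hinner : ∀ {f g : Ω → ℂ} (hf : MemLp f 2 P) (hg : MemLp g 2 P),
      inner ℂ (hf.toLp f) (hg.toLp g) = ∫ ω, g ω * conj (f ω) ∂P := by
    intro f g hf hg
    rw [L2.inner_def]
    refine integral_congr_ae ?_
    filter_upwards [hf.coeFn_toLp, hg.coeFn_toLp] with ω h1 h2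
    rw [h1, h2, RCLike.inner_apply]
  have hrep : ∀ p : ℝ × ℝ, complexCov (X p.1) (Z p.2) P
      = inner ℂ ((hZ p.2).toLp (Z p.2)) ((hX p.1).toLp (X p.1))
        - inner ℂ (hone.toLp _) ((hX p.1).toLp (X p.1)) *
          inner ℂ ((hZ p.2).toLp (Z p.2)) (hone.toLp _) := by
    intro p
    rw [complexCov_eq_sub (hX p.1) (hZ p.2), hinner, hinner, hinner]
    simp
  simp_rw [hrep]
  exact ((cZ.comp continuous_snd).inner (cX.comp continuous_fst)).sub
    ((continuous_const.inner (cX.comp continuous_fst)).mul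
      ((cZ.comp continuous_snd).inner continuous_const))

end Continuity
/-! ### Covariances of the synchrosqueezing integrand -/

section Covariance

open scoped ENNReal

variable {Ω : Type*} [MeasurableSpace Ω] {P : Measure Ω} [IsProbabilityMeasure P]
  {Φ : 𝓢(ℝ, ℂ) → Ω → ℂ}

theorem exists_norm_complexCov_sstIntegrand_le (hΦ : IsComplexGaussianWhiteNoise Φ P)
    (A ξ₀ t : ℝ) {ξ : ℝ} (hξ : 0 < ξ) (Y : ℝ → ℝ → Ω → ℂ)
    (hY : Y = sstIntegrand gaussianWindow (signal A ξ₀) Φ t ξ) :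
    ∃ C : ℝ, 0 ≤ C ∧ ∀ η > 0, ∀ η' > 0, ∀ α > 0,
      ‖complexCov (Y α η) (Y α η') P‖ ≤ C * Real.exp (-((η - η') ^ 2)) * α⁻¹ ∧
      ‖complexCov (Y α η) (fun ω => conj (Y α η' ω)) P‖
        ≤ C * Real.exp (-((η - η') ^ 2)) * α⁻¹ := by
  obtain ⟨C₁, hC₁, h₁⟩ := exists_enorm_integral_mul_sub_sq_le hΦ t
  obtain ⟨C₂, hC₂, h₂⟩ := exists_lintegral_enorm_sstIntegrand_sq_le hΦ A ξ₀ t hξ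
  refine ⟨√C₁ * C₂, by positivity, fun η hη η' hη' α hα => ?_⟩
  have hmem : ∀ η, MemLp (Y α η) 2 P := fun η => hY ▸ memLp_sstIntegrand hΦ A ξ₀ t ξ hα η
  have hvar : ∀ η > 0, ∫⁻ ω, ‖Y α η ω‖ₑ ^ 2 ∂P ≤ ENNReal.ofReal (C₂ * α⁻¹) :=
    fun η hη => hY ▸ h₂ η hη α hα
  set F : ℝ → ℂ × ℂ → ℂ := fun η p => squeeze ξ α (signalMean A ξ₀ t η + p.1)
    (2 * Real.pi * Complex.I * ξ₀ * signalMean A ξ₀ t η + p.2) with hF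
  have hFm : ∀ η, Measurable (F η) := fun η => (measurable_squeeze ξ α).comp
    (g := fun p : ℂ × ℂ => squeeze ξ α p.1 p.2)
    (f := fun p : ℂ × ℂ => (signalMean A ξ₀ t η + p.1,
      2 * Real.pi * Complex.I * ξ₀ * signalMean A ξ₀ t η + p.2)) (by fun_prop)
  have hYF : ∀ η, Y α η = fun ω =>
      F η (Φ (atom gaussianWindow t η) ω, Φ (dtAtom gaussianWindow t η) ω) := fun η => by
    funext ω
    rw [hY, sstIntegrand_eq_squeeze]
  -- Takes the square root of the decorrelation estimate: `e^{-2(η-η')²}` gives `e^{-(η-η')²}`, and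
  -- the two second moments `C₂α⁻¹` give a single `C₂α⁻¹`.
  have hreal : ∀ {z : ℂ}, ‖z‖ₑ ^ 2 ≤ ENNReal.ofReal (C₁ * Real.exp (-(2 * (η - η') ^ 2))) *
      ENNReal.ofReal (C₂ * α⁻¹) * ENNReal.ofReal (C₂ * α⁻¹) →
      ‖z‖ ≤ √C₁ * C₂ * Real.exp (-((η - η') ^ 2)) * α⁻¹ := by
    intro z hz
    rw [← ofReal_norm, ← ENNReal.ofReal_pow (norm_nonneg _), ← ENNReal.ofReal_mul (by positivity),
      ← ENNReal.ofReal_mul (by positivity), ENNReal.ofReal_le_ofReal_iff (by positivity)] at hz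
    refine le_of_sq_le_sq (hz.trans_eq ?_) (by positivity)
    have he : Real.exp (-(2 * (η - η') ^ 2)) = Real.exp (-((η - η') ^ 2)) ^ 2 := by
      rw [← Real.exp_nat_mul]; congr 1; push_cast; ring
    rw [he, mul_pow, mul_pow, mul_pow, Real.sq_sqrt hC₁.le]
    ring
  constructor
  · rw [complexCov_eq_sub (hmem η) (hmem η')]
    refine hreal ((h₁ η hη η' hη' (F η) (fun p => conj (F η' p)) (hFm η)
      (Complex.continuous_conj.measurable.comp (hFm η')) (Y α η) (fun ω => conj (Y α η' ω))
      (hYF η) (by rw [hYF η']) (hmem η) (hmem η').star).trans ?_)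
    refine mul_le_mul' (mul_le_mul' le_rfl (hvar η hη)) (le_trans (le_of_eq ?_) (hvar η' hη'))
    refine lintegral_congr fun ω => ?_
    rw [← ofReal_norm, Complex.norm_conj, ofReal_norm]
  · rw [complexCov_eq_sub (Z := fun ω => conj (Y α η' ω)) (hmem η) (hmem η').star]
    simp only [Complex.conj_conj]
    exact hreal ((h₁ η hη η' hη' (F η) (F η') (hFm η) (hFm η') (Y α η) (Y α η') (hYF η)
      (hYF η') (hmem η) (hmem η')).trans
        (mul_le_mul' (mul_le_mul' le_rfl (hvar η hη)) (hvar η' hη')))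

end Covariance
end SST

/-! ### Continuity and off-diagonal decay of the covariances -/

theorem mainTheorem5 {Ω : Type*} [MeasurableSpace Ω] (P : Measure Ω) [IsProbabilityMeasure P]
    (Φ : 𝓢(ℝ, ℂ) → Ω → ℂ) (hΦ : SST.IsComplexGaussianWhiteNoise Φ P)
    (A ξ₀ : ℝ) (hA : 0 ≤ A) (hξ₀ : 0 < ξ₀) (t ξ : ℝ) (hξ : 0 < ξ)
    (Y : ℝ → ℝ → Ω → ℂ)
    (hY : Y = SST.sstIntegrand SST.gaussianWindow (SST.signal A ξ₀) Φ t ξ) :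
    (∀ α : ℝ, 0 < α →
      (∀ η > 0, MemLp (Y α η) 2 P) ∧
      ContinuousOn (fun p : ℝ × ℝ => SST.complexCov (Y α p.1) (Y α p.2) P)
        (Set.Ioi 0 ×ˢ Set.Ioi 0) ∧
      ContinuousOn (fun p : ℝ × ℝ => SST.complexCov (Y α p.1) (fun ω => conj (Y α p.2 ω)) P)
        (Set.Ioi 0 ×ˢ Set.Ioi 0)) ∧
    ∃ α₀ : ℝ, 0 < α₀ ∧ ∃ K : ℝ → ℝ → ℝ,
      (∀ η > 0, ∀ η' > 0, η ≠ η' → ∀ α, 0 < α → α < α₀ →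
        ‖SST.complexCov (Y α η) (Y α η') P‖ ≤ K η η' * α⁻¹ ∧
        ‖SST.complexCov (Y α η) (fun ω => conj (Y α η' ω)) P‖ ≤ K η η' * α⁻¹) ∧
      (∀ δ : ℝ, 0 < δ → ∃ D C : ℝ, ∀ η ≥ δ, ∀ η' ≥ δ, D ≤ |η - η'| →
        K η η' ≤ C * ((η + η') ^ 2 * Real.exp (-((η - η') ^ 2)))) ∧
      (∃ δ : ℝ, 0 < δ ∧ ∃ D C : ℝ, ∀ η η' : ℝ, 0 < η → η < δ → 0 < η' → D ≤ |η - η'| →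
        K η η' ≤ C * ((η + η') ^ 2 * η ^ (-(1 / 2) : ℝ) * Real.exp (-((η - η') ^ 2)))) ∧
      (∃ δ : ℝ, 0 < δ ∧ ∃ D C : ℝ, ∀ η η' : ℝ, 0 < η → 0 < η' → η' < δ → D ≤ |η - η'| →
        K η η' ≤ C * ((η + η') ^ 2 * η' ^ (-(1 / 2) : ℝ) * Real.exp (-((η - η') ^ 2)))) := by
  constructor
  · intro α hα
    have hmem : ∀ η, MemLp (Y α η) 2 P := fun η => hY ▸ SST.memLp_sstIntegrand hΦ A ξ₀ t ξ hα η
    have hcont : ∀ η₀, Tendsto (fun η => eLpNorm (Y α η - Y α η₀) 2 P) (𝓝 η₀) (𝓝 0) :=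
      fun η₀ => hY ▸ SST.tendsto_eLpNorm_sstIntegrand_sub hΦ A ξ₀ t hξ hα η₀
    refine ⟨fun η _ => hmem η, (SST.continuous_complexCov hmem hmem hcont hcont).continuousOn,
      (SST.continuous_complexCov (Z := fun η ω => conj (Y α η ω)) hmem (fun η => (hmem η).star)
        hcont fun η₀ => (hcont η₀).congr fun η => ?_).continuousOn⟩
    refine eLpNorm_congr_norm_ae (ae_of_all _ fun ω => ?_)
    rw [Pi.sub_apply, Pi.sub_apply, ← map_sub, Complex.norm_conj]
  · obtain ⟨C, hC0, hC⟩ := SST.exists_norm_complexCov_sstIntegrand_le hΦ A ξ₀ t hξ Y hY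
    -- For positive frequencies `η + η' ≥ |η-η'|`, so the choice `D = 1` makes the factor `(η+η')²`
    -- harmless.
    have hsum : ∀ η η' : ℝ, 0 < η → 0 < η' → 1 ≤ |η - η'| → 1 ≤ (η + η') ^ 2 := by
      intro η η' hη hη' h
      have : |η - η'| ≤ η + η' := abs_sub_le_iff.2 ⟨by linarith, by linarith⟩
      nlinarith
    have hpow : ∀ η : ℝ, 0 < η → η < 1 → 1 ≤ η ^ (-(1 / 2) : ℝ) := fun η h0 h1 =>
      Real.one_le_rpow_of_pos_of_le_one_of_nonpos h0 h1.le (by norm_num)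
    -- The bound holds for every `α > 0`, so `α₀ = 1` is arbitrary. Taking `δ = 1` in the last two
    -- clauses makes the powers with exponent `-1/2` at least `1`.
    refine ⟨1, one_pos, fun η η' => C * Real.exp (-((η - η') ^ 2)),
      fun η hη η' hη' _ α hα _ => hC η hη η' hη' α hα, ?_, ?_, ?_⟩
    · intro δ hδ
      refine ⟨1, C, fun η hη η' hη' h => ?_⟩
      have h1 := hsum η η' (hδ.trans_le hη) (hδ.trans_le hη') h
      refine mul_le_mul_of_nonneg_left ?_ hC0
      exact le_mul_of_one_le_left (Real.exp_pos _).le h1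
    · refine ⟨1, one_pos, 1, C, fun η η' hη hη1 hη' h => ?_⟩
      have h1 := hsum η η' hη hη' h
      refine mul_le_mul_of_nonneg_left ?_ hC0
      exact le_mul_of_one_le_left (Real.exp_pos _).le (one_le_mul_of_one_le_of_one_le h1
        (hpow η hη hη1))
    · refine ⟨1, one_pos, 1, C, fun η η' hη hη' hη1 h => ?_⟩
      have h1 := hsum η η' hη hη' h
      refine mul_le_mul_of_nonneg_left ?_ hC0
      exact le_mul_of_one_le_left (Real.exp_pos _).le (one_le_mul_of_one_le_of_one_le h1
        (hpow η' hη' hη1))
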